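/- All objects are real-analytic. Let $k,n\ge 0$ be integers, let $M$ be a real-analytic manifold of dimension $m=k(n+1)$, and let $\{w(t)\}_{t\in\mathbb{RP}^1}$, $\mathbb{RP}^1=\mathbb R\cup\{\infty\}$, be a generalized Veronese curve of distributions of codimension $k$ on $M$: near every point of $M$ there is a coframe $\{\gamma^i_j\}_{1\le i\le k,\,0\le j\le n}$ such that for every $t$ the subbundle $w(t)\subset TM$ is the common kernel of the 1-forms $\gamma^i(t)=\gamma^i_0+t\gamma^i_1+\dots+t^n\gamma^i_n$, $1\le i\le k$, where $\gamma^i(\infty):=\gamma^i_n$. Assume that every $w(t)$, $t\in\mathbb{RP}^1$, is integrable, i.e. satisfies the Frobenius condition. For an open set $U\subset M$ let $U^{\mathbb C}$ be the germ along $U$ of a complexification of $U$ (a complex manifold of complex dimension $m$ in which $U$ is real-analytically embedded as a totally real submanifold), let $J$ be the complex structure operator on its real tangent bundle $TU^{\mathbb C}$, and for a real-analytic function $\phi$ on $U$ let $\phi^c$ be the germ along $U$ of the holomorphic function on $U^{\mathbb C}$ extending $\phi$. For $t=\infty$ we interpret both $(\mathrm{Id}+tJ)F$ and $(\mathrm{Id}-tJ)F$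 as $JF$. Then for every $x\in M$ there are an analytic coordinate chart $(U,\phi)$, $x\in U$, $\phi=(\phi_1,\dots,\phi_m)$, and a germ along $U$ of an integrable distribution $F\subset TU^{\mathbb C}$ such that for every $t\in\mathbb{RP}^1$: 1. the distribution $(\mathrm{Id}+tJ)F\subset TU^{\mathbb C}$ is integrable; 2. $\operatorname{rank}\,(\mathrm{Id}+tJ)F=kn=\operatorname{rank} w(t)$; 3. $(\mathrm{Id}+tJ)F$ is projectable onto $U$ along the foliation $\mathcal Y=\{\operatorname{Re}\phi^c_1=\mathrm{const},\dots,\operatorname{Re}\phi^c_m=\mathrm{const}\}$, i.e. its image under the differential of the projection $\pi:U^{\mathbb C}\to U$ along $\mathcal Y$ is a well-defined integrable distribution on $U$; 4. the projection of $(\mathrm{Id}-tJ)F$ coincides with $w(t)|_U$. -/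

import Mathlib

open Set
open scoped Manifold ContDiff Topology

namespace VeroneseWeb

/-! ### Analytic distributions on real-analytic manifolds -/

section Distributions

variable {E : Type*} [NormedAddCommGroup E] [NormedSpace ℝ E]
  {H : Type*} [TopologicalSpace H] (I : ModelWithCorners ℝ E H)
  {M : Type*} [TopologicalSpace M] [ChartedSpace H M] [IsManifold I ω M]

/-- The vector field `X` is real-analytic on the set `V`. -/
def AnalyticVectorFieldOn (X : (x : M) → TangentSpace I x) (V : Set M) : Prop :=
  ContMDiffOn I I.tangent ω (fun x => (⟨x, X x⟩ : TangentBundle I M)) V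

/-- The 1-form `α` is real-analytic on the set `V`: it is an analytic section of the bundle of
continuous linear maps from the tangent bundle to the trivial line bundle. -/
def AnalyticOneFormOn (α : (x : M) → TangentSpace I x →L[ℝ] ℝ) (V : Set M) : Prop :=
  ContMDiffOn I (I.prod 𝓘(ℝ, E →L[ℝ] ℝ)) ω
    (fun x => Bundle.TotalSpace.mk' (E →L[ℝ] ℝ)
      (E := fun x : M => TangentSpace I x →L[ℝ] Bundle.Trivial M ℝ x) x (α x)) V

/-- On the set `Ω`, the family `D` of subspaces of the tangent spaces is a real-analytic
distribution (subbundle of the tangent bundle) of rank `r`: near every point of `Ω` it has an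
analytic frame consisting of `r` vector fields. -/
def IsDistributionOn (D : (x : M) → Submodule ℝ (TangentSpace I x)) (r : ℕ) (Ω : Set M) : Prop :=
  ∀ p ∈ Ω, ∃ V : Set M, IsOpen V ∧ p ∈ V ∧ ∃ X : Fin r → (x : M) → TangentSpace I x,
    (∀ i, AnalyticVectorFieldOn I (X i) V) ∧
    ∀ q ∈ V, LinearIndependent ℝ (fun i => X i q) ∧
      D q = Submodule.span ℝ (Set.range fun i => X i q)

/-- Integrability (Frobenius condition) of the distribution `D` on the open set `Ω`: the Lie
bracket of any two local analytic sections of `D` is again a section of `D`. -/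
def IsIntegrableOn (D : (x : M) → Submodule ℝ (TangentSpace I x)) (Ω : Set M) : Prop :=
  ∀ V : Set M, IsOpen V → V ⊆ Ω → ∀ X Y : (x : M) → TangentSpace I x,
    AnalyticVectorFieldOn I X V → AnalyticVectorFieldOn I Y V →
    (∀ q ∈ V, X q ∈ D q) → (∀ q ∈ V, Y q ∈ D q) →
    ∀ q ∈ V, VectorField.mlieBracket I X Y q ∈ D q

end Distributions

/-! ### Generalized Veronese curves of distributions

The real projective line is `OnePoint ℝ = ℝ ∪ {∞}`. -/

section VeroneseCurves

/-- The value at `t` of the polynomial curve `γ_0 + t γ_1 + ⋯ + t ^ n γ_n`, with value `γ_n` at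
`t = ∞`. -/
noncomputable def veroneseValue {V : Type*} [AddCommGroup V] [Module ℝ V] {n : ℕ}
    (γ : Fin (n + 1) → V) (t : OnePoint ℝ) : V :=
  t.elim (γ (Fin.last n)) (fun s => ∑ j : Fin (n + 1), s ^ (j : ℕ) • γ j)

variable (k n : ℕ) {M : Type*} [TopologicalSpace M]
  [ChartedSpace (EuclideanSpace ℝ (Fin (k * (n + 1)))) M] [IsManifold (𝓡 (k * (n + 1))) ω M]

/-- `w` is a generalized Veronese curve of distributions of codimension `k` on the manifold `M` of
dimension `k * (n + 1)`: locally there is an analytic coframe `γ i j` (`1 ≤ i ≤ k`, `0 ≤ j ≤ n`)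
such that `w t` is, for every `t`, the common kernel of the `k` (automatically independent) 1-forms
`γ i 0 + t γ i 1 + ⋯ + t ^ n γ i n`. As `M` has dimension `k * (n + 1)`, linear independence
of the `γ i j` at a point means that they are a basis of the cotangent space. -/
def IsGeneralizedVeroneseCurve
    (w : OnePoint ℝ → (x : M) → Submodule ℝ (TangentSpace (𝓡 (k * (n + 1))) x)) : Prop :=
  ∀ p : M, ∃ V : Set M, IsOpen V ∧ p ∈ V ∧
    ∃ γ : Fin k → Fin (n + 1) → (x : M) → TangentSpace (𝓡 (k * (n + 1))) x →L[ℝ] ℝ,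
      (∀ i j, AnalyticOneFormOn (𝓡 (k * (n + 1))) (γ i j) V) ∧
      (∀ q ∈ V, LinearIndependent ℝ (fun ij : Fin k × Fin (n + 1) => γ ij.1 ij.2 q)) ∧
      ∀ t, ∀ q ∈ V, ∀ v : TangentSpace (𝓡 (k * (n + 1))) q,
        v ∈ w t q ↔ ∀ i, veroneseValue (fun j => γ i j q) t v = 0

end VeroneseCurves

/-! ### Complex manifolds and complexifications -/

section Complexification

variable {m : ℕ} {Z : Type*} [TopologicalSpace Z] [ChartedSpace (EuclideanSpace ℂ (Fin m)) Z]

/-- The real-analytic manifold underlying a complex manifold. -/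
instance isManifold_real [IsManifold 𝓘(ℂ, EuclideanSpace ℂ (Fin m)) ω Z] :
    IsManifold 𝓘(ℝ, EuclideanSpace ℂ (Fin m)) ω Z := by
  apply isManifold_of_contDiffOn
  intro e e' he he'
  have h := (contDiffGroupoid ω 𝓘(ℂ, EuclideanSpace ℂ (Fin m))).compatible he he'
  rw [contDiffGroupoid, mem_groupoid_of_pregroupoid] at h
  exact ContDiffOn.restrict_scalars ℝ h.1

/-- The complex structure operator `J` on the real tangent spaces of a complex manifold:
multiplication by the imaginary unit (which does not depend on the holomorphic chart). -/
noncomputable def J (z : Z) :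
    TangentSpace 𝓘(ℝ, EuclideanSpace ℂ (Fin m)) z →L[ℝ]
      TangentSpace 𝓘(ℝ, EuclideanSpace ℂ (Fin m)) z :=
  (Complex.I • ContinuousLinearMap.id ℝ (EuclideanSpace ℂ (Fin m)) :
    EuclideanSpace ℂ (Fin m) →L[ℝ] EuclideanSpace ℂ (Fin m))

/-- The operator `Id + t J`, which stands for `J` if `t = ∞`. -/
noncomputable def idAddJ (t : OnePoint ℝ) (z : Z) :
    TangentSpace 𝓘(ℝ, EuclideanSpace ℂ (Fin m)) z →L[ℝ]
      TangentSpace 𝓘(ℝ, EuclideanSpace ℂ (Fin m)) z :=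
  t.elim (J z) (fun s => ContinuousLinearMap.id ℝ _ + s • J z)

/-- The operator `Id - t J`, which stands for `-J` if `t = ∞` (as `J` and `-J` have the same
effect on subspaces, the sign is immaterial). -/
noncomputable def idSubJ (t : OnePoint ℝ) (z : Z) :
    TangentSpace 𝓘(ℝ, EuclideanSpace ℂ (Fin m)) z →L[ℝ]
      TangentSpace 𝓘(ℝ, EuclideanSpace ℂ (Fin m)) z :=
  t.elim (-J z) (fun s => ContinuousLinearMap.id ℝ _ - s • J z)

variable {M : Type*} [TopologicalSpace M] [ChartedSpace (EuclideanSpace ℝ (Fin m)) M]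

/-- The map `ι` makes the complex manifold `Z` a complexification of the open subset `U` of the
real-analytic manifold `M`, `dim_ℂ Z = dim_ℝ M`: it is a real-analytic embedding of `U` as a
totally real submanifold of `Z`. -/
structure IsComplexification (m : ℕ)
    {Z : Type*} [TopologicalSpace Z] [ChartedSpace (EuclideanSpace ℂ (Fin m)) Z]
    {M : Type*} [TopologicalSpace M] [ChartedSpace (EuclideanSpace ℝ (Fin m)) M]
    (U : Set M) (ι : M → Z) : Prop where
  analytic : ContMDiffOn (𝓡 m) 𝓘(ℝ, EuclideanSpace ℂ (Fin m)) ω ι U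
  embedding : Topology.IsEmbedding (U.domRestrict ι)
  immersion : ∀ x ∈ U,
    Function.Injective (mfderiv (𝓡 m) 𝓘(ℝ, EuclideanSpace ℂ (Fin m)) ι x)
  totallyReal : ∀ x ∈ U, ∀ u v : TangentSpace (𝓡 m) x,
    mfderiv (𝓡 m) 𝓘(ℝ, EuclideanSpace ℂ (Fin m)) ι x u =
      J (ι x) (mfderiv (𝓡 m) 𝓘(ℝ, EuclideanSpace ℂ (Fin m)) ι x v) → u = 0 ∧ v = 0

/-- `φc`, on the open neighbourhood `Ω` of `ι '' U` in `Z`, represents the germ of the holomorphic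
extension `(φ_1^c, …, φ_m^c)` of the functions `φ_1, …, φ_m` on `U`. -/
structure IsHolomorphicExtension (U : Set M) (ι : M → Z) (φ : M → EuclideanSpace ℝ (Fin m))
    (Ω : Set Z) (φc : Z → EuclideanSpace ℂ (Fin m)) : Prop where
  isOpen : IsOpen Ω
  image_subset : ι '' U ⊆ Ω
  holomorphic :
    ContMDiffOn 𝓘(ℂ, EuclideanSpace ℂ (Fin m)) 𝓘(ℂ, EuclideanSpace ℂ (Fin m)) ω φc Ω
  extends_coord : ∀ x ∈ U, ∀ j, φc (ι x) j = (φ x j : ℂ)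

/-- The vector `(Re φ_1^c, …, Re φ_m^c)`, whose level sets are the leaves of the foliation
`{Re φ_1^c = const, …, Re φ_m^c = const}`. -/
noncomputable def rePart (φc : Z → EuclideanSpace ℂ (Fin m)) (z : Z) : EuclideanSpace ℝ (Fin m) :=
  WithLp.toLp 2 (fun j => (φc z j).re)

/-- The projection onto the coordinate domain `U = φ.source` along the foliation
`{Re φ_1^c = const, …, Re φ_m^c = const}`: the point `z` goes to the point of `U` with coordinates
`Re φ_j^c z`, where the leaf of `z` meets `U`. -/
noncomputable def leafProjection (φ : OpenPartialHomeomorph M (EuclideanSpace ℝ (Fin m)))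
    (φc : Z → EuclideanSpace ℂ (Fin m)) (z : Z) : M :=
  φ.symm (rePart φc z)

/-- The differential of `π : Z → M` maps the subspace `D z` onto `D' (π z)` for all `z ∈ Ω`: the
projection of the distribution `D` along the fibres of `π` coincides with `D'`. -/
def ProjectsOnto (π : Z → M) (Ω : Set Z)
    (D : (z : Z) → Submodule ℝ (TangentSpace 𝓘(ℝ, EuclideanSpace ℂ (Fin m)) z))
    (D' : (x : M) → Submodule ℝ (TangentSpace (𝓡 m) x)) : Prop :=
  ∀ z ∈ Ω, (D z).map
    (mfderiv 𝓘(ℝ, EuclideanSpace ℂ (Fin m)) (𝓡 m) π z).toLinearMap = D' (π z)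

/-- The distribution `D` on `Ω` is projectable on `U` along the fibres of `π`: it projects onto a
well-defined integrable analytic distribution on `U`. -/
def IsProjectable [IsManifold (𝓡 m) ω M] (π : Z → M) (Ω : Set Z) (U : Set M)
    (D : (z : Z) → Submodule ℝ (TangentSpace 𝓘(ℝ, EuclideanSpace ℂ (Fin m)) z)) : Prop :=
  ∃ D' : (x : M) → Submodule ℝ (TangentSpace (𝓡 m) x),
    (∃ r, IsDistributionOn (𝓡 m) D' r U) ∧ IsIntegrableOn (𝓡 m) D' U ∧ ProjectsOnto π Ω D D'

end Complexification

end VeroneseWeb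

/-! Work with γ(t) = γ_0 + tγ_1 + … + tⁿγ_n as an ℝᵏ-valued form. The Frobenius theorem at the n+1
nodes t = 0, …, n yields k first integrals for each; by a Vandermonde argument together they are
coordinates φ (`exists_rectifying_chart`). In them w(l) is the common kernel of the differentials of
the l-th block. Let S be the constant operator that multiplies the l-th block by l (`blockScale`).

For fixed b the polynomial γ(t)((t - S)b) has degree at most n+1 and vanishes at the nodes, hence
equals ∏(t - l) · γ_n(b) (`curveEval_pencil`). So t - S maps w(∞) into w(t), and a second
Vandermonde argument makes it an isomorphism.

Take F to consist of the vectors v with dφᶜ v = (i - S)b, where b lies in w(∞) at the point of U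
with coordinates Re φᶜ. In these coordinates Id ± tJ is multiplication by c = 1 ± ti. Since Re((1 -
ti)(i - S)b) = (t - S)b, the projection of (Id - tJ)F is w(t), and that of (Id + tJ)F is w(-t).

It remains to see that c(i - S)w(∞) is integrable for every c ≠ 0 (`isIntegrableOn_slantField`). As
S is constant, this reduces to the symmetry in b, b' ∈ w(∞) of dγ_n(b)b' and of dγ_n(Sb)b', where d
is the coordinate derivative of the coefficients. The first is integrability of w(∞). The second
follows from it and integrability at one more parameter, t = -1 (`fderiv_symm_operator`).

The analytic Frobenius theorem is itself proved here (`exists_first_integral`): horizontal lifts of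
segments solve an integral equation in a space of continuous functions, the analytic inverse
function theorem solves it with analytic dependence on the initial data, and Grönwall's inequality
shows that the endpoint map carries horizontal directions into the distribution. -/

/-! ### Analyticity of superposition operators. -/

section Superposition

variable {X : Type*} [TopologicalSpace X] [CompactSpace X]
  {E F : Type*} [NormedAddCommGroup E] [NormedSpace ℝ E] [NormedAddCommGroup F] [NormedSpace ℝ F]

/-- The power series on the space of continuous functions obtained by applying a power series
pointwise. -/
noncomputable def FormalMultilinearSeries.pointwise (X : Type*) [TopologicalSpace X]
    [CompactSpace X] (p : FormalMultilinearSeries ℝ E F) :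
    FormalMultilinearSeries ℝ C(X, E) C(X, F) := fun n =>
  MultilinearMap.mkContinuous
    { toFun := fun h => ⟨fun s => p n (fun i => h i s), by fun_prop⟩
      map_update_add' := by
        intro _ h i a b
        ext s
        have key : ∀ c : C(X, E), (fun j => Function.update h i c j s) =
            Function.update (fun j => h j s) i (c s) := by
          intro c; ext j
          by_cases hj : j = i
          · subst hj; simp
          · simp [hj]
        simp [key]
      map_update_smul' := by
        intro _ h i a b
        ext s
        have key : ∀ c : C(X, E), (fun j => Function.update h i c j s) =
            Function.update (fun j => h j s) i (c s) := by
          intro c; ext j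
          by_cases hj : j = i
          · subst hj; simp
          · simp [hj]
        simp [key] }
    ‖p n‖ (by
      intro h
      rw [ContinuousMap.norm_le _ (by positivity)]
      intro s
      refine ((p n).le_opNorm _).trans ?_
      gcongr with i
      exact (h i).norm_coe_le_norm s)

open Classical in
/-- The superposition operator `h ↦ f ∘ h` on continuous functions (with value `0` if `f ∘ h` is
not continuous). -/
noncomputable def superposition {X E F : Type*} [TopologicalSpace X] [NormedAddCommGroup E]
    [NormedAddCommGroup F] (f : E → F) (h : C(X, E)) : C(X, F) :=
  if hc : Continuous (fun s => f (h s)) then ⟨_, hc⟩ else 0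

theorem superposition_apply {X E F : Type*} [TopologicalSpace X] [NormedAddCommGroup E]
    [NormedAddCommGroup F] {f : E → F} {h : C(X, E)} (hf : ∀ s, ContinuousAt f (h s)) (s : X) :
    superposition f h s = f (h s) := by
  have hc : Continuous (fun s => f (h s)) :=
    continuous_iff_continuousAt.2 fun s => (hf s).comp h.continuous.continuousAt
  simp [superposition, hc]

/-- The pointwise coefficients have norm at most ‖p n‖, so the radius does not shrink, and a
function of sup norm less than `r` has all its values in the ball. The sum of the series in the
function space is then identified by evaluating at each `s`. -/
theorem HasFPowerSeriesOnBall.superposition [CompleteSpace F] {f : E → F}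
    {p : FormalMultilinearSeries ℝ E F} {y : E} {r : ENNReal} (hf : HasFPowerSeriesOnBall f p y r) :
    HasFPowerSeriesOnBall (superposition f) (p.pointwise X) (ContinuousMap.const X y) r where
  r_le := by
    refine hf.r_le.trans (FormalMultilinearSeries.radius_le_of_le fun n => ?_)
    exact MultilinearMap.mkContinuous_norm_le _ (norm_nonneg _) _
  r_pos := hf.r_pos
  hasSum := by
    intro h hh
    have hs : ∀ s, h s ∈ Metric.eball (0 : E) r := by
      intro s
      rw [Metric.mem_eball, edist_zero_right] at hh ⊢
      refine lt_of_le_of_lt ?_ hh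
      rw [enorm_le_iff_norm_le]
      exact h.norm_coe_le_norm s
    have hr : r ≤ (p.pointwise X).radius := by
      refine hf.r_le.trans (FormalMultilinearSeries.radius_le_of_le fun n => ?_)
      exact MultilinearMap.mkContinuous_norm_le _ (norm_nonneg _) _
    have hsum : Summable fun n => p.pointwise X n fun _ => h :=
      ((p.pointwise X).summable_norm_apply (Metric.eball_subset_eball hr hh)).of_norm
    refine (?_ : _root_.superposition f (ContinuousMap.const X y + h) = _) ▸ hsum.hasSum
    ext s
    rw [superposition_apply]
    · have h1 := hf.hasSum (hs s)
      have h2 := (ContinuousMap.evalCLM ℝ s : C(X, F) →L[ℝ] F).hasSum hsum.hasSum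
      exact h1.unique h2
    · intro s
      refine hf.analyticAt_of_mem ?_ |>.continuousAt
      have := hs s
      rw [Metric.mem_eball, edist_zero_right] at this
      simpa [Metric.mem_eball, edist_eq_enorm_sub] using this

theorem AnalyticAt.superposition [CompleteSpace F] {f : E → F} {y : E} (hf : AnalyticAt ℝ f y) :
    AnalyticAt ℝ (superposition f) (ContinuousMap.const X y) := by
  obtain ⟨p, r, h⟩ := hf
  exact ⟨p.pointwise X, r, h.superposition⟩

/-- Compose with the evaluation at `s`, which is continuous and linear, and use uniqueness of
derivatives. -/
theorem fderiv_superposition_apply {f : E → F} {c : C(X, E)}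
    (hS : DifferentiableAt ℝ (superposition f) c)
    (hc : ∀ᶠ c' in 𝓝 c, ∀ s, ContinuousAt f (c' s))
    (hf : ∀ s, DifferentiableAt ℝ f (c s)) (h : C(X, E)) (s : X) :
    fderiv ℝ (superposition f) c h s = fderiv ℝ f (c s) (h s) := by
  have h1 : HasFDerivAt (fun c' : C(X, E) => superposition f c' s)
      ((ContinuousMap.evalCLM ℝ s).comp (fderiv ℝ (superposition f) c)) c :=
    (ContinuousMap.evalCLM ℝ s : C(X, F) →L[ℝ] F).hasFDerivAt.comp c hS.hasFDerivAt
  have h2 : HasFDerivAt (fun c' : C(X, E) => f (c' s))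
      ((fderiv ℝ f (c s)).comp (ContinuousMap.evalCLM ℝ s)) c :=
    (hf s).hasFDerivAt.comp c (ContinuousMap.evalCLM ℝ s : C(X, E) →L[ℝ] E).hasFDerivAt
  have h3 := h1.congr_of_eventuallyEq
    (show (fun c' : C(X, E) => f (c' s)) =ᶠ[𝓝 c] fun c' => superposition f c' s from
      hc.mono fun c' hc' => (superposition_apply hc' s).symm)
  exact congrArg (fun L : C(X, E) →L[ℝ] F => L h) (h3.unique h2)

end Superposition

/-! ### Integration as a bounded operator on continuous functions. -/

section IntegralOperator

variable {G : Type*} [NormedAddCommGroup G] [NormedSpace ℝ G]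

/-- The operator sending a continuous function on `[0, 1]` to its primitive vanishing at `0`. -/
noncomputable def primitiveCLM : C(Icc (0 : ℝ) 1, G) →L[ℝ] C(Icc (0 : ℝ) 1, G) :=
  LinearMap.mkContinuous
    -- `projIcc` extends `h` by constants, so the integrand is continuous on all of ℝ.
    { toFun := fun h => ⟨fun s => ∫ τ in (0 : ℝ)..s, h (projIcc 0 1 zero_le_one τ), by
        have hc : Continuous fun τ : ℝ => h (projIcc 0 1 zero_le_one τ) := by fun_prop
        exact (intervalIntegral.continuous_primitive (fun a b => hc.intervalIntegrable a b) 0).comp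
          continuous_subtype_val⟩
      map_add' := by
        intro h k
        ext s
        have hc : Continuous fun τ : ℝ => h (projIcc 0 1 zero_le_one τ) := by fun_prop
        have kc : Continuous fun τ : ℝ => k (projIcc 0 1 zero_le_one τ) := by fun_prop
        exact intervalIntegral.integral_add (hc.intervalIntegrable _ _) (kc.intervalIntegrable _ _)
      map_smul' := by
        intro a h
        ext s
        exact intervalIntegral.integral_smul _ _ }
    1 (by
      intro h
      rw [ContinuousMap.norm_le _ (by positivity)]
      intro s
      refine (intervalIntegral.norm_integral_le_of_norm_le_const
        (C := ‖h‖) fun τ _ => h.norm_coe_le_norm _).trans ?_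
      have h0 := s.2.1
      have h1 := s.2.2
      rw [sub_zero, abs_of_nonneg h0, mul_comm]
      gcongr)

theorem primitiveCLM_apply (h : C(Icc (0 : ℝ) 1, G)) (s : Icc (0 : ℝ) 1) :
    primitiveCLM h s = ∫ τ in (0 : ℝ)..s, h (projIcc 0 1 zero_le_one τ) := rfl

end IntegralOperator

/-! ### The linearized horizontal lift and Grönwall's inequality. -/

section FrobeniusPath

variable {E G : Type*} [NormedAddCommGroup E] [NormedSpace ℝ E]
  [NormedAddCommGroup G] [NormedSpace ℝ G]

/-- Along the path `z' = u - R (B z u)`, the primitive `θ` of the linearized equation in the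
direction `v` is annihilated by the form `B`, if `B` is involutive and `R` is a constant right
inverse of `B`. -/
theorem linearized_path_annihilated {B : E → E →L[ℝ] G} {R : G →L[ℝ] E} {U : Set E}
    (hUo : IsOpen U)
    (hB : ∀ z ∈ U, DifferentiableAt ℝ B z) (hR : ∀ z ∈ U, ∀ c, B z (R c) = c)
    (hinv : ∀ z ∈ U, ∀ a b, B z a = 0 → B z b = 0 → fderiv ℝ B z a b = fderiv ℝ B z b a)
    {C : ℝ} (hC : ∀ z ∈ U, ‖fderiv ℝ B z‖ ≤ C)
    {u v : E} {z : ℝ → E} {η : ℝ → G}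
    (hz : ∀ s ∈ Icc (0 : ℝ) 1, z s ∈ U)
    (hz' : ∀ s ∈ Icc (0 : ℝ) 1, HasDerivAt z (u - R (B (z s) u)) s)
    (hη0 : η 0 = 0)
    (hη : ∀ s ∈ Icc (0 : ℝ) 1,
      HasDerivAt η (-(fderiv ℝ B (z s) (s • v + R (η s)) u + B (z s) v)) s) :
    B (z 1) (v + R (η 1)) = 0 := by
  -- The quantity θ(s) = B(z)(s v + Rη) = s B(z)v + η satisfies the homogeneous linear equation θ' =
  -- -dB(Rθ)u. Indeed z' is in ker B, dB vanishes on the range of R, and involutivity turns dB(z')v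
  -- into dB(v - RBv)u.
  have hθ' : ∀ s ∈ Icc (0 : ℝ) 1, HasDerivAt (fun s => s • B (z s) v + η s)
      (-(fderiv ℝ B (z s) (R (s • B (z s) v + η s)) u)) s := by
    intro s hs
    have hzs := hz s hs
    have h1 : HasDerivAt (fun s => B (z s)) (fderiv ℝ B (z s) (u - R (B (z s) u))) s :=
      (hB _ hzs).hasFDerivAt.comp_hasDerivAt s (hz' s hs)
    have h2 : HasDerivAt (fun s => B (z s) v) (fderiv ℝ B (z s) (u - R (B (z s) u)) v) s := by
      simpa using h1.clm_apply (hasDerivAt_const s v)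
    have h3 := ((hasDerivAt_id s).smul h2).add (hη s hs)
    refine h3.congr_deriv ?_
    -- `B ∘ R` is constant, so derivatives of `B` vanish on the range of `R`
    have hBR : ∀ a c, fderiv ℝ B (z s) a (R c) = 0 := by
      intro a c
      have e1 : HasFDerivAt (fun w => B w (R c))
          ((ContinuousLinearMap.apply ℝ G (R c)).comp (fderiv ℝ B (z s))) (z s) :=
        (ContinuousLinearMap.apply ℝ G (R c)).hasFDerivAt.comp _ (hB _ hzs).hasFDerivAt
      have e2 : HasFDerivAt (fun w => B w (R c)) (0 : E →L[ℝ] G) (z s) :=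
        (hasFDerivAt_const c (z s)).congr_of_eventuallyEq
          (Filter.mem_of_superset (hUo.mem_nhds hzs) fun w hw => hR w hw c)
      simpa using congrArg (fun L : E →L[ℝ] G => L a) (e1.unique e2)
    have k1 : B (z s) (u - R (B (z s) u)) = 0 := by simp [hR _ hzs]
    have k2 : B (z s) (v - R (B (z s) v)) = 0 := by simp [hR _ hzs]
    have k3 := hinv _ hzs _ _ k1 k2
    simp only [map_sub, hBR, sub_zero, _root_.sub_apply] at k3
    simp only [map_add, map_smul, map_sub, _root_.sub_apply,
      _root_.add_apply, _root_.smul_apply, id_eq, one_smul] at k3 ⊢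
    rw [k3, smul_sub]
    abel
  -- θ(0) = 0 and ‖θ'‖ ≤ C‖R‖‖u‖‖θ‖, so θ vanishes on [0, 1]; its value at 1 is the claim.
  have hgr := norm_le_gronwallBound_of_norm_deriv_right_le (δ := 0) (K := C * ‖R‖ * ‖u‖) (ε := 0)
    (a := 0) (b := 1) (f := fun s => s • B (z s) v + η s)
    (fun s hs => (hθ' s hs).continuousAt.continuousWithinAt)
    (fun s hs => (hθ' s ⟨hs.1, hs.2.le⟩).hasDerivWithinAt)
    (by simp [hη0])
    (fun s hs => by
      have hzs := hz s ⟨hs.1, hs.2.le⟩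
      rw [norm_neg, add_zero]
      refine ((fderiv ℝ B (z s) _).le_opNorm u).trans ?_
      calc _ ≤ (‖fderiv ℝ B (z s)‖ * (‖R‖ * ‖s • B (z s) v + η s‖)) * ‖u‖ := by
            gcongr
            refine ((fderiv ℝ B (z s)).le_opNorm _).trans ?_
            gcongr
            exact R.le_opNorm _
        _ ≤ (C * (‖R‖ * ‖s • B (z s) v + η s‖)) * ‖u‖ := by
            gcongr
            exact hC _ hzs
        _ = _ := by ring)
    1 (by simp)
  have h0 : (1 : ℝ) • B (z 1) v + η 1 = 0 := by
    simpa [gronwallBound_ε0_δ0] using hgr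
  rw [map_add, hR _ (hz 1 (by simp)), ← h0, one_smul]

end FrobeniusPath

/-! ### Analytic solution of the path equation. -/

section Frobenius

variable {E G : Type*} [NormedAddCommGroup E] [NormedSpace ℝ E]
  [NormedAddCommGroup G] [NormedSpace ℝ G]

/-- The linear part of the path operator used in the proof of the Frobenius theorem. -/
noncomputable def pathCLM (P : E →L[ℝ] E) (R : G →L[ℝ] E) :
    E × C(Icc (0 : ℝ) 1, G) →L[ℝ] C(Icc (0 : ℝ) 1, E × E) :=
  LinearMap.mkContinuous
    -- First component: displacement of the path from z₀. Second: the fixed direction P e on which B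
    -- is evaluated.
    { toFun := fun p => ⟨fun s => ((s : ℝ) • P p.1 + R (p.2 s), P p.1), by fun_prop⟩
      map_add' := by
        intro p q
        ext s <;> simp [add_add_add_comm]
      map_smul' := by
        intro a p
        ext s <;> simp [smul_comm a] }
    (‖P‖ + ‖R‖) (by
      intro p
      rw [ContinuousMap.norm_le _ (by positivity)]
      intro s
      have h1 : ‖P p.1‖ ≤ ‖P‖ * ‖p‖ := (P.le_opNorm _).trans (by gcongr; exact norm_fst_le p)
      have h2 : ‖R (p.2 s)‖ ≤ ‖R‖ * ‖p‖ := (R.le_opNorm _).trans (by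
        gcongr
        exact (p.2.norm_coe_le_norm s).trans (norm_snd_le p))
      have h3 : ‖(s : ℝ) • P p.1‖ ≤ ‖P p.1‖ := by
        rw [norm_smul, Real.norm_of_nonneg s.2.1]
        exact mul_le_of_le_one_left (norm_nonneg _) s.2.2
      refine norm_prod_le_iff.2 ⟨?_, ?_⟩
      · refine (norm_add_le _ _).trans ?_
        rw [add_mul]
        exact add_le_add (h3.trans h1) h2
      · exact h1.trans (by gcongr; simp))

theorem pathCLM_apply (P : E →L[ℝ] E) (R : G →L[ℝ] E) (p : E × C(Icc (0 : ℝ) 1, G))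
    (s : Icc (0 : ℝ) 1) : pathCLM P R p s = ((s : ℝ) • P p.1 + R (p.2 s), P p.1) := rfl

theorem hasFDerivAt_eval_prod {B : E → E →L[ℝ] G} {z u : E} (hB : DifferentiableAt ℝ B z) :
    HasFDerivAt (fun p : E × E => B p.1 p.2)
      ((B z).comp (ContinuousLinearMap.snd ℝ E E) +
        ((fderiv ℝ B z).flip u).comp (ContinuousLinearMap.fst ℝ E E)) (z, u) := by
  have h1 : HasFDerivAt (fun p : E × E => B p.1)
      ((fderiv ℝ B z).comp (ContinuousLinearMap.fst ℝ E E)) (z, u) :=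
    HasFDerivAt.comp (z, u) (g := B) (f := Prod.fst) hB.hasFDerivAt hasFDerivAt_fst
  exact h1.clm_apply (hasFDerivAt_snd (𝕜 := ℝ) (E := E) (F := E) (p := (z, u)))

theorem analyticAt_eval_prod {B : E → E →L[ℝ] G} {z u : E} (hB : AnalyticAt ℝ B z) :
    AnalyticAt ℝ (fun p : E × E => B p.1 p.2) (z, u) := by
  have h1 : AnalyticAt ℝ (fun p : E × E => B p.1) (z, u) :=
    AnalyticAt.fun_comp (g := B) (f := Prod.fst) (x := (z, u)) hB analyticAt_fst
  exact ((ContinuousLinearMap.id ℝ (E →L[ℝ] G)).analyticAt_bilinear _).fun_comp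
    (h1.prod analyticAt_snd)

/-- Analytic dependence on parameters of the solutions of the path equation
`h(s) = B z₀ e - ∫₀ˢ B (z₀ + τ P e + R (h τ)) (P e) dτ`. -/
theorem exists_analytic_path [CompleteSpace E] [CompleteSpace G] {B : E → E →L[ℝ] G} {z₀ : E}
    (hB : AnalyticAt ℝ B z₀) (P : E →L[ℝ] E) (R : G →L[ℝ] E) (hP : ∀ e, B z₀ (P e) = 0) :
    ∃ h : E → C(Icc (0 : ℝ) 1, G), AnalyticAt ℝ h 0 ∧ h 0 = 0 ∧
      HasFDerivAt h ((ContinuousLinearMap.const ℝ (Icc (0 : ℝ) 1)).comp (B z₀)) 0 ∧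
      ∀ᶠ e in 𝓝 0, h e = ContinuousMap.const _ (B z₀ e) -
        primitiveCLM (superposition (fun p : E × E => B p.1 p.2)
          (ContinuousMap.const _ (z₀, 0) + pathCLM P R (e, h e))) := by
  set f : E × E → G := fun p => B p.1 p.2 with hf
  set c₀ : C(Icc (0 : ℝ) 1, E × E) := ContinuousMap.const _ (z₀, 0) with hc₀
  set K : E →L[ℝ] C(Icc (0 : ℝ) 1, G) :=
    (ContinuousLinearMap.const ℝ (Icc (0 : ℝ) 1)).comp (B z₀) with hK
  have hfan : AnalyticAt ℝ f (z₀, 0) := analyticAt_eval_prod hB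
  have hS : AnalyticAt ℝ (superposition (X := Icc (0 : ℝ) 1) f) c₀ := hfan.superposition
  -- the derivative of the integral term vanishes at the origin
  have hSd : HasFDerivAt (fun p => superposition f (c₀ + pathCLM P R p))
      (0 : E × C(Icc (0 : ℝ) 1, G) →L[ℝ] C(Icc (0 : ℝ) 1, G)) 0 := by
    have e1 : HasFDerivAt (fun p => c₀ + pathCLM P R p) (pathCLM P R) 0 :=
      (pathCLM P R).hasFDerivAt.const_add c₀
    have e2 : HasFDerivAt (superposition (X := Icc (0 : ℝ) 1) f)
        (fderiv ℝ (superposition f) c₀) (c₀ + pathCLM P R 0) := by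
      simpa using hS.differentiableAt.hasFDerivAt
    refine (e2.comp 0 e1).congr_fderiv ?_
    refine ContinuousLinearMap.ext fun p => ContinuousMap.ext fun s => ?_
    have hc : ∀ᶠ c' in 𝓝 c₀, ∀ s, ContinuousAt f (c' s) := by
      obtain ⟨r, hr, hr'⟩ := Metric.eventually_nhds_iff.1 hfan.eventually_analyticAt
      refine Metric.eventually_nhds_iff.2 ⟨r, hr, fun c' hc' s => (hr' ?_).continuousAt⟩
      exact (c'.dist_apply_le_dist (g := c₀) s).trans_lt hc'
    rw [ContinuousLinearMap.comp_apply, fderiv_superposition_apply hS.differentiableAt hc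
      (fun s => hfan.differentiableAt)]
    have e3 : fderiv ℝ f (c₀ s) = _ := (hasFDerivAt_eval_prod (u := 0) hB.differentiableAt).fderiv
    rw [e3, pathCLM_apply]
    simp [hP]
  -- Keeping the parameter e as a component turns the implicit equation into an inversion: h solves
  -- the equation for e exactly when Φ(e, h) = (e, 0). The integral term has zero derivative at 0,
  -- because B z₀ ∘ P = 0, so the derivative of Φ is the triangular isomorphism Λ below.
  set Φ : E × C(Icc (0 : ℝ) 1, G) → E × C(Icc (0 : ℝ) 1, G) := fun p =>
    (p.1, p.2 - K p.1 + primitiveCLM (superposition f (c₀ + pathCLM P R p))) with hΦ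
  have hΦan : AnalyticAt ℝ Φ 0 := by
    have e1 : AnalyticAt ℝ (fun p => superposition f (c₀ + pathCLM P R p)) 0 := by
      refine AnalyticAt.fun_comp (g := superposition f) (f := fun p => c₀ + pathCLM P R p) ?_
        (analyticAt_const.add ((pathCLM P R).analyticAt 0))
      simpa using hS
    refine analyticAt_fst.prod ((analyticAt_snd.sub ?_).add ?_)
    · exact AnalyticAt.fun_comp (g := K) (f := Prod.fst) (K.analyticAt _) analyticAt_fst
    · exact AnalyticAt.fun_comp (g := primitiveCLM) ((primitiveCLM (G := G)).analyticAt _) e1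
  set Λ : (E × C(Icc (0 : ℝ) 1, G)) ≃L[ℝ] (E × C(Icc (0 : ℝ) 1, G)) :=
    ContinuousLinearEquiv.equivOfInverse
      ((ContinuousLinearMap.fst ℝ _ _).prod
        (ContinuousLinearMap.snd ℝ _ _ - K.comp (ContinuousLinearMap.fst ℝ _ _)))
      ((ContinuousLinearMap.fst ℝ _ _).prod
        (ContinuousLinearMap.snd ℝ _ _ + K.comp (ContinuousLinearMap.fst ℝ _ _)))
      (fun p => by simp) (fun p => by simp) with hΛ
  have hΦd : HasFDerivAt Φ (Λ : E × C(Icc (0 : ℝ) 1, G) →L[ℝ] E × C(Icc (0 : ℝ) 1, G)) 0 := by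
    have e1 : HasFDerivAt (fun p : E × C(Icc (0 : ℝ) 1, G) => K p.1)
        (K.comp (ContinuousLinearMap.fst ℝ _ _)) 0 :=
      K.hasFDerivAt.comp 0 hasFDerivAt_fst
    have e2 := (primitiveCLM (G := G)).hasFDerivAt.comp 0 hSd
    refine (hasFDerivAt_fst.prodMk ((hasFDerivAt_snd.sub e1).add e2)).congr_fderiv ?_
    ext p <;> simp [hΛ]
  have hΦ0 : Φ 0 = 0 := by
    have : primitiveCLM (superposition f c₀) = 0 := by
      have : superposition (X := Icc (0 : ℝ) 1) f c₀ = 0 := by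
        ext s
        rw [superposition_apply (fun s => hfan.continuousAt)]
        simp [hf, hc₀]
      rw [this, map_zero]
    simp [hΦ, this]
  have hcd : ContDiffAt ℝ ω Φ 0 := hΦan.contDiffAt
  set Ξ := hcd.localInverse hΦd (by simp) with hΞ
  have hΞan : AnalyticAt ℝ Ξ 0 := by
    have := hcd.to_localInverse hΦd (by simp)
    rw [hΦ0] at this
    exact this.analyticAt
  have hΞd : HasFDerivAt Ξ (Λ.symm : E × C(Icc (0 : ℝ) 1, G) →L[ℝ] E × C(Icc (0 : ℝ) 1, G)) 0 := by
    have := (hcd.hasStrictFDerivAt' hΦd (by simp)).to_localInverse.hasFDerivAt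
    rwa [hΦ0] at this
  have hΞr : ∀ᶠ q in 𝓝 0, Φ (Ξ q) = q := by
    have := (hcd.hasStrictFDerivAt' hΦd (by simp)).eventually_right_inverse
    rwa [hΦ0] at this
  have hΞ0 : Ξ 0 = 0 := by
    have := hcd.localInverse_apply_image hΦd (by simp)
    rwa [hΦ0] at this
  have hinl : Filter.Tendsto (fun e : E => (e, (0 : C(Icc (0 : ℝ) 1, G)))) (𝓝 0) (𝓝 0) := by
    have : Continuous (fun e : E => (e, (0 : C(Icc (0 : ℝ) 1, G)))) := by fun_prop
    exact this.tendsto 0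
  have hinlan : AnalyticAt ℝ (fun e : E => (e, (0 : C(Icc (0 : ℝ) 1, G)))) 0 :=
    analyticAt_id.prod analyticAt_const
  refine ⟨fun e => (Ξ (e, 0)).2, ?_, ?_, ?_, ?_⟩
  · have e1 : AnalyticAt ℝ (fun e : E => Ξ (e, 0)) 0 := AnalyticAt.fun_comp (g := Ξ) hΞan hinlan
    exact AnalyticAt.fun_comp (g := Prod.snd) analyticAt_snd e1
  · show (Ξ 0).2 = 0
    rw [hΞ0]; rfl
  · have e1 : HasFDerivAt (fun e : E => (e, (0 : C(Icc (0 : ℝ) 1, G))))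
        (ContinuousLinearMap.inl ℝ _ _) 0 := hasFDerivAt_prodMk_left 0 0
    have e2 : HasFDerivAt Ξ _ ((fun e : E => (e, (0 : C(Icc (0 : ℝ) 1, G)))) 0) := hΞd
    have e3 := (hasFDerivAt_snd (𝕜 := ℝ)).comp (0 : E) (HasFDerivAt.comp (0 : E) e2 e1)
    refine e3.congr_fderiv ?_
    ext e
    simp [hΛ]
  · filter_upwards [hinl.eventually hΞr] with e he
    have h1 : (Ξ (e, 0)).1 = e := congrArg Prod.fst he
    have h2 := congrArg Prod.snd he
    simp only [hΦ] at h2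
    have h3 : ((e, (Ξ (e, 0)).2) : E × C(Icc (0 : ℝ) 1, G)) = Ξ (e, 0) := Prod.ext h1.symm rfl
    rw [h3]
    rw [h1] at h2
    rw [sub_add_eq_add_sub, sub_eq_zero, add_comm] at h2
    rw [eq_sub_iff_add_eq, add_comm]
    exact h2

end Frobenius

/-! ### First integrals of a normalized involutive system. -/

section Frobenius

variable {E G : Type*} [NormedAddCommGroup E] [NormedSpace ℝ E]
  [NormedAddCommGroup G] [NormedSpace ℝ G]

/-- Differentiating the path equation in the direction P v gives exactly the linearized equation of
`linearized_path_annihilated`, with zero initial value because B z₀ (P v) = 0. So the endpoint map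
carries directions in ker B z₀ into the kernel of B at the endpoint. -/
theorem eventually_annihilated_of_path [CompleteSpace E] [CompleteSpace G]
    {B : E → E →L[ℝ] G} {z₀ : E}
    (hB : AnalyticAt ℝ B z₀) {R : G →L[ℝ] E} (hR : ∀ᶠ z in 𝓝 z₀, ∀ c, B z (R c) = c)
    (hinv : ∀ᶠ z in 𝓝 z₀, ∀ a b, B z a = 0 → B z b = 0 → fderiv ℝ B z a b = fderiv ℝ B z b a)
    {P : E →L[ℝ] E} (hP : ∀ e, B z₀ (P e) = 0) (hPP : ∀ e, P (P e) = P e)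
    {h : E → C(Icc (0 : ℝ) 1, G)} (han : AnalyticAt ℝ h 0) (h0 : h 0 = 0)
    (heq : ∀ᶠ e in 𝓝 0, h e = ContinuousMap.const _ (B z₀ e) -
        primitiveCLM (superposition (fun p : E × E => B p.1 p.2)
          (ContinuousMap.const _ (z₀, 0) + pathCLM P R (e, h e)))) :
    ∀ᶠ e in 𝓝 0, ∀ v, B (z₀ + P e + R (h e 1))
      (fderiv ℝ (fun e => z₀ + P e + R (h e 1)) e (P v)) = 0 := by
  set f : E × E → G := fun p => B p.1 p.2 with hf
  set c₀ : C(Icc (0 : ℝ) 1, E × E) := ContinuousMap.const _ (z₀, 0) with hc₀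
  have hbd : ∀ᶠ z in 𝓝 z₀, ‖fderiv ℝ B z‖ ≤ ‖fderiv ℝ B z₀‖ + 1 := by
    have : ContinuousAt (fun z => ‖fderiv ℝ B z‖) z₀ := hB.fderiv.continuousAt.norm
    exact (this.eventually (gt_mem_nhds (lt_add_one _))).mono fun z hz => hz.le
  obtain ⟨ρ, hρ, hball⟩ := Metric.eventually_nhds_iff_ball.1
    (hB.eventually_analyticAt.and (hR.and (hinv.and hbd)))
  have hSan : AnalyticAt ℝ (superposition (X := Icc (0 : ℝ) 1) f) c₀ :=
    (analyticAt_eval_prod hB).superposition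
  have hpath : ContinuousAt (fun e => pathCLM P R (e, h e)) 0 :=
    (pathCLM P R).continuous.continuousAt.comp (continuousAt_id.prodMk han.continuousAt)
  have hpath0 : pathCLM P R (0, h 0) = 0 := by rw [h0]; exact map_zero _
  have hsmall : ∀ᶠ e in 𝓝 0, ‖pathCLM P R (e, h e)‖ < ρ := by
    have : ContinuousAt (fun e => ‖pathCLM P R (e, h e)‖) 0 := hpath.norm
    exact this.eventually (gt_mem_nhds (by simpa [hpath0] using hρ))
  have hSev : ∀ᶠ e in 𝓝 0, AnalyticAt ℝ (superposition f) (c₀ + pathCLM P R (e, h e)) := by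
    have : ContinuousAt (fun e => c₀ + pathCLM P R (e, h e)) 0 := continuousAt_const.add hpath
    refine this.eventually (p := fun c => AnalyticAt ℝ (superposition f) c) ?_
    simpa [hpath0] using hSan.eventually_analyticAt
  filter_upwards [hsmall, hSev, heq.eventually_nhds, han.eventually_analyticAt]
    with e hsm hS heqe hane v
  set c := c₀ + pathCLM P R (e, h e) with hc
  set w := P v with hw
  set u := P e with hu
  set η : C(Icc (0 : ℝ) 1, G) := fderiv ℝ h e w with hη
  have hmem : ∀ c' : C(Icc (0 : ℝ) 1, E × E), ‖c' - c₀‖ < ρ → ∀ s, (c' s).1 ∈ Metric.ball z₀ ρ := by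
    intro c' hc' s
    have h1 : ‖(c' - c₀) s‖ ≤ ‖c' - c₀‖ := (c' - c₀).norm_coe_le_norm s
    have h2 : ‖((c' - c₀) s).1‖ ≤ ‖(c' - c₀) s‖ := norm_fst_le _
    rw [mem_ball_iff_norm]
    exact (h2.trans h1).trans_lt hc'
  have hcs : ∀ s, (c s).1 ∈ Metric.ball z₀ ρ := hmem c (by simpa [hc] using hsm)
  have hfan : ∀ p : E × E, p.1 ∈ Metric.ball z₀ ρ → AnalyticAt ℝ f p := fun p hp =>
    analyticAt_eval_prod (u := p.2) (hball _ hp).1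
  have hcont : ∀ᶠ c' in 𝓝 c, ∀ s, ContinuousAt f (c' s) := by
    have h1 : ∀ᶠ c' in 𝓝 c, ‖c' - c₀‖ < ρ := by
      have h2 : Continuous fun c' : C(Icc (0 : ℝ) 1, E × E) => ‖c' - c₀‖ := by fun_prop
      exact h2.continuousAt.eventually (gt_mem_nhds (by simpa [hc] using hsm))
    exact h1.mono fun c' hc' s => (hfan _ (hmem c' hc' s)).continuousAt
  set k := fderiv ℝ (superposition f) c (pathCLM P R (w, η)) with hk
  have hks : ∀ s, k s = B (c s).1 w + fderiv ℝ B (c s).1 ((s : ℝ) • w + R (η s)) u := by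
    intro s
    rw [hk, fderiv_superposition_apply hS.differentiableAt hcont
      (fun s => (hfan _ (hcs s)).differentiableAt)]
    have e3 : fderiv ℝ f (c s) = _ :=
      (hasFDerivAt_eval_prod (z := (c s).1) (u := (c s).2)
        (hball _ (hcs s)).1.differentiableAt).fderiv
    have e4 : (c s).2 = u := by simp [hc, hc₀, pathCLM_apply, hu]
    rw [e3, pathCLM_apply, e4]
    simp [hw, hPP]
  -- the linearized path equation
  have hηeq : η = ContinuousMap.const _ (B z₀ w) - primitiveCLM k := by
    have d1 : HasFDerivAt (fun e => c₀ + pathCLM P R (e, h e))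
        ((pathCLM P R).comp ((ContinuousLinearMap.id ℝ E).prod (fderiv ℝ h e))) e :=
      ((pathCLM P R).hasFDerivAt.comp e
        ((hasFDerivAt_id e).prodMk hane.differentiableAt.hasFDerivAt)).const_add c₀
    have d2 := (primitiveCLM (G := G)).hasFDerivAt.comp e
      (HasFDerivAt.comp e (g := superposition f) hS.differentiableAt.hasFDerivAt d1)
    have d3 : HasFDerivAt (fun e => ContinuousMap.const (Icc (0 : ℝ) 1) (B z₀ e))
        ((ContinuousLinearMap.const ℝ (Icc (0 : ℝ) 1)).comp (B z₀)) e :=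
      ((ContinuousLinearMap.const ℝ (Icc (0 : ℝ) 1)).comp (B z₀)).hasFDerivAt
    have d4 := (d3.sub d2).congr_of_eventuallyEq heqe
    have d5 := congrArg (fun L : E →L[ℝ] C(Icc (0 : ℝ) 1, G) => L w) d4.fderiv
    exact d5
  have hprimd : ∀ (q : C(Icc (0 : ℝ) 1, G)) (s : ℝ) (hs : s ∈ Icc (0 : ℝ) 1),
      HasDerivAt (fun s : ℝ => ∫ τ in (0 : ℝ)..s, q (projIcc 0 1 zero_le_one τ)) (q ⟨s, hs⟩) s := by
    intro q s hs
    have hq : Continuous fun τ : ℝ => q (projIcc 0 1 zero_le_one τ) := by fun_prop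
    have := (hq.integral_hasStrictDerivAt 0 s).hasDerivAt
    rwa [projIcc_of_mem zero_le_one hs] at this
  -- The right-hand side of the path equation, defined for all real s and equal to `h e` on [0, 1],
  -- so that two-sided derivatives exist also at the endpoints.
  set H : ℝ → G := fun s =>
    B z₀ e - ∫ τ in (0 : ℝ)..s, superposition f c (projIcc 0 1 zero_le_one τ) with hH
  have hHs : ∀ s (hs : s ∈ Icc (0 : ℝ) 1), H s = h e ⟨s, hs⟩ := by
    intro s hs
    conv_rhs => rw [heqe.self_of_nhds]
    rfl
  set z : ℝ → E := fun s => z₀ + s • u + R (H s) with hz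
  have hzs : ∀ s (hs : s ∈ Icc (0 : ℝ) 1), z s = (c ⟨s, hs⟩).1 := by
    intro s hs
    simp [hz, hHs s hs, hc, hc₀, pathCLM_apply, hu, add_assoc]
  have hcs2 : ∀ s, (c s).2 = u := by
    intro s
    simp [hc, hc₀, pathCLM_apply, hu]
  set η' : ℝ → G := fun s => - ∫ τ in (0 : ℝ)..s, k (projIcc 0 1 zero_le_one τ) with hη'
  have hηs : ∀ s (hs : s ∈ Icc (0 : ℝ) 1), η' s = η ⟨s, hs⟩ := by
    intro s hs
    rw [hηeq, hw, hP]
    simp [hη', primitiveCLM_apply]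
  have main := linearized_path_annihilated (B := B) (R := R) (U := Metric.ball z₀ ρ)
    Metric.isOpen_ball (fun z hz => (hball z hz).1.differentiableAt)
    (fun z hz => (hball z hz).2.1) (fun z hz => (hball z hz).2.2.1)
    (fun z hz => (hball z hz).2.2.2) (u := u) (v := w) (z := z) (η := η')
    (fun s hs => by rw [hzs s hs]; exact hcs _)
    (fun s hs => by
      have d1 := ((hasDerivAt_id s).smul_const u).const_add z₀
      have d2 : HasDerivAt H (-(superposition f c ⟨s, hs⟩)) s := by
        simpa using (hprimd (superposition f c) s hs).const_sub (B z₀ e)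
      have d3 := d1.add (R.hasFDerivAt.comp_hasDerivAt s d2)
      refine d3.congr_deriv ?_
      rw [superposition_apply (fun s => (hfan _ (hcs s)).continuousAt), hzs s hs]
      simp only [hf, hcs2]
      simp [sub_eq_add_neg])
    (by simp [hη'])
    (fun s hs => by
      refine (hprimd k s hs).neg.congr_deriv ?_
      rw [hks, hzs s hs, hηs s hs, add_comm])
  have hΨ : fderiv ℝ (fun e => z₀ + P e + R (h e 1)) e w = w + R (η 1) := by
    have d1 : HasFDerivAt (fun e => h e 1)
        ((ContinuousMap.evalCLM ℝ (1 : Icc (0 : ℝ) 1)).comp (fderiv ℝ h e)) e :=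
      (ContinuousMap.evalCLM ℝ (1 : Icc (0 : ℝ) 1) :
        C(Icc (0 : ℝ) 1, G) →L[ℝ] G).hasFDerivAt.comp e hane.differentiableAt.hasFDerivAt
    have d2 := (P.hasFDerivAt.const_add z₀).add (R.hasFDerivAt.comp e d1)
    have d3 : fderiv ℝ (fun e => z₀ + P e + R (h e 1)) e = _ := d2.fderiv
    rw [d3]
    simp [hw, hPP, hη]
  have hz1 : z 1 = z₀ + u + R (h e 1) := by
    rw [hz]
    simp only [one_smul, hHs 1 (by simp)]
    rfl
  have hη1 : η' 1 = η 1 := hηs 1 (by simp)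
  rw [hΨ, ← hz1, ← hη1]
  exact main

/-- **Frobenius theorem** in the analytic category: an involutive Pfaffian system `B` which is
normalized on a fixed complement of its kernel has local first integrals. -/
theorem exists_first_integral_of_normalized [CompleteSpace E] [CompleteSpace G]
    {B : E → E →L[ℝ] G} {z₀ : E}
    (hB : AnalyticAt ℝ B z₀) {R : G →L[ℝ] E} (hR : ∀ᶠ z in 𝓝 z₀, ∀ c, B z (R c) = c)
    (hinv : ∀ᶠ z in 𝓝 z₀, ∀ a b, B z a = 0 → B z b = 0 →
      fderiv ℝ B z a b = fderiv ℝ B z b a) :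
    ∃ g : E → G, AnalyticAt ℝ g z₀ ∧ ∀ᶠ z in 𝓝 z₀, ∀ v, fderiv ℝ g z v = 0 ↔ B z v = 0 := by
  have hR₀ : ∀ c, B z₀ (R c) = c := hR.self_of_nhds
  -- The projection onto ker B z₀ along the range of R.
  set P : E →L[ℝ] E := ContinuousLinearMap.id ℝ E - R.comp (B z₀) with hPdef
  have hP : ∀ e, B z₀ (P e) = 0 := fun e => by simp [hPdef, hR₀]
  have hPP : ∀ e, P (P e) = P e := fun e => by
    have : P (P e) = P e - R (B z₀ (P e)) := rfl
    rw [this, hP, map_zero, sub_zero]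
  obtain ⟨h, han, h0, hd, heq⟩ := exists_analytic_path hB P R hP
  have hann := eventually_annihilated_of_path hB hR hinv hP hPP han h0 heq
  set Ψ : E → E := fun e => z₀ + P e + R (h e 1) with hΨ
  have hΨan : AnalyticAt ℝ Ψ 0 := by
    have a1 : AnalyticAt ℝ (fun e => h e 1) 0 :=
      ((ContinuousMap.evalCLM ℝ (1 : Icc (0 : ℝ) 1)).analyticAt _).fun_comp han
    exact (analyticAt_const.add (P.analyticAt 0)).add ((R.analyticAt _).fun_comp a1)
  have hΨ0 : Ψ 0 = z₀ := by simp [hΨ, h0]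
  have hΨd : HasFDerivAt Ψ ((ContinuousLinearEquiv.refl ℝ E : E ≃L[ℝ] E) : E →L[ℝ] E) 0 := by
    have d1 : HasFDerivAt (fun e => h e 1) ((ContinuousMap.evalCLM ℝ (1 : Icc (0 : ℝ) 1)).comp
        ((ContinuousLinearMap.const ℝ (Icc (0 : ℝ) 1)).comp (B z₀))) 0 :=
      (ContinuousMap.evalCLM ℝ (1 : Icc (0 : ℝ) 1) :
        C(Icc (0 : ℝ) 1, G) →L[ℝ] G).hasFDerivAt.comp 0 hd
    refine ((P.hasFDerivAt.const_add z₀).add (R.hasFDerivAt.comp 0 d1)).congr_fderiv ?_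
    ext e
    simp [hPdef]
  have hcd : ContDiffAt ℝ ω Ψ 0 := hΨan.contDiffAt
  set χ := hcd.localInverse hΨd (by simp) with hχ
  have hχan : AnalyticAt ℝ χ z₀ := by
    have := hcd.to_localInverse hΨd (by simp)
    rw [hΨ0] at this
    exact this.analyticAt
  have hχ0 : χ z₀ = 0 := by
    have := hcd.localInverse_apply_image hΨd (by simp)
    rwa [hΨ0] at this
  have hχr : ∀ᶠ z in 𝓝 z₀, Ψ (χ z) = z := by
    have := (hcd.hasStrictFDerivAt' hΨd (by simp)).eventually_right_inverse
    rwa [hΨ0] at this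
  have hχl : ∀ᶠ e in 𝓝 0, χ (Ψ e) = e :=
    (hcd.hasStrictFDerivAt' hΨd (by simp)).eventually_left_inverse
  have htend : Filter.Tendsto χ (𝓝 z₀) (𝓝 0) := by
    have := hχan.continuousAt
    rwa [ContinuousAt, hχ0] at this
  -- the transverse part of the derivative of `Ψ` stays invertible
  have hunit : ∀ᶠ e in 𝓝 0, IsUnit ((B (Ψ e)).comp ((fderiv ℝ Ψ e).comp R)) := by
    have hc : ContinuousAt (fun e => (B (Ψ e)).comp ((fderiv ℝ Ψ e).comp R)) 0 := by
      have c1 : ContinuousAt (fun e => B (Ψ e)) 0 :=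
        ContinuousAt.comp (by rw [hΨ0]; exact hB.continuousAt) hΨan.continuousAt
      exact c1.clm_comp (hΨan.fderiv.continuousAt.clm_comp continuousAt_const)
    have h1 : (B (Ψ 0)).comp ((fderiv ℝ Ψ 0).comp R) = 1 := by
      ext c
      rw [hΨ0, hΨd.fderiv]
      simp [hR₀]
    refine hc.eventually (p := fun L => IsUnit L) ?_
    beta_reduce
    rw [h1]
    exact Units.isOpen.mem_nhds isUnit_one
  -- The endpoint map Ψ has derivative P + R B z₀ = id at 0 and local inverse χ. It sends each slice
  -- e + ker B z₀ to an integral manifold, and B z₀ labels the slices.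
  refine ⟨fun z => B z₀ (χ z), ((B z₀).analyticAt _).fun_comp hχan, ?_⟩
  filter_upwards [hχr.eventually_nhds, htend.eventually hχl.eventually_nhds,
    htend.eventually hann, htend.eventually hunit, htend.eventually hΨan.eventually_analyticAt,
    hχan.eventually_analyticAt] with z hr hl ha hu hΨz hχz v
  have hgz : fderiv ℝ (fun z => B z₀ (χ z)) z v = B z₀ (fderiv ℝ χ z v) := by
    have : HasFDerivAt (fun z => B z₀ (χ z)) _ z :=
      (B z₀).hasFDerivAt.comp z hχz.differentiableAt.hasFDerivAt
    rw [this.fderiv]; rfl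
  have hinv : fderiv ℝ Ψ (χ z) (fderiv ℝ χ z v) = v := by
    have d1 : HasFDerivAt (fun z => Ψ (χ z)) _ z :=
      hΨz.differentiableAt.hasFDerivAt.comp z hχz.differentiableAt.hasFDerivAt
    have d2 : HasFDerivAt (fun z => Ψ (χ z)) (ContinuousLinearMap.id ℝ E) z :=
      (hasFDerivAt_id z).congr_of_eventuallyEq hr
    exact congrArg (fun L : E →L[ℝ] E => L v) (d1.unique d2)
  have hzz : Ψ (χ z) = z := hr.self_of_nhds
  set e' := fderiv ℝ χ z v with he'
  have hdec : e' = P e' + R (B z₀ e') := by simp [hPdef]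
  -- With e' = dχ(v), the P-part of e' is mapped by dΨ into ker B, so only B ∘ dΨ ∘ R applied to
  -- dg(v) = B z₀ e' survives, and that operator is invertible near z₀.
  have hBv : B z v = ((B (Ψ (χ z))).comp ((fderiv ℝ Ψ (χ z)).comp R)) (B z₀ e') := by
    have h1 := ha e'
    change B (Ψ (χ z)) (fderiv ℝ Ψ (χ z) (P e')) = 0 at h1
    rw [← hinv, hdec, map_add, map_add]
    nth_rewrite 1 [← hzz]
    rw [h1, zero_add]
    simp [hzz, hR₀, hP]
  rw [hgz, hBv]
  constructor
  · intro h0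
    rw [h0, map_zero]
  · intro h0
    obtain ⟨U, hU⟩ := hu
    rw [← hU] at h0
    have := congrArg (fun x => ((U⁻¹ : (G →L[ℝ] G)ˣ) : G →L[ℝ] G) x) h0
    simp only [map_zero] at this
    rw [← mul_apply_eq_comp, Units.inv_mul] at this
    simpa using this

end Frobenius

/-! ### Frobenius theorem without normalization. -/

section FrobeniusGeneral

variable {E G : Type*} [NormedAddCommGroup E] [NormedSpace ℝ E]
  [NormedAddCommGroup G] [NormedSpace ℝ G]

/-- **Frobenius theorem** in the analytic category: an involutive Pfaffian system `A` with a
right inverse at `z₀` has local first integrals near `z₀`. -/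
theorem exists_first_integral [CompleteSpace E] [CompleteSpace G] {A : E → E →L[ℝ] G} {z₀ : E}
    (hA : AnalyticAt ℝ A z₀) {R : G →L[ℝ] E} (hR : ∀ c, A z₀ (R c) = c)
    (hinv : ∀ᶠ z in 𝓝 z₀, ∀ a b, A z a = 0 → A z b = 0 →
      fderiv ℝ A z a b = fderiv ℝ A z b a) :
    ∃ g : E → G, AnalyticAt ℝ g z₀ ∧ ∀ᶠ z in 𝓝 z₀, ∀ v, fderiv ℝ g z v = 0 ↔ A z v = 0 := by
  have hN : AnalyticAt ℝ (fun z => (A z).comp R) z₀ :=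
    ((ContinuousLinearMap.compL ℝ G E G).flip R).analyticAt _ |>.fun_comp hA
  have hN0 : (A z₀).comp R = 1 := by ext c; simp [hR]
  have hM : AnalyticAt ℝ (fun z => Ring.inverse ((A z).comp R)) z₀ := by
    refine AnalyticAt.fun_comp (g := Ring.inverse) ?_ hN
    rw [hN0]
    exact analyticAt_inverse (𝕜 := ℝ) (A := G →L[ℝ] G) 1
  have hunit : ∀ᶠ z in 𝓝 z₀, IsUnit ((A z).comp R) := by
    refine hN.continuousAt.eventually (p := fun L => IsUnit L) ?_
    beta_reduce
    rw [hN0]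
    exact Units.isOpen.mem_nhds isUnit_one
  -- Left multiplication by (A R)⁻¹ normalizes the system to B R = id and keeps the kernel.
  set B : E → E →L[ℝ] G := fun z => (Ring.inverse ((A z).comp R)).comp (A z) with hBdef
  have hB : AnalyticAt ℝ B z₀ :=
    ((ContinuousLinearMap.compL ℝ E G G).analyticAt_bilinear _).fun_comp (hM.prod hA)
  have hker : ∀ z, IsUnit ((A z).comp R) → ∀ v, B z v = 0 ↔ A z v = 0 := by
    intro z hz v
    constructor
    · intro h
      have h1 : ((A z).comp R * Ring.inverse ((A z).comp R)) (A z v) = 0 := by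
        rw [mul_apply_eq_comp]
        change (A z).comp R (B z v) = 0
        rw [h, map_zero]
      rwa [Ring.mul_inverse_cancel _ hz] at h1
    · intro h
      simp [hBdef, h]
  -- On vectors killed by A the derivative of the factor (A R)⁻¹ drops out, so the involutivity
  -- condition passes from A to B.
  have hfd : ∀ z, AnalyticAt ℝ A z → AnalyticAt ℝ (fun z => Ring.inverse ((A z).comp R)) z →
      ∀ a b, A z b = 0 → fderiv ℝ B z a b = Ring.inverse ((A z).comp R) (fderiv ℝ A z a b) := by
    intro z h1 h2 a b hb
    have h3 := (h2.differentiableAt.hasFDerivAt.clm_comp h1.differentiableAt.hasFDerivAt).fderiv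
    change fderiv ℝ B z = _ at h3
    rw [h3]
    simp [hb]
  obtain ⟨g, hg, hg'⟩ := exists_first_integral_of_normalized hB (R := R)
    (by
      filter_upwards [hunit] with z hz c
      change (Ring.inverse ((A z).comp R) * (A z).comp R) c = c
      rw [Ring.inverse_mul_cancel _ hz]
      rfl)
    (by
      filter_upwards [hunit, hinv, hA.eventually_analyticAt, hM.eventually_analyticAt]
        with z hz hi h1 h2 a b ha hb
      rw [hker z hz] at ha hb
      rw [hfd z h1 h2 a b hb, hfd z h1 h2 b a ha, hi a b ha hb])
  refine ⟨g, hg, ?_⟩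
  filter_upwards [hg', hunit] with z h1 h2 v
  rw [h1, hker z h2]

end FrobeniusGeneral

/-! ### Differentials and Lie brackets on manifolds. -/

section Derivation

variable {E E' : Type*} [NormedAddCommGroup E] [NormedSpace ℝ E]
  [NormedAddCommGroup E'] [NormedSpace ℝ E']
  {M : Type*} [TopologicalSpace M] [ChartedSpace E M]

/-- The terms with second derivatives of `f` cancel by symmetry. -/
theorem fderiv_lieBracket_apply {f : E → E'} {p : E} (hf : ContDiffAt ℝ 2 f p) {X Y : E → E}
    (hX : DifferentiableAt ℝ X p) (hY : DifferentiableAt ℝ Y p) :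
    fderiv ℝ f p (VectorField.lieBracket ℝ X Y p) =
      fderiv ℝ (fun y => fderiv ℝ f y (Y y)) p (X p) -
        fderiv ℝ (fun y => fderiv ℝ f y (X y)) p (Y p) := by
  have hd : DifferentiableAt ℝ (fderiv ℝ f) p :=
    (hf.fderiv_right (m := 1) (by norm_num)).differentiableAt (by norm_num)
  have hsymm : IsSymmSndFDerivAt ℝ f p := hf.isSymmSndFDerivAt (by simp)
  have h : ∀ Z : E → E, DifferentiableAt ℝ Z p → ∀ v,
      fderiv ℝ (fun y => fderiv ℝ f y (Z y)) p v =
        fderiv ℝ f p (fderiv ℝ Z p v) + fderiv ℝ (fderiv ℝ f) p v (Z p) := by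
    intro Z hZ v
    rw [fderiv_clm_apply hd hZ]
    simp
  rw [h Y hY, h X hX, VectorField.lieBracket_eq, hsymm.eq (X p) (Y p)]
  simp

variable (E) in
/-- The differential at `q` of a map from a manifold modelled on `E` to a vector space, as a linear
map from `E`. -/
noncomputable def vdiff (f : M → E') (q : M) : E →L[ℝ] E' := mfderiv 𝓘(ℝ, E) 𝓘(ℝ, E') f q

theorem vdiff_congr {f g : M → E'} {q : M} (h : f =ᶠ[𝓝 q] g) : vdiff E f q = vdiff E g q :=
  h.mfderiv_eq

theorem vdiff_comp {E'' : Type*} [NormedAddCommGroup E''] [NormedSpace ℝ E''] {f : M → E'}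
    {g : E' → E''} {q : M} (hf : MDifferentiableAt 𝓘(ℝ, E) 𝓘(ℝ, E') f q)
    (hg : DifferentiableAt ℝ g (f q)) :
    vdiff E (g ∘ f) q = (fderiv ℝ g (f q)).comp (vdiff E f q) := by
  have := mfderiv_comp (I := 𝓘(ℝ, E)) (I' := 𝓘(ℝ, E')) (I'' := 𝓘(ℝ, E'')) q
    hg.mdifferentiableAt hf
  rw [mfderiv_eq_fderiv] at this
  exact this

theorem vdiff_vectorSpace (f : E → E') (y : E) : vdiff E f y = fderiv ℝ f y := mfderiv_eq_fderiv

theorem vdiff_comp_map {M' : Type*} [TopologicalSpace M'] {E'' : Type*} [NormedAddCommGroup E'']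
    [NormedSpace ℝ E''] [ChartedSpace E'' M'] {g : M' → M} {f : M → E'} {q : M'}
    (hf : MDifferentiableAt 𝓘(ℝ, E) 𝓘(ℝ, E') f (g q))
    (hg : MDifferentiableAt 𝓘(ℝ, E'') 𝓘(ℝ, E) g q) :
    vdiff E'' (f ∘ g) q = (vdiff E f (g q)).comp
      (show E'' →L[ℝ] E from mfderiv 𝓘(ℝ, E'') 𝓘(ℝ, E) g q) :=
  mfderiv_comp (I := 𝓘(ℝ, E'')) (I' := 𝓘(ℝ, E)) (I'' := 𝓘(ℝ, E')) q hf hg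

/-- The Lie bracket of vector fields on a manifold modelled on `E`, regarded as maps to `E`. -/
noncomputable def fieldBracket (X Y : M → E) (q : M) : E :=
  VectorField.mlieBracket 𝓘(ℝ, E) (M := M) X Y q

/-- The vector field `X` in the preferred chart at `q`. -/
noncomputable def chartField (q : M) (X : M → E) : E → E :=
  VectorField.mpullbackWithin 𝓘(ℝ, E) 𝓘(ℝ, E) (extChartAt 𝓘(ℝ, E) q).symm X (range 𝓘(ℝ, E))

variable [IsManifold 𝓘(ℝ, E) ω M]

/-- Differentiability of a vector field at a point. -/
abbrev FieldDifferentiableAt (X : M → E) (q : M) : Prop :=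
  MDifferentiableAt 𝓘(ℝ, E) 𝓘(ℝ, E).tangent (fun x => (⟨x, X x⟩ : TangentBundle 𝓘(ℝ, E) M)) q

theorem chartField_self (q : M) (X : M → E) :
    chartField q X (extChartAt 𝓘(ℝ, E) q q) = X q := by
  have : IsManifold 𝓘(ℝ, E) 1 M := IsManifold.of_le (n := ω) le_top
  refine (mfderivWithin_extChartAt_symm_inverse_apply (I := 𝓘(ℝ, E)) (x := q) _).trans ?_
  exact congrArg X (extChartAt_to_inv (I := 𝓘(ℝ, E)) q)

theorem vdiff_chart_apply (q : M) (v : E) : vdiff E (extChartAt 𝓘(ℝ, E) q) q v = v := by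
  have : IsManifold 𝓘(ℝ, E) 1 M := IsManifold.of_le (n := ω) le_top
  unfold vdiff
  rw [mfderiv_extChartAt_self]
  rfl

theorem differentiableAt_chartField [CompleteSpace E] {q : M} {X : M → E}
    (hX : FieldDifferentiableAt X q) :
    DifferentiableAt ℝ (chartField q X) (extChartAt 𝓘(ℝ, E) q q) := by
  have : IsManifold 𝓘(ℝ, E) 2 M := IsManifold.of_le (n := ω) le_top
  have := MDifferentiableWithinAt.differentiableWithinAt_mpullbackWithin_vectorField
    (I := 𝓘(ℝ, E)) (V := X) (hX.mdifferentiableWithinAt (s := univ))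
  rw [preimage_univ, univ_inter, modelWithCornersSelf_coe, range_id] at this
  unfold chartField
  rw [modelWithCornersSelf_coe, range_id]
  exact differentiableWithinAt_univ.1 this

/-- The preferred chart at `q` has identity differential at `q`, so the pullback in the definition
of the bracket reduces to the inverse of the identity, which is removed in the next lemma. -/
theorem mlieBracket_eq_inverse_id (q : M) (X Y : (x : M) → TangentSpace 𝓘(ℝ, E) x) :
    VectorField.mlieBracket 𝓘(ℝ, E) X Y q = (ContinuousLinearMap.inverse
      (ContinuousLinearMap.id ℝ (TangentSpace 𝓘(ℝ, E) q)))
      ((VectorField.lieBracketWithin ℝ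
      (VectorField.mpullbackWithin 𝓘(ℝ, E) 𝓘(ℝ, E) (extChartAt 𝓘(ℝ, E) q).symm X (range 𝓘(ℝ, E)))
      (VectorField.mpullbackWithin 𝓘(ℝ, E) 𝓘(ℝ, E) (extChartAt 𝓘(ℝ, E) q).symm Y (range 𝓘(ℝ, E)))
      ((extChartAt 𝓘(ℝ, E) q).symm ⁻¹' univ ∩ range 𝓘(ℝ, E))) (extChartAt 𝓘(ℝ, E) q q)) := by
  have : IsManifold 𝓘(ℝ, E) 1 M := IsManifold.of_le (n := ω) le_top
  rw [← VectorField.mlieBracketWithin_univ, VectorField.mlieBracketWithin_apply,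
    mfderiv_extChartAt_self]
  rfl

theorem fieldBracket_eq_chartField (q : M) (X Y : M → E) :
    fieldBracket X Y q =
      VectorField.lieBracket ℝ (chartField q X) (chartField q Y) (extChartAt 𝓘(ℝ, E) q q) := by
  have : IsManifold 𝓘(ℝ, E) 1 M := IsManifold.of_le (n := ω) le_top
  have h1 : ∀ v : E, (ContinuousLinearMap.inverse (ContinuousLinearMap.id ℝ E)) v = v := by
    intro v
    rw [ContinuousLinearMap.inverse_id]
    rfl
  refine (mlieBracket_eq_inverse_id q X Y).trans ((h1 _).trans ?_)
  rw [preimage_univ, univ_inter]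
  unfold chartField
  rw [modelWithCornersSelf_coe, range_id]
  exact congrFun (VectorField.lieBracketWithin_univ (𝕜 := ℝ) (E := E)) _

/-- One fixed chart serves a whole neighbourhood of `q`, so the identity may be differentiated at
`q`. -/
theorem vdiff_eq_fderiv_chart {f : M → E'} {q : M}
    (hf : ContMDiffAt 𝓘(ℝ, E) 𝓘(ℝ, E') ω f q) (X : M → E) :
    ∀ᶠ z in 𝓝 q, vdiff E f z (X z) =
      fderiv ℝ (f ∘ (extChartAt 𝓘(ℝ, E) q).symm) (extChartAt 𝓘(ℝ, E) q z)
        (chartField q X (extChartAt 𝓘(ℝ, E) q z)) := by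
  have : IsManifold 𝓘(ℝ, E) 1 M := IsManifold.of_le (n := ω) le_top
  have hf1 : ContMDiffAt 𝓘(ℝ, E) 𝓘(ℝ, E') 1 f q := hf.of_le le_top
  filter_upwards [extChartAt_source_mem_nhds (I := 𝓘(ℝ, E)) q,
    contMDiffAt_iff_contMDiffAt_nhds (by simp) |>.1 hf1] with z hz hfz
  have hl : (extChartAt 𝓘(ℝ, E) q).symm (extChartAt 𝓘(ℝ, E) q z) = z :=
    (extChartAt 𝓘(ℝ, E) q).left_inv hz
  have ht := (extChartAt 𝓘(ℝ, E) q).map_source hz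
  have hinv := isInvertible_mfderivWithin_extChartAt_symm (I := 𝓘(ℝ, E)) ht
  have hs : MDifferentiableAt 𝓘(ℝ, E) 𝓘(ℝ, E) (extChartAt 𝓘(ℝ, E) q).symm
      (extChartAt 𝓘(ℝ, E) q z) := by
    have := mdifferentiableWithinAt_extChartAt_symm (I := 𝓘(ℝ, E)) ht
    rwa [modelWithCornersSelf_coe, range_id, mdifferentiableWithinAt_univ] at this
  have hfz' : MDifferentiableAt 𝓘(ℝ, E) 𝓘(ℝ, E') f
      ((extChartAt 𝓘(ℝ, E) q).symm (extChartAt 𝓘(ℝ, E) q z)) := by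
    rw [hl]; exact hfz.mdifferentiableAt (by simp)
  have hc := vdiff_comp_map hfz' hs
  rw [vdiff_vectorSpace] at hc
  rw [hc, ContinuousLinearMap.comp_apply]
  have h2 : (show E →L[ℝ] E from mfderiv 𝓘(ℝ, E) 𝓘(ℝ, E) (extChartAt 𝓘(ℝ, E) q).symm
      (extChartAt 𝓘(ℝ, E) q z)) (chartField q X (extChartAt 𝓘(ℝ, E) q z)) = X z := by
    have h3 := hinv.self_apply_inverse (X ((extChartAt 𝓘(ℝ, E) q).symm (extChartAt 𝓘(ℝ, E) q z)))
    unfold chartField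
    rw [modelWithCornersSelf_coe, range_id, mfderivWithin_univ] at h3
    rw [modelWithCornersSelf_coe, range_id, ← mfderivWithin_univ]
    rw [← mfderivWithin_univ] at h3
    exact h3.trans (congrArg X hl)
  rw [h2, hl]

/-- The formula df[X, Y] = X(df Y) - Y(df X) for vector-valued f, obtained from the flat case in the
preferred chart. All integrability questions below are settled by it; `a` and `b` need only agree
with df X and df Y near `q`. -/
theorem vdiff_fieldBracket [CompleteSpace E] {f : M → E'} {q : M}
    (hf : ContMDiffAt 𝓘(ℝ, E) 𝓘(ℝ, E') ω f q) {X Y : M → E}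
    (hX : FieldDifferentiableAt X q) (hY : FieldDifferentiableAt Y q)
    {a b : M → E'} (ha : ∀ᶠ z in 𝓝 q, vdiff E f z (X z) = a z)
    (hb : ∀ᶠ z in 𝓝 q, vdiff E f z (Y z) = b z) :
    MDifferentiableAt 𝓘(ℝ, E) 𝓘(ℝ, E') a q ∧ MDifferentiableAt 𝓘(ℝ, E) 𝓘(ℝ, E') b q ∧
    vdiff E f q (fieldBracket X Y q) = vdiff E b q (X q) - vdiff E a q (Y q) := by
  have : IsManifold 𝓘(ℝ, E) 1 M := IsManifold.of_le (n := ω) le_top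
  set ζ := extChartAt 𝓘(ℝ, E) q with hζ
  have hζd : MDifferentiableAt 𝓘(ℝ, E) 𝓘(ℝ, E) ζ q :=
    mdifferentiableAt_extChartAt (mem_chart_source E q)
  set F : E → E' := f ∘ ζ.symm with hF
  have hFc : ContDiffAt ℝ ω F (ζ q) := by
    have := (contMDiffAt_iff.1 hf).2
    rw [modelWithCornersSelf_coe, range_id, contDiffWithinAt_univ] at this
    exact this
  have key : ∀ {Z : M → E} {c : M → E'}, FieldDifferentiableAt Z q →
      (∀ᶠ z in 𝓝 q, vdiff E f z (Z z) = c z) →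
      MDifferentiableAt 𝓘(ℝ, E) 𝓘(ℝ, E') c q ∧ ∀ v : E, vdiff E c q v =
        fderiv ℝ (fun y => fderiv ℝ F y (chartField q Z y)) (ζ q) v := by
    intro Z c hZ hc
    have h1 : c =ᶠ[𝓝 q] (fun y => fderiv ℝ F y (chartField q Z y)) ∘ ζ := by
      filter_upwards [hc, vdiff_eq_fderiv_chart hf Z] with z h1 h2
      rw [← h1, h2]; rfl
    have h2 : DifferentiableAt ℝ (fun y => fderiv ℝ F y (chartField q Z y)) (ζ q) :=
      ((hFc.fderiv_right (m := 1) (by simp)).differentiableAt (by simp)).clm_apply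
        (differentiableAt_chartField hZ)
    refine ⟨?_, fun v => ?_⟩
    · exact (h2.mdifferentiableAt.comp q hζd).congr_of_eventuallyEq h1
    · rw [vdiff_congr h1, vdiff_comp hζd h2, ContinuousLinearMap.comp_apply, vdiff_chart_apply]
  obtain ⟨a1, a2⟩ := key hX ha
  obtain ⟨b1, b2⟩ := key hY hb
  refine ⟨a1, b1, ?_⟩
  rw [a2, b2, fieldBracket_eq_chartField]
  have h0 : vdiff E f q (VectorField.lieBracket ℝ (chartField q X) (chartField q Y) (ζ q)) =
      fderiv ℝ F (ζ q) (VectorField.lieBracket ℝ (chartField q X) (chartField q Y) (ζ q)) := by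
    have h1 : f =ᶠ[𝓝 q] F ∘ ζ := by
      filter_upwards [extChartAt_source_mem_nhds (I := 𝓘(ℝ, E)) q] with z hz
      simp only [hF, hζ, Function.comp_apply, (extChartAt 𝓘(ℝ, E) q).left_inv hz]
    rw [vdiff_congr h1, vdiff_comp hζd (hFc.differentiableAt (by simp)),
      ContinuousLinearMap.comp_apply, vdiff_chart_apply]
  rw [h0, fderiv_lieBracket_apply (hFc.of_le le_top) (differentiableAt_chartField hX)
    (differentiableAt_chartField hY), chartField_self, chartField_self]

theorem VeroneseWeb.AnalyticVectorFieldOn.fieldDifferentiableAt {X : M → E} {V : Set M}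
    (hV : IsOpen V)
    (hX : VeroneseWeb.AnalyticVectorFieldOn 𝓘(ℝ, E) X V) {q : M} (hq : q ∈ V) :
    FieldDifferentiableAt X q :=
  (ContMDiffOn.contMDiffAt hX (hV.mem_nhds hq)).mdifferentiableAt (by simp)

end Derivation

/-! ### Pullback of fields and the coordinate form of integrability. -/

section Pullback

variable {E G : Type*} [NormedAddCommGroup E] [NormedSpace ℝ E] [CompleteSpace E]
  [NormedAddCommGroup G] [NormedSpace ℝ G]
  {M : Type*} [TopologicalSpace M] [ChartedSpace E M] [IsManifold 𝓘(ℝ, E) ω M]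

/-- `vdiff E f z` refers to the preferred chart at `z`, which may jump with `z`, so continuity is
not available directly. It is factored through the fixed chart at `q`: the derivative there is
continuous, and the other factor is invertible. -/
theorem eventually_isInvertible_vdiff {f : M → E} {q : M}
    (hf : ContMDiffAt 𝓘(ℝ, E) 𝓘(ℝ, E) ω f q) (hq : (vdiff E f q).IsInvertible) :
    ∀ᶠ z in 𝓝 q, (vdiff E f z).IsInvertible := by
  have : IsManifold 𝓘(ℝ, E) 1 M := IsManifold.of_le (n := ω) le_top
  set ζ := extChartAt 𝓘(ℝ, E) q with hζ
  have hζd : ∀ z ∈ ζ.source, MDifferentiableAt 𝓘(ℝ, E) 𝓘(ℝ, E) ζ z := fun z hz =>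
    mdifferentiableAt_extChartAt (by simpa [hζ] using hz)
  have hFc : ContDiffAt ℝ ω (f ∘ ζ.symm) (ζ q) := by
    have := (contMDiffAt_iff.1 hf).2
    rw [modelWithCornersSelf_coe, range_id, contDiffWithinAt_univ] at this
    exact this
  have hFan : AnalyticAt ℝ (f ∘ ζ.symm) (ζ q) := hFc.analyticAt
  have hζc : ContinuousAt ζ q := continuousAt_extChartAt (I := 𝓘(ℝ, E)) q
  have heq : ∀ z ∈ ζ.source, AnalyticAt ℝ (f ∘ ζ.symm) (ζ z) →
      vdiff E f z = (fderiv ℝ (f ∘ ζ.symm) (ζ z)).comp (vdiff E ζ z) := by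
    intro z hz ha
    rw [← vdiff_comp (hζd z hz) ha.differentiableAt]
    refine vdiff_congr ?_
    filter_upwards [(isOpen_extChartAt_source (I := 𝓘(ℝ, E)) q).mem_nhds hz] with z' hz'
    simp only [Function.comp_apply, hζ, (extChartAt 𝓘(ℝ, E) q).left_inv hz']
  have hqs : q ∈ ζ.source := mem_extChartAt_source (I := 𝓘(ℝ, E)) q
  have hζi : ∀ z ∈ ζ.source, (vdiff E ζ z).IsInvertible := fun z hz =>
    isInvertible_mfderiv_extChartAt (I := 𝓘(ℝ, E)) hz
  have hFi : (fderiv ℝ (f ∘ ζ.symm) (ζ q)).IsInvertible := by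
    rw [heq q hqs hFan] at hq
    obtain ⟨L, hL⟩ := hζi q hqs
    rw [← hL] at hq
    exact (ContinuousLinearMap.isInvertible_comp_equiv (e := L)).1 hq
  have hopen : ∀ᶠ L in 𝓝 (fderiv ℝ (f ∘ ζ.symm) (ζ q)), L.IsInvertible := by
    obtain ⟨L, hL⟩ := hFi
    rw [← hL]
    filter_upwards [L.nhds] with L' hL'
    exact hL'
  have h2 : ContinuousAt (fun z => fderiv ℝ (f ∘ ζ.symm) (ζ z)) q :=
    ContinuousAt.comp (g := fderiv ℝ (f ∘ ζ.symm)) hFan.fderiv.continuousAt hζc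
  filter_upwards [h2.eventually hopen, extChartAt_source_mem_nhds (I := 𝓘(ℝ, E)) q,
    hζc.eventually hFan.eventually_analyticAt] with z h1 h2 h3
  rw [heq z h2 h3]
  exact h1.comp (hζi z h2)

/-- The pullback of an analytic vector field under a locally diffeomorphic map is analytic. -/
theorem analyticVectorFieldOn_pullback {f : M → E} {V : Set M} (hV : IsOpen V)
    (hf : ContMDiffOn 𝓘(ℝ, E) 𝓘(ℝ, E) ω f V) (hi : ∀ q ∈ V, (vdiff E f q).IsInvertible)
    {X : E → E} (hX : ∀ q ∈ V, AnalyticAt ℝ X (f q)) :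
    VeroneseWeb.AnalyticVectorFieldOn 𝓘(ℝ, E) (fun q => (vdiff E f q).inverse (X (f q))) V := by
  intro q hq
  have hfq : ContMDiffAt 𝓘(ℝ, E) 𝓘(ℝ, E) ω f q := hf.contMDiffAt (hV.mem_nhds hq)
  have h1 : ContMDiffAt 𝓘(ℝ, E) 𝓘(ℝ, E).tangent ω
      (fun y => (⟨y, X y⟩ : TangentBundle 𝓘(ℝ, E) E)) (f q) :=
    contMDiffAt_vectorSpace_iff_contDiffAt.2 (hX q hq).contDiffAt
  exact (ContMDiffAt.mpullback_vectorField_preimage (I := 𝓘(ℝ, E)) (I' := 𝓘(ℝ, E)) (n := ω)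
    (V := X) h1 hfq (hi q hq) (by simp)).contMDiffWithinAt

/-- Integrability of the kernel of a constant linear combination `l` of the components of an
analytic coframe `Γ`, expressed in coordinates. -/
theorem fderiv_symm_of_isIntegrableOn {H : Type*} [NormedAddCommGroup H] [NormedSpace ℝ H]
    [CompleteSpace H]
    {f : M → E} {U : Set M} (hU : IsOpen U)
    (hf : ContMDiffOn 𝓘(ℝ, E) 𝓘(ℝ, E) ω f U) (hi : ∀ q ∈ U, (vdiff E f q).IsInvertible)
    {D : (q : M) → Submodule ℝ (TangentSpace 𝓘(ℝ, E) q)}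
    (hD : VeroneseWeb.IsIntegrableOn 𝓘(ℝ, E) D univ)
    {Γ : E → E →L[ℝ] H} {l : H →L[ℝ] G} (hΓ : ∀ q ∈ U, AnalyticAt ℝ Γ (f q))
    (hΓi : ∀ q ∈ U, (Γ (f q)).IsInvertible)
    (hmem : ∀ q ∈ U, ∀ v : E, v ∈ (D q : Set (TangentSpace 𝓘(ℝ, E) q)) ↔
      l (Γ (f q) (vdiff E f q v)) = 0)
    {q : M} (hq : q ∈ U) {b b' : E} (hb : l (Γ (f q) b) = 0) (hb' : l (Γ (f q) b') = 0) :
    l (fderiv ℝ Γ (f q) b b') = l (fderiv ℝ Γ (f q) b' b) := by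
  set y := f q with hy
  -- The vector c is extended to a field on which Γ is constant. A field starting in the kernel of l
  -- ∘ Γ stays in it, and derivatives of the field become derivatives of Γ.
  set s : E → E → E := fun c y' => (Γ y').inverse (Γ y c) with hs
  set X : E → M → E := fun c q' => (vdiff E f q').inverse (s c (f q')) with hX
  have hsan : ∀ c, ∀ q' ∈ U, AnalyticAt ℝ (s c) (f q') := by
    intro c q' hq'
    obtain ⟨L, hL⟩ := hΓi q' hq'
    have h1 : ContDiffAt ℝ ω ContinuousLinearMap.inverse (Γ (f q')) := by
      rw [← hL]
      exact contDiffAt_map_inverse L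
    have h2 : ContDiffAt ℝ ω (fun y' => (Γ y').inverse) (f q') :=
      h1.comp (f q') (hΓ q' hq').contDiffAt
    exact (h2.clm_apply contDiffAt_const).analyticAt
  have hXan : ∀ c, VeroneseWeb.AnalyticVectorFieldOn 𝓘(ℝ, E) (X c) U := fun c =>
    analyticVectorFieldOn_pullback hU hf hi (hsan c)
  have hfX : ∀ c, ∀ q' ∈ U, vdiff E f q' (X c q') = s c (f q') := fun c q' hq' =>
    (hi q' hq').self_apply_inverse _
  have hΓs : ∀ c, ∀ q' ∈ U, Γ (f q') (s c (f q')) = Γ y c := fun c q' hq' =>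
    (hΓi q' hq').self_apply_inverse _
  have hsy : ∀ c, s c y = c := fun c => (hΓi q hq).inverse_apply_self c
  have hXmem : ∀ c, l (Γ y c) = 0 → ∀ q' ∈ U, X c q' ∈ (D q' : Set (TangentSpace 𝓘(ℝ, E) q')) := by
    intro c hc q' hq'
    rw [hmem q' hq', hfX c q' hq', hΓs c q' hq', hc]
  have hfq : ContMDiffAt 𝓘(ℝ, E) 𝓘(ℝ, E) ω f q := hf.contMDiffAt (hU.mem_nhds hq)
  have hbr := hD U hU (subset_univ _) (X b) (X b') (hXan b) (hXan b') (hXmem b hb)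
    (hXmem b' hb') q hq
  have hbr' : l (Γ y (vdiff E f q (fieldBracket (X b) (X b') q))) = 0 := (hmem q hq _).1 hbr
  obtain ⟨-, -, h3⟩ := vdiff_fieldBracket hfq
    (VeroneseWeb.AnalyticVectorFieldOn.fieldDifferentiableAt hU (hXan b) hq)
    (VeroneseWeb.AnalyticVectorFieldOn.fieldDifferentiableAt hU (hXan b') hq)
    (a := s b ∘ f) (b := s b' ∘ f)
    (Filter.mem_of_superset (hU.mem_nhds hq) (hfX b))
    (Filter.mem_of_superset (hU.mem_nhds hq) (hfX b'))
  have hd : ∀ c c', vdiff E (s c ∘ f) q (X c' q) = fderiv ℝ (s c) y c' := by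
    intro c c'
    rw [vdiff_comp (hfq.mdifferentiableAt (by simp)) (hsan c q hq).differentiableAt,
      ContinuousLinearMap.comp_apply, hfX c' q hq, ← hy, hsy]
  rw [h3, hd, hd] at hbr'
  -- differentiate `Γ (s c) = const` along the manifold
  have hconst : ∀ c v, Γ y (fderiv ℝ (s c) y v) = -fderiv ℝ Γ y v c := by
    intro c v
    have h1 : HasFDerivAt (fun y' => Γ y' (s c y')) _ y :=
      (hΓ q hq).differentiableAt.hasFDerivAt.clm_apply (hsan c q hq).differentiableAt.hasFDerivAt
    have h2 : vdiff E ((fun y' => Γ y' (s c y')) ∘ f) q = 0 := by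
      have : (fun y' => Γ y' (s c y')) ∘ f =ᶠ[𝓝 q] fun _ => Γ y c :=
        Filter.mem_of_superset (hU.mem_nhds hq) (hΓs c)
      rw [vdiff_congr this]
      exact mfderiv_const
    rw [vdiff_comp (hfq.mdifferentiableAt (by simp)) h1.differentiableAt, h1.fderiv] at h2
    have h3 := congrArg (fun L : E →L[ℝ] H => L ((vdiff E f q).inverse v)) h2
    simp only [ContinuousLinearMap.comp_apply, (hi q hq).self_apply_inverse] at h3
    have h4 : Γ y (fderiv ℝ (s c) y v) + fderiv ℝ Γ y v (s c y) = 0 := h3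
    rw [hsy] at h4
    exact eq_neg_of_add_eq_zero_left h4
  rw [map_sub, hconst, hconst, map_sub, map_neg, map_neg, sub_neg_eq_add, add_comm,
    ← sub_eq_add_neg, sub_eq_zero] at hbr'
  exact hbr'.symm

end Pullback

/-! ### Linear algebra of Veronese curves. -/

section VeroneseAlgebra

open Polynomial

theorem eq_zero_of_sum_pow_eq_zero {n : ℕ} {u : Fin (n + 1) → ℝ} (s : Fin (n + 1) → ℝ)
    (hs : Function.Injective s) (h : ∀ l, ∑ j : Fin (n + 1), s l ^ (j : ℕ) * u j = 0) : u = 0 := by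
  have := Matrix.eq_zero_of_mulVec_eq_zero (M := Matrix.vandermonde s) (v := u)
    (Matrix.det_vandermonde_ne_zero_iff.2 hs) (by
      ext l
      simpa [Matrix.mulVec, dotProduct, Matrix.vandermonde_apply] using h l)
  exact this

/-- A polynomial `t ∑ tʲ uⱼ - ∑ tʲ wⱼ` of degree `n + 1` with roots `0, …, n` is determined by its
leading coefficient. -/
theorem sum_pow_eq_prod {n : ℕ} {u w : Fin (n + 1) → ℝ}
    (h : ∀ l : Fin (n + 1), ∑ j : Fin (n + 1), (l : ℝ) ^ (j : ℕ) * ((l : ℝ) * u j - w j) = 0)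
    (t : ℝ) : ∑ j : Fin (n + 1), t ^ (j : ℕ) * (t * u j - w j) =
      (∏ l : Fin (n + 1), (t - (l : ℝ))) * u (Fin.last n) := by
  set Q : ℝ[X] := ∑ j : Fin n, C (u j.castSucc) * X ^ ((j : ℕ) + 1) -
    ∑ j : Fin (n + 1), C (w j) * X ^ (j : ℕ) with hQ
  set N : ℝ[X] := ∏ l : Fin (n + 1), (X - C ((l : ℕ) : ℝ)) with hN
  have hNm : N.Monic := monic_prod_of_monic _ _ fun l _ => monic_X_sub_C _
  have hNd : N.natDegree = n + 1 := by
    rw [hN, natDegree_prod_of_monic _ _ fun l _ => monic_X_sub_C _]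
    simp only [natDegree_X_sub_C]
    simp
  have hP : ∀ t : ℝ, (C (u (Fin.last n)) * X ^ (n + 1) + Q).eval t =
      ∑ j : Fin (n + 1), t ^ (j : ℕ) * (t * u j - w j) := by
    intro t
    simp only [hQ, eval_add, eval_sub, eval_mul, eval_pow, eval_C, eval_X, eval_finsetSum]
    simp only [mul_sub, Finset.sum_sub_distrib]
    rw [Fin.sum_univ_castSucc (f := fun j : Fin (n + 1) => t ^ (j : ℕ) * (t * u j))]
    simp only [Fin.val_castSucc, Fin.val_last]
    have h1 : ∑ j : Fin n, u j.castSucc * t ^ ((j : ℕ) + 1) =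
        ∑ j : Fin n, t ^ (j : ℕ) * (t * u j.castSucc) :=
      Finset.sum_congr rfl fun j _ => by ring
    have h2 : ∑ j : Fin (n + 1), w j * t ^ (j : ℕ) = ∑ j : Fin (n + 1), t ^ (j : ℕ) * w j :=
      Finset.sum_congr rfl fun j _ => by ring
    rw [h1, h2]
    ring
  have hQd : Q.degree < (n + 1 : ℕ) := by
    refine (degree_sub_le _ _).trans_lt (max_lt ?_ ?_)
    · refine (degree_sum_le _ _).trans_lt ?_
      rw [Finset.sup_lt_iff (by exact WithBot.bot_lt_coe _)]
      intro j _
      refine (degree_C_mul_X_pow_le _ _).trans_lt ?_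
      exact_mod_cast Nat.succ_lt_succ j.2
    · refine (degree_sum_le _ _).trans_lt ?_
      rw [Finset.sup_lt_iff (by exact WithBot.bot_lt_coe _)]
      intro j _
      refine (degree_C_mul_X_pow_le _ _).trans_lt ?_
      exact_mod_cast j.2
  have hlow : (X ^ (n + 1) - N : ℝ[X]).degree < (n + 1 : ℕ) := by
    have h1 : (X ^ (n + 1) : ℝ[X]).degree = N.degree := by
      rw [degree_X_pow, degree_eq_natDegree hNm.ne_zero, hNd]
    have h2 := degree_sub_lt_left h1 (pow_ne_zero _ X_ne_zero) (by
      rw [hNm.leadingCoeff]; exact monic_X_pow _)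
    rwa [degree_X_pow] at h2
  -- Both polynomials have the same coefficient at degree n+1, so the difference has degree at most
  -- n, yet it vanishes at the n+1 nodes.
  have key : C (u (Fin.last n)) * X ^ (n + 1) + Q - C (u (Fin.last n)) * N = 0 := by
    refine eq_zero_of_degree_lt_of_eval_finset_eq_zero
      ((Finset.univ : Finset (Fin (n + 1))).image fun l : Fin (n + 1) => ((l : ℕ) : ℝ)) ?_ ?_
    · rw [Finset.card_image_of_injective _ (fun a b hab => by
        simpa [Fin.ext_iff] using hab), Finset.card_univ, Fintype.card_fin]
      have : C (u (Fin.last n)) * X ^ (n + 1) + Q - C (u (Fin.last n)) * N =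
          C (u (Fin.last n)) * (X ^ (n + 1) - N) + Q := by ring
      rw [this]
      refine (degree_add_le _ _).trans_lt (max_lt ?_ hQd)
      rw [← smul_eq_C_mul]
      exact (degree_smul_le _ _).trans_lt hlow
    · intro a ha
      obtain ⟨l, -, rfl⟩ := Finset.mem_image.1 ha
      rw [eval_sub, hP, h l, hN, eval_mul, eval_prod,
        Finset.prod_eq_zero (Finset.mem_univ l) (by simp)]
      simp
  have := congrArg (eval t) key
  rw [eval_sub, hP, eval_mul, eval_C, eval_prod, eval_zero, sub_eq_zero] at this
  rw [this, mul_comm]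
  simp

variable {k n : ℕ}

/-- Evaluation at `t` of the polynomial curve with coefficients `u j`. -/
noncomputable def curveEval (k n : ℕ) (t : OnePoint ℝ) :
    (Fin (n + 1) → Fin k → ℝ) →L[ℝ] (Fin k → ℝ) :=
  t.elim (ContinuousLinearMap.proj (Fin.last n))
    (fun s => ∑ j : Fin (n + 1), s ^ (j : ℕ) • ContinuousLinearMap.proj j)

theorem curveEval_coe_apply (s : ℝ) (u : Fin (n + 1) → Fin k → ℝ) (i : Fin k) :
    curveEval k n (s : OnePoint ℝ) u i = ∑ j : Fin (n + 1), s ^ (j : ℕ) * u j i := by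
  change (∑ j : Fin (n + 1), s ^ (j : ℕ) • ContinuousLinearMap.proj (R := ℝ)
    (φ := fun _ : Fin (n + 1) => Fin k → ℝ) j) u i = _
  simp

theorem curveEval_infty_apply (u : Fin (n + 1) → Fin k → ℝ) :
    curveEval k n OnePoint.infty u = u (Fin.last n) := rfl

/-- A right inverse of `curveEval k n t`. -/
noncomputable def curveSection (k n : ℕ) (t : OnePoint ℝ) :
    (Fin k → ℝ) →L[ℝ] (Fin (n + 1) → Fin k → ℝ) :=
  t.elim (ContinuousLinearMap.single ℝ (fun _ => Fin k → ℝ) (Fin.last n))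
    (fun _ => ContinuousLinearMap.single ℝ (fun _ => Fin k → ℝ) 0)

theorem curveEval_curveSection (t : OnePoint ℝ) (u : Fin k → ℝ) :
    curveEval k n t (curveSection k n t u) = u := by
  induction t using OnePoint.rec with
  | infty =>
    rw [curveEval_infty_apply]
    exact Pi.single_eq_same (M := fun _ => Fin k → ℝ) (Fin.last n) u
  | coe s =>
    ext i
    rw [curveEval_coe_apply, Finset.sum_eq_single 0]
    · change s ^ 0 * (Pi.single (M := fun _ => Fin k → ℝ) 0 u) 0 i = u i
      simp
    · intro j _ hj
      change s ^ (j : ℕ) * (Pi.single (M := fun _ => Fin k → ℝ) 0 u) j i = 0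
      rw [Pi.single_eq_of_ne hj]
      simp
    · simp

theorem eq_zero_of_curveEval_eq_zero {u : Fin (n + 1) → Fin k → ℝ} {s : Fin (n + 1) → ℝ}
    (hs : Function.Injective s) (h : ∀ l, curveEval k n (s l : OnePoint ℝ) u = 0) : u = 0 := by
  ext j i
  have := eq_zero_of_sum_pow_eq_zero (u := fun j => u j i) s hs (fun l => by
    rw [← curveEval_coe_apply, h l]; rfl)
  exact congrFun this j

variable {E : Type*} [NormedAddCommGroup E] [NormedSpace ℝ E]

/-- The operator `t - S`, which stands for the identity if `t = ∞`. -/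
noncomputable def pencil (S : E →L[ℝ] E) (t : OnePoint ℝ) : E →L[ℝ] E :=
  t.elim (ContinuousLinearMap.id ℝ E) (fun s => s • ContinuousLinearMap.id ℝ E - S)

theorem pencil_coe_apply (S : E →L[ℝ] E) (s : ℝ) (b : E) :
    pencil S (s : OnePoint ℝ) b = s • b - S b := rfl

section

variable {Γ : E →L[ℝ] (Fin (n + 1) → Fin k → ℝ)} {S : E →L[ℝ] E}

theorem curveEval_pencil
    (hS : ∀ (l : Fin (n + 1)) (b : E),
      curveEval k n ((l : ℕ) : ℝ) (Γ (((l : ℕ) : ℝ) • b - S b)) = 0)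
    (t : ℝ) (b : E) : curveEval k n t (Γ (t • b - S b)) =
      (∏ l : Fin (n + 1), (t - (l : ℕ))) • curveEval k n OnePoint.infty (Γ b) := by
  ext i
  rw [curveEval_coe_apply, curveEval_infty_apply]
  have h := sum_pow_eq_prod (u := fun j => Γ b j i) (w := fun j => Γ (S b) j i) (fun l => by
    have := congrFun (hS l b) i
    rw [curveEval_coe_apply] at this
    simpa using this) t
  simpa using h

/-- If S b = t b and γ_n(b) = 0, then `curveEval_pencil` at t' gives (t' - t)γ(t')(b) = 0. Hence
γ(t')(b) = 0 for every t' ≠ t, and n+1 such parameters force b = 0. -/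
theorem eq_zero_of_pencil_eq_zero (hΓ : Function.Injective Γ)
    (hS : ∀ (l : Fin (n + 1)) (b : E),
      curveEval k n ((l : ℕ) : ℝ) (Γ (((l : ℕ) : ℝ) • b - S b)) = 0)
    {t : OnePoint ℝ} {b : E} (hb : curveEval k n OnePoint.infty (Γ b) = 0)
    (h : pencil S t b = 0) : b = 0 := by
  induction t using OnePoint.rec with
  | infty => exact h
  | coe t =>
    rw [pencil_coe_apply, sub_eq_zero] at h
    apply hΓ
    rw [map_zero]
    -- These n+1 sample parameters are distinct and all exceed t.
    refine eq_zero_of_curveEval_eq_zero (s := fun l => t + 1 + (l : ℕ)) (fun l l' hl => by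
      simpa [Fin.ext_iff] using hl) (fun l => ?_)
    have h1 := curveEval_pencil hS (t + 1 + (l : ℕ)) b
    rw [hb, smul_zero, ← h, ← sub_smul, map_smul, map_smul, smul_eq_zero] at h1
    refine h1.resolve_left ?_
    have : (0 : ℝ) ≤ (l : ℕ) := Nat.cast_nonneg _
    linarith

theorem curveEval_pencil_eq_zero
    (hS : ∀ (l : Fin (n + 1)) (b : E),
      curveEval k n ((l : ℕ) : ℝ) (Γ (((l : ℕ) : ℝ) • b - S b)) = 0)
    (t : OnePoint ℝ) {b : E} (hb : curveEval k n OnePoint.infty (Γ b) = 0) :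
    curveEval k n t (Γ (pencil S t b)) = 0 := by
  induction t using OnePoint.rec with
  | infty => exact hb
  | coe t => rw [pencil_coe_apply, curveEval_pencil hS, hb, smul_zero]

/-- The pencil is injective from the kernel at ∞ into the kernel at t, and both kernels have
codimension k. -/
theorem exists_pencil_eq_of_curveEval_eq_zero [FiniteDimensional ℝ E]
    (hΓ : Function.Bijective Γ)
    (hS : ∀ (l : Fin (n + 1)) (b : E),
      curveEval k n ((l : ℕ) : ℝ) (Γ (((l : ℕ) : ℝ) • b - S b)) = 0)
    (t : OnePoint ℝ) {v : E} (hv : curveEval k n t (Γ v) = 0) :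
    ∃ b, curveEval k n OnePoint.infty (Γ b) = 0 ∧ pencil S t b = v := by
  have hsurj : ∀ t, Function.Surjective (curveEval k n t ∘L Γ).toLinearMap := by
    intro t u
    obtain ⟨b, hb⟩ := hΓ.2 (curveSection k n t u)
    exact ⟨b, by simp [hb, curveEval_curveSection]⟩
  set W : OnePoint ℝ → Submodule ℝ E := fun t => LinearMap.ker (curveEval k n t ∘L Γ).toLinearMap
    with hW
  have hrank : ∀ t, Module.finrank ℝ (W t) + Module.finrank ℝ (Fin k → ℝ) = Module.finrank ℝ E := by
    intro t
    have := LinearMap.finrank_range_add_finrank_ker (curveEval k n t ∘L Γ).toLinearMap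
    rw [LinearMap.range_eq_top.2 (hsurj t), finrank_top] at this
    rw [← this, add_comm]
  let T : W OnePoint.infty →ₗ[ℝ] W t :=
    (pencil S t).toLinearMap.restrict (fun b hb => curveEval_pencil_eq_zero hS t hb)
  have hT : Function.Injective T := by
    rw [injective_iff_map_eq_zero]
    rintro ⟨b, hb⟩ h
    have h1 : pencil S t b = 0 := congrArg Subtype.val h
    exact Subtype.ext (eq_zero_of_pencil_eq_zero hΓ.1 hS hb h1)
  have hTs : Function.Surjective T :=
    (LinearMap.injective_iff_surjective_of_finrank_eq_finrank (by
      have h1 := hrank t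
      have h2 := hrank OnePoint.infty
      omega)).1 hT
  obtain ⟨⟨b, hb⟩, h⟩ := hTs ⟨v, hv⟩
  exact ⟨b, hb, congrArg Subtype.val h⟩

end

end VeroneseAlgebra

/-! ### Charts and coframes in charts. -/

section Charts

variable {E : Type*} [NormedAddCommGroup E] [NormedSpace ℝ E]
  {M : Type*} [TopologicalSpace M] [ChartedSpace E M]

theorem trans_mem_maximalAtlas {ψ : OpenPartialHomeomorph M E}
    (hψ : ψ ∈ IsManifold.maximalAtlas 𝓘(ℝ, E) ω M) {e : OpenPartialHomeomorph E E}
    (he : ContDiffOn ℝ ω e e.source) (he' : ContDiffOn ℝ ω e.symm e.target) :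
    ψ.trans e ∈ IsManifold.maximalAtlas 𝓘(ℝ, E) ω M := by
  have hG : e ∈ contDiffGroupoid ω 𝓘(ℝ, E) := by
    rw [contDiffGroupoid, mem_groupoid_of_pregroupoid]
    constructor
    · simpa [contDiffPregroupoid] using he
    · simpa [contDiffPregroupoid] using he'
  intro e' hat
  obtain ⟨h1, h2⟩ := hψ e' hat
  constructor
  · rw [OpenPartialHomeomorph.trans_symm_eq_symm_trans_symm, OpenPartialHomeomorph.trans_assoc]
    exact StructureGroupoid.trans _ (StructureGroupoid.symm _ hG) h1
  · rw [← OpenPartialHomeomorph.trans_assoc]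
    exact StructureGroupoid.trans _ h2 hG

theorem vdiff_isInvertible_of_mem_maximalAtlas {φ : OpenPartialHomeomorph M E}
    (hφ : φ ∈ IsManifold.maximalAtlas 𝓘(ℝ, E) ω M) {q : M} (hq : q ∈ φ.source) :
    (vdiff E φ q).IsInvertible ∧
      HasMFDerivAt 𝓘(ℝ, E) 𝓘(ℝ, E) φ.symm (φ q) (vdiff E φ q).inverse := by
  have h1 : MDifferentiableAt 𝓘(ℝ, E) 𝓘(ℝ, E) φ q :=
    (contMDiffAt_of_mem_maximalAtlas hφ hq).mdifferentiableAt (by simp)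
  have h2 : MDifferentiableAt 𝓘(ℝ, E) 𝓘(ℝ, E) φ.symm (φ q) :=
    (contMDiffAt_symm_of_mem_maximalAtlas hφ (φ.map_source hq)).mdifferentiableAt (by simp)
  have hl : φ.symm (φ q) = q := φ.left_inv hq
  set L : E →L[ℝ] E := mfderiv 𝓘(ℝ, E) 𝓘(ℝ, E) φ.symm (φ q) with hL
  have h1' : MDifferentiableAt 𝓘(ℝ, E) 𝓘(ℝ, E) φ (φ.symm (φ q)) := by rwa [hl]
  have c1 : (vdiff E φ q).comp L = ContinuousLinearMap.id ℝ E := by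
    have := vdiff_comp_map h1' h2
    rw [hl] at this
    refine this.symm.trans ?_
    have h3 : φ ∘ φ.symm =ᶠ[𝓝 (φ q)] id := by
      filter_upwards [φ.open_target.mem_nhds (φ.map_source hq)] with y hy
      exact φ.right_inv hy
    rw [vdiff_congr h3, vdiff_vectorSpace, fderiv_id]
  have c2 : L.comp (vdiff E φ q) = ContinuousLinearMap.id ℝ E := by
    have h3 := mfderiv_comp (I := 𝓘(ℝ, E)) (I' := 𝓘(ℝ, E)) (I'' := 𝓘(ℝ, E)) q h2 h1
    refine h3.symm.trans ?_
    have h4 : φ.symm ∘ φ =ᶠ[𝓝 q] id := by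
      filter_upwards [φ.open_source.mem_nhds hq] with y hy
      exact φ.left_inv hy
    rw [h4.mfderiv_eq]
    exact mfderiv_id
  have hinv : (vdiff E φ q).IsInvertible := ContinuousLinearMap.IsInvertible.of_inverse c1 c2
  refine ⟨hinv, ?_⟩
  have h5 : (vdiff E φ q).inverse = L := ContinuousLinearMap.inverse_eq c1 c2
  rw [h5]
  exact h2.hasMFDerivAt

/-- A local analytic coframe read in a chart. -/
theorem exists_coframe_in_chart [IsManifold 𝓘(ℝ, E) ω M] [FiniteDimensional ℝ E] {k n : ℕ}
    (hdim : Module.finrank ℝ E = k * (n + 1))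
    {φ : OpenPartialHomeomorph M E} (hφ : φ ∈ IsManifold.maximalAtlas 𝓘(ℝ, E) ω M)
    {V : Set M} (hV : φ.source ⊆ V)
    {γ : Fin k → Fin (n + 1) → (q : M) → TangentSpace 𝓘(ℝ, E) q →L[ℝ] ℝ}
    (hγ : ∀ i j, VeroneseWeb.AnalyticOneFormOn 𝓘(ℝ, E) (γ i j) V)
    (hli : ∀ q ∈ V, LinearIndependent ℝ (fun ij : Fin k × Fin (n + 1) => γ ij.1 ij.2 q)) :
    ∃ Γ : E → E →L[ℝ] (Fin (n + 1) → Fin k → ℝ),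
      (∀ y ∈ φ.target, AnalyticAt ℝ Γ y) ∧ (∀ y ∈ φ.target, (Γ y).IsInvertible) ∧
      ∀ q ∈ φ.source, ∀ (v : E) i j, Γ (φ q) (vdiff E φ q v) j i = (γ i j q : E →L[ℝ] ℝ) v := by
  have : CompleteSpace E := FiniteDimensional.complete ℝ E
  have hinv := fun q hq => (vdiff_isInvertible_of_mem_maximalAtlas hφ (q := q) hq).1
  have hφan : ContMDiffOn 𝓘(ℝ, E) 𝓘(ℝ, E) ω φ φ.source := contMDiffOn_of_mem_maximalAtlas hφ
  set Γ : E → E →L[ℝ] (Fin (n + 1) → Fin k → ℝ) := fun y =>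
    (ContinuousLinearMap.pi fun j => ContinuousLinearMap.pi fun i =>
      (γ i j (φ.symm y) : E →L[ℝ] ℝ)).comp (vdiff E φ (φ.symm y)).inverse with hΓ
  have hΓq : ∀ q ∈ φ.source, ∀ (v : E) i j,
      Γ (φ q) (vdiff E φ q v) j i = (γ i j q : E →L[ℝ] ℝ) v := by
    intro q hq v i j
    change (γ i j (φ.symm (φ q)) : E →L[ℝ] ℝ)
      ((vdiff E φ (φ.symm (φ q))).inverse (vdiff E φ q v)) = _
    rw [φ.left_inv hq, (hinv q hq).inverse_apply_self]
  refine ⟨Γ, ?_, ?_, hΓq⟩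
  · have hcd : ContDiffOn ℝ ω Γ φ.target := by
      rw [contDiffOn_clm_apply]
      intro v
      rw [contDiffOn_pi]
      intro j
      rw [contDiffOn_pi]
      intro i
      have hX := analyticVectorFieldOn_pullback (X := fun _ => v) φ.open_source hφan hinv
        (fun q _ => analyticAt_const)
      have h1 := ContMDiffOn.clm_bundle_apply (E₁ := fun q : M => TangentSpace 𝓘(ℝ, E) q)
        (E₂ := Bundle.Trivial M ℝ) (b := fun q : M => q)
        (ContMDiffOn.mono (hγ i j) hV) hX
      have h2 : ContMDiffOn 𝓘(ℝ, E) 𝓘(ℝ, ℝ) ω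
          (fun q => (γ i j q : E →L[ℝ] ℝ) ((vdiff E φ q).inverse v)) φ.source := by
        intro q hq
        have h3 := h1 q hq
        rw [Bundle.contMDiffWithinAt_totalSpace] at h3
        exact h3.2
      have h4 := h2.comp (contMDiffOn_symm_of_mem_maximalAtlas hφ) (fun y hy => φ.map_target hy)
      exact h4.contDiffOn
    exact fun y hy => (hcd.contDiffAt (φ.open_target.mem_nhds hy)).analyticAt
  · intro y hy
    obtain ⟨q, hq, rfl⟩ : ∃ q ∈ φ.source, φ q = y := ⟨φ.symm y, φ.map_target hy, φ.right_inv hy⟩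
    obtain ⟨L, hL⟩ := hinv q hq
    have hinj : Function.Injective (Γ (φ q)) := by
      rw [injective_iff_map_eq_zero]
      intro u hu
      obtain ⟨v, rfl⟩ : ∃ v, vdiff E φ q v = u := (hinv q hq).surjective u
      have hv : ∀ i j, (γ i j q : E →L[ℝ] ℝ) v = 0 := by
        intro i j
        rw [← hΓq q hq, hu]; rfl
      suffices v = 0 by rw [this, map_zero]
      set g : Fin k × Fin (n + 1) → E →L[ℝ] ℝ := fun ij => γ ij.1 ij.2 q with hg
      have hli' : LinearIndependent ℝ g := hli q (hV hq)
      have hli'' : LinearIndependent ℝ (fun ij => (g ij : E →ₗ[ℝ] ℝ)) :=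
        hli'.map' (ContinuousLinearMap.coeLM ℝ) (LinearMap.ker_eq_bot.2
          ContinuousLinearMap.coe_injective)
      -- The k(n+1) independent covectors form a basis of the dual space, so a vector killed by all
      -- of them is zero.
      have hspan := hli''.span_eq_top_of_card_eq_finrank' (by
        rw [Fintype.card_prod, Fintype.card_fin, Fintype.card_fin, Subspace.dual_finrank_eq, hdim])
      rw [← Module.forall_dual_apply_eq_zero_iff ℝ]
      intro f
      have hf : f ∈ Submodule.span ℝ (range fun ij => (g ij : E →ₗ[ℝ] ℝ)) := by
        rw [hspan]; trivial
      induction hf using Submodule.span_induction with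
      | mem f hf =>
        obtain ⟨ij, rfl⟩ := hf
        exact hv ij.1 ij.2
      | zero => rfl
      | add f g _ _ hf hg => rw [LinearMap.add_apply, hf, hg, add_zero]
      | smul a f _ hf => rw [LinearMap.smul_apply, hf, smul_zero]
    have hbij : Function.Bijective (Γ (φ q)) := by
      refine ⟨hinj, ?_⟩
      refine (LinearMap.injective_iff_surjective_of_finrank_eq_finrank
        (f := (Γ (φ q)).toLinearMap) ?_).1 hinj
      rw [hdim]
      rw [Module.finrank_pi_fintype]
      simp only [Module.finrank_fin_fun, Finset.sum_const, Finset.card_univ, Fintype.card_fin,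
        smul_eq_mul]
      ring
    exact ⟨(LinearEquiv.ofBijective (Γ (φ q)).toLinearMap hbij).toContinuousLinearEquiv, by
      ext v; rfl⟩

end Charts

/-! ### Coordinates rectifying the distributions at the nodes 0, …, n. -/

section RectifyingChart

theorem isInvertible_of_injective {E F : Type*} [NormedAddCommGroup E] [NormedSpace ℝ E]
    [FiniteDimensional ℝ E] [NormedAddCommGroup F] [NormedSpace ℝ F] [FiniteDimensional ℝ F]
    (hdim : Module.finrank ℝ E = Module.finrank ℝ F) {L : E →L[ℝ] F} (hL : Function.Injective L) :
    L.IsInvertible :=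
  ⟨(LinearEquiv.ofBijective L.toLinearMap ⟨hL,
    (LinearMap.injective_iff_surjective_of_finrank_eq_finrank hdim).1 hL⟩).toContinuousLinearEquiv,
    by ext v; rfl⟩

theorem fderiv_curveEval_comp {E : Type*} [NormedAddCommGroup E] [NormedSpace ℝ E] {k n : ℕ}
    {Γ : E → E →L[ℝ] (Fin (n + 1) → Fin k → ℝ)} {y : E} (h : DifferentiableAt ℝ Γ y)
    (t : OnePoint ℝ) (a b : E) :
    fderiv ℝ (fun y => (curveEval k n t).comp (Γ y)) y a b =
      curveEval k n t (fderiv ℝ Γ y a b) := by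
  have := ((ContinuousLinearMap.compL ℝ E
    (Fin (n + 1) → Fin k → ℝ) (Fin k → ℝ) (curveEval k n t)).hasFDerivAt.comp y
    h.hasFDerivAt).fderiv
  change fderiv ℝ (fun y => (curveEval k n t).comp (Γ y)) y = _ at this
  rw [this]
  rfl

theorem analyticAt_curveEval_comp {E : Type*} [NormedAddCommGroup E] [NormedSpace ℝ E] {k n : ℕ}
    {Γ : E → E →L[ℝ] (Fin (n + 1) → Fin k → ℝ)} {y : E} (h : AnalyticAt ℝ Γ y) (t : OnePoint ℝ) :
    AnalyticAt ℝ (fun y => (curveEval k n t).comp (Γ y)) y :=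
  ((ContinuousLinearMap.compL ℝ E (Fin (n + 1) → Fin k → ℝ) (Fin k → ℝ)
    (curveEval k n t)).analyticAt _).fun_comp h

/-- An analytic map with injective differentials near a point of `E` restricts to an analytic
chart of `E`. -/
theorem exists_openPartialHomeomorph {E : Type*} [NormedAddCommGroup E] [NormedSpace ℝ E]
    [FiniteDimensional ℝ E] {Θ : E → E} {N : Set E} (hN : IsOpen N) {z₀ : E} (hz₀ : z₀ ∈ N)
    (hΘ : ∀ z ∈ N, AnalyticAt ℝ Θ z) (hinj : ∀ z ∈ N, Function.Injective (fderiv ℝ Θ z)) :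
    ∃ e : OpenPartialHomeomorph E E, z₀ ∈ e.source ∧ e.source ⊆ N ∧ (∀ z, e z = Θ z) ∧
      ContDiffOn ℝ ω e e.source ∧ ContDiffOn ℝ ω e.symm e.target := by
  have : CompleteSpace E := FiniteDimensional.complete ℝ E
  have hd : ∀ z ∈ N, ∃ L : E ≃L[ℝ] E, HasFDerivAt Θ (L : E →L[ℝ] E) z := by
    intro z hz
    obtain ⟨L, hL⟩ := isInvertible_of_injective rfl (hinj z hz)
    exact ⟨L, hL ▸ (hΘ z hz).differentiableAt.hasFDerivAt⟩
  obtain ⟨L₀, hL₀⟩ := hd z₀ hz₀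
  have hcd : ContDiffAt ℝ ω Θ z₀ := (hΘ z₀ hz₀).contDiffAt
  set e := (hcd.toOpenPartialHomeomorph Θ hL₀ (by simp)).restrOpen N hN with he
  have hsub : e.source ⊆ N := fun z hz => hz.2
  have hcoe : ∀ z, e z = Θ z := fun z => rfl
  refine ⟨e, ⟨hcd.mem_toOpenPartialHomeomorph_source hL₀ (by simp), hz₀⟩, hsub, hcoe, ?_, ?_⟩
  · intro z hz
    exact (hΘ z (hsub hz)).contDiffAt.contDiffWithinAt
  · intro y hy
    obtain ⟨L, hL⟩ := hd (e.symm y) (hsub (e.map_target hy))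
    exact (e.contDiffAt_symm hy hL (hΘ _ (hsub (e.map_target hy))).contDiffAt).contDiffWithinAt

variable {k n : ℕ}

/-- The identification of block vectors with vectors of the model space. -/
noncomputable def blockEquiv (k n : ℕ) :
    (Fin (n + 1) → Fin k → ℝ) ≃L[ℝ] EuclideanSpace ℝ (Fin (k * (n + 1))) :=
  LinearEquiv.toContinuousLinearEquiv
    { toFun := fun u => WithLp.toLp 2 fun a =>
        u (finProdFinEquiv.symm a).2 (finProdFinEquiv.symm a).1
      invFun := fun v j i => v (finProdFinEquiv (i, j))
      map_add' := fun u v => by ext a; simp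
      map_smul' := fun c u => by ext a; simp
      left_inv := fun u => by ext j i; simp
      right_inv := fun v => by
        ext a
        exact congrArg v (finProdFinEquiv.apply_symm_apply a) }

theorem blockEquiv_apply (u : Fin (n + 1) → Fin k → ℝ) (i : Fin k) (j : Fin (n + 1)) :
    blockEquiv k n u (finProdFinEquiv (i, j)) = u j i := by
  change u (finProdFinEquiv.symm (finProdFinEquiv (i, j))).2
    (finProdFinEquiv.symm (finProdFinEquiv (i, j))).1 = u j i
  rw [Equiv.symm_apply_apply]

variable {M : Type*} [TopologicalSpace M]
  [ChartedSpace (EuclideanSpace ℝ (Fin (k * (n + 1)))) M]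

/-- The coframe `Γ` of the model space defines the curve of distributions `w` in the chart `φ`. -/
structure IsCoframeInChart
    (w : OnePoint ℝ → (x : M) → Submodule ℝ (TangentSpace (𝓡 (k * (n + 1))) x))
    (φ : OpenPartialHomeomorph M (EuclideanSpace ℝ (Fin (k * (n + 1)))))
    (Γ : EuclideanSpace ℝ (Fin (k * (n + 1))) →
      EuclideanSpace ℝ (Fin (k * (n + 1))) →L[ℝ] (Fin (n + 1) → Fin k → ℝ)) : Prop where
  analyticAt : ∀ y ∈ φ.target, AnalyticAt ℝ Γ y
  isInvertible : ∀ y ∈ φ.target, (Γ y).IsInvertible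
  mem_iff : ∀ q ∈ φ.source, ∀ t, ∀ v : EuclideanSpace ℝ (Fin (k * (n + 1))),
    v ∈ (w t q : Set (TangentSpace (𝓡 (k * (n + 1))) q)) ↔
      curveEval k n t (Γ (φ q) (vdiff (EuclideanSpace ℝ (Fin (k * (n + 1)))) φ q v)) = 0

variable [IsManifold (𝓡 (k * (n + 1))) ω M]
  {w : OnePoint ℝ → (x : M) → Submodule ℝ (TangentSpace (𝓡 (k * (n + 1))) x)}

/-- Integrability of w(t) in dual form: the exterior derivative of γ(t) vanishes on pairs of vectors
of w(t). -/
theorem IsCoframeInChart.fderiv_symm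
    {φ : OpenPartialHomeomorph M (EuclideanSpace ℝ (Fin (k * (n + 1))))}
    {Γ : EuclideanSpace ℝ (Fin (k * (n + 1))) →
      EuclideanSpace ℝ (Fin (k * (n + 1))) →L[ℝ] (Fin (n + 1) → Fin k → ℝ)}
    (h : IsCoframeInChart w φ Γ) (hφ : φ ∈ IsManifold.maximalAtlas (𝓡 (k * (n + 1))) ω M)
    (hint : ∀ t, VeroneseWeb.IsIntegrableOn (𝓡 (k * (n + 1))) (w t) univ)
    {y : EuclideanSpace ℝ (Fin (k * (n + 1)))} (hy : y ∈ φ.target) (t : OnePoint ℝ)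
    {b b' : EuclideanSpace ℝ (Fin (k * (n + 1)))} (hb : curveEval k n t (Γ y b) = 0)
    (hb' : curveEval k n t (Γ y b') = 0) :
    curveEval k n t (fderiv ℝ Γ y b b') = curveEval k n t (fderiv ℝ Γ y b' b) := by
  obtain ⟨q, hq, rfl⟩ : ∃ q ∈ φ.source, φ q = y := ⟨φ.symm y, φ.map_target hy, φ.right_inv hy⟩
  exact fderiv_symm_of_isIntegrableOn φ.open_source (contMDiffOn_of_mem_maximalAtlas hφ)
    (fun q hq => (vdiff_isInvertible_of_mem_maximalAtlas hφ hq).1) (hint t)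
    (fun q hq => h.analyticAt _ (φ.map_source hq)) (fun q hq => h.isInvertible _ (φ.map_source hq))
    (fun q hq => h.mem_iff q hq t) hq hb hb'

/-- The neighbourhood is chosen before the chart because the coframe is read twice: in an initial
chart, to find the first integrals, and in the rectifying chart built from them. -/
theorem exists_isCoframeInChart (hw : VeroneseWeb.IsGeneralizedVeroneseCurve k n w) (x : M) :
    ∃ V : Set M, IsOpen V ∧ x ∈ V ∧
      ∀ φ ∈ IsManifold.maximalAtlas (𝓡 (k * (n + 1))) ω M, φ.source ⊆ V →
        ∃ Γ, IsCoframeInChart w φ Γ := by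
  obtain ⟨V, hV, hxV, γ, hγ, hli, hmem⟩ := hw x
  refine ⟨V, hV, hxV, fun φ hφ hφV => ?_⟩
  obtain ⟨Γ, h1, h2, h3⟩ := exists_coframe_in_chart (by simp) hφ hφV hγ hli
  refine ⟨Γ, h1, h2, fun q hq t v => (hmem t q (hφV hq) v).trans ?_⟩
  rw [funext_iff]
  refine forall_congr' fun i => ?_
  have : VeroneseWeb.veroneseValue (fun j => γ i j q) t v = curveEval k n t
      (Γ (φ q) (vdiff (EuclideanSpace ℝ (Fin (k * (n + 1)))) φ q v)) i := by
    induction t using OnePoint.rec with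
    | infty =>
      rw [curveEval_infty_apply]
      exact (h3 q hq v _ _).symm
    | coe s =>
      rw [curveEval_coe_apply]
      set g : Fin (n + 1) → EuclideanSpace ℝ (Fin (k * (n + 1))) →L[ℝ] ℝ := fun j => γ i j q
      change (∑ j : Fin (n + 1), s ^ (j : ℕ) • g j) v = _
      rw [sum_apply]
      refine Finset.sum_congr rfl fun j _ => ?_
      rw [h3 q hq v]
      rfl
  rw [this]
  rfl

/-- There are charts in which every distribution `w l`, `l = 0, …, n`, is the common kernel of the
differentials of the coordinates of the `l`-th block. -/
theorem exists_rectifying_chart (hw : VeroneseWeb.IsGeneralizedVeroneseCurve k n w)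
    (hint : ∀ t, VeroneseWeb.IsIntegrableOn (𝓡 (k * (n + 1))) (w t) univ) (x : M) :
    ∃ φ ∈ IsManifold.maximalAtlas (𝓡 (k * (n + 1))) ω M, x ∈ φ.source ∧
      ∃ Γ, IsCoframeInChart w φ Γ ∧ ∀ y ∈ φ.target, ∀ (l : Fin (n + 1)) v,
        curveEval k n ((l : ℕ) : ℝ) (Γ y v) = 0 ↔ ∀ i : Fin k, v (finProdFinEquiv (i, l)) = 0 := by
  obtain ⟨V, hV, hxV, hVφ⟩ := exists_isCoframeInChart hw x
  set ψ := (chartAt (EuclideanSpace ℝ (Fin (k * (n + 1)))) x).restr V with hψdef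
  have hψ : ψ ∈ IsManifold.maximalAtlas (𝓡 (k * (n + 1))) ω M := by
    have := restr_mem_maximalAtlas (contDiffGroupoid ω (𝓡 (k * (n + 1))))
      (IsManifold.chart_mem_maximalAtlas (I := 𝓡 (k * (n + 1))) (n := ω) x) hV
    exact this
  have hxψ : x ∈ ψ.source := ⟨mem_chart_source _ x, hV.interior_eq.symm ▸ hxV⟩
  have hψV : ψ.source ⊆ V := fun q hq => interior_subset hq.2
  obtain ⟨Γ, hΓ⟩ := hVφ ψ hψ hψV
  set z₀ := ψ x with hz₀
  have hz₀t : z₀ ∈ ψ.target := ψ.map_source hxψ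
  have hfirst : ∀ l : Fin (n + 1), ∃ g : EuclideanSpace ℝ (Fin (k * (n + 1))) → Fin k → ℝ,
      AnalyticAt ℝ g z₀ ∧ ∀ᶠ z in 𝓝 z₀, ∀ v, fderiv ℝ g z v = 0 ↔
        curveEval k n ((l : ℕ) : ℝ) (Γ z v) = 0 := by
    intro l
    refine exists_first_integral
      (analyticAt_curveEval_comp (hΓ.analyticAt z₀ hz₀t) ((l : ℕ) : ℝ))
      (R := (Γ z₀).inverse.comp (curveSection k n ((l : ℕ) : ℝ))) ?_ ?_
    · intro c
      simp only [ContinuousLinearMap.comp_apply, (hΓ.isInvertible z₀ hz₀t).self_apply_inverse]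
      exact curveEval_curveSection _ c
    · filter_upwards [ψ.open_target.mem_nhds hz₀t] with z hz a b ha hb
      have hd := (hΓ.analyticAt z hz).differentiableAt
      rw [fderiv_curveEval_comp hd, fderiv_curveEval_comp hd]
      exact hΓ.fderiv_symm hψ hint hz _ ha hb
  choose g hgan hg using hfirst
  -- The first integrals of all nodes are gathered block by block as new coordinates. A vector
  -- killed by every block is killed by γ(0), …, γ(n), hence is zero by Vandermonde, so Θ is a local
  -- diffeomorphism.
  set Θ : EuclideanSpace ℝ (Fin (k * (n + 1))) → EuclideanSpace ℝ (Fin (k * (n + 1))) :=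
    fun z => blockEquiv k n (fun l => g l z) with hΘ
  have hgood : ∀ᶠ z in 𝓝 z₀, z ∈ ψ.target ∧ ∀ l, AnalyticAt ℝ (g l) z ∧
      ∀ v, fderiv ℝ (g l) z v = 0 ↔ curveEval k n ((l : ℕ) : ℝ) (Γ z v) = 0 :=
    Filter.Eventually.and (ψ.open_target.mem_nhds hz₀t)
      (Filter.eventually_all.2 fun l => (hgan l).eventually_analyticAt.and (hg l))
  obtain ⟨N, hNsub, hN, hz₀N⟩ := mem_nhds_iff.1 hgood
  have hΘan : ∀ z ∈ N, AnalyticAt ℝ Θ z := fun z hz =>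
    ((blockEquiv k n).toContinuousLinearMap.analyticAt _).fun_comp
      (analyticAt_pi_iff.2 fun l => ((hNsub hz).2 l).1)
  have hΘd : ∀ z ∈ N, ∀ v i l, fderiv ℝ Θ z v (finProdFinEquiv (i, l)) = fderiv ℝ (g l) z v i := by
    intro z hz v i l
    have h1 : HasFDerivAt (fun z l => g l z) (ContinuousLinearMap.pi fun l => fderiv ℝ (g l) z) z :=
      hasFDerivAt_pi.2 fun l => ((hNsub hz).2 l).1.differentiableAt.hasFDerivAt
    have h2 : fderiv ℝ Θ z = _ :=
      ((blockEquiv k n).toContinuousLinearMap.hasFDerivAt.comp z h1).fderiv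
    rw [h2]
    exact blockEquiv_apply _ i l
  have hΘker : ∀ z ∈ N, ∀ v l, (∀ i, fderiv ℝ Θ z v (finProdFinEquiv (i, l)) = 0) ↔
      curveEval k n ((l : ℕ) : ℝ) (Γ z v) = 0 := by
    intro z hz v l
    rw [← ((hNsub hz).2 l).2 v, funext_iff]
    simp only [hΘd z hz]
    rfl
  have hΘinj : ∀ z ∈ N, Function.Injective (fderiv ℝ Θ z) := by
    intro z hz
    rw [injective_iff_map_eq_zero]
    intro v hv
    have h0 : Γ z v = 0 := eq_zero_of_curveEval_eq_zero (s := fun l => ((l : ℕ) : ℝ))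
      (fun l l' h => by simpa [Fin.ext_iff] using h) (fun l => (hΘker z hz v l).1 fun i => by
        rw [hv]; rfl)
    exact (hΓ.isInvertible z (hNsub hz).1).injective (by rw [h0, map_zero])
  obtain ⟨e, hze, heN, heΘ, he1, he2⟩ := exists_openPartialHomeomorph hN hz₀N hΘan hΘinj
  set φ := ψ.trans e with hφdef
  have hφ : φ ∈ IsManifold.maximalAtlas (𝓡 (k * (n + 1))) ω M := trans_mem_maximalAtlas hψ he1 he2
  have hφs : ∀ q ∈ φ.source, q ∈ ψ.source ∧ ψ q ∈ e.source := fun q hq => by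
    simpa [hφdef] using hq
  refine ⟨φ, hφ, by simpa [hφdef] using ⟨hxψ, hze⟩, ?_⟩
  obtain ⟨Γ', hΓ'⟩ := hVφ φ hφ fun q hq => hψV (hφs q hq).1
  refine ⟨Γ', hΓ', fun y hy l v => ?_⟩
  obtain ⟨q, hq, rfl⟩ : ∃ q ∈ φ.source, φ q = y := ⟨φ.symm y, φ.map_target hy, φ.right_inv hy⟩
  obtain ⟨u, rfl⟩ := (vdiff_isInvertible_of_mem_maximalAtlas hφ hq).1.surjective v
  obtain ⟨hq1, hq2⟩ := hφs q hq
  have hd : vdiff (EuclideanSpace ℝ (Fin (k * (n + 1)))) φ q =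
      (fderiv ℝ Θ (ψ q)).comp (vdiff (EuclideanSpace ℝ (Fin (k * (n + 1)))) ψ q) := by
    have h1 : (φ : M → EuclideanSpace ℝ (Fin (k * (n + 1)))) = Θ ∘ ψ := by
      funext z
      exact heΘ (ψ z)
    rw [h1]
    exact vdiff_comp ((contMDiffAt_of_mem_maximalAtlas hψ hq1).mdifferentiableAt (by simp))
      (hΘan _ (heN hq2)).differentiableAt
  rw [← hΓ'.mem_iff q hq, hΓ.mem_iff q hq1, ← hΘker _ (heN hq2), hd]
  rfl

end RectifyingChart

/-! ### Transport of frames and of integrability. -/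

section Distributions

variable {E : Type*} [NormedAddCommGroup E] [NormedSpace ℝ E] {M : Type*} [TopologicalSpace M]
  [ChartedSpace E M]

theorem VeroneseWeb.IsDistributionOn.congr [IsManifold 𝓘(ℝ, E) ω M]
    {D D' : (q : M) → Submodule ℝ (TangentSpace 𝓘(ℝ, E) q)} {r : ℕ} {Ω : Set M} (hΩ : IsOpen Ω)
    (hD : VeroneseWeb.IsDistributionOn 𝓘(ℝ, E) D r Ω) (h : ∀ q ∈ Ω, D' q = D q) :
    VeroneseWeb.IsDistributionOn 𝓘(ℝ, E) D' r Ω := by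
  intro p hp
  obtain ⟨V, hV, hpV, X, hX, hD⟩ := hD p hp
  exact ⟨V ∩ Ω, hV.inter hΩ, ⟨hpV, hp⟩, X, fun i => ContMDiffOn.mono (hX i) inter_subset_left,
    fun q hq => ⟨(hD q hq.1).1, (h q hq.2).trans (hD q hq.1).2⟩⟩

theorem VeroneseWeb.IsIntegrableOn.congr [IsManifold 𝓘(ℝ, E) ω M]
    {D D' : (q : M) → Submodule ℝ (TangentSpace 𝓘(ℝ, E) q)} {Ω : Set M}
    (hD : VeroneseWeb.IsIntegrableOn 𝓘(ℝ, E) D Ω) (h : ∀ q ∈ Ω, D' q = D q) :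
    VeroneseWeb.IsIntegrableOn 𝓘(ℝ, E) D' Ω := by
  intro V hV hVΩ X Y hX hY hXD hYD q hq
  rw [h q (hVΩ hq)]
  exact hD V hV hVΩ X Y hX hY (fun z hz => h z (hVΩ hz) ▸ hXD z hz)
    (fun z hz => h z (hVΩ hz) ▸ hYD z hz) q hq

theorem isDistributionOn_of_comap [CompleteSpace E] [IsManifold 𝓘(ℝ, E) ω M] {f : M → E}
    {Ω : Set M} (hΩ : IsOpen Ω) (hf : ContMDiffOn 𝓘(ℝ, E) 𝓘(ℝ, E) ω f Ω)
    (hi : ∀ q ∈ Ω, (vdiff E f q).IsInvertible) {r : ℕ} {X : Fin r → E → E}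
    (hX : ∀ i, ∀ q ∈ Ω, AnalyticAt ℝ (X i) (f q))
    (hli : ∀ q ∈ Ω, LinearIndependent ℝ fun i => X i (f q))
    {D : (q : M) → Submodule ℝ (TangentSpace 𝓘(ℝ, E) q)}
    (hD : ∀ q ∈ Ω, D q =
      (Submodule.span ℝ (range fun i => X i (f q))).comap (vdiff E f q).toLinearMap) :
    VeroneseWeb.IsDistributionOn 𝓘(ℝ, E) D r Ω := by
  intro p hp
  refine ⟨Ω, hΩ, hp, fun i q => (vdiff E f q).inverse (X i (f q)),
    fun i => analyticVectorFieldOn_pullback hΩ hf hi (hX i), fun q hq => ?_⟩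
  obtain ⟨e, he⟩ := hi q hq
  set g : Fin r → E := fun i => e.symm (X i (f q)) with hg
  have hge : (fun i => (vdiff E f q).inverse (X i (f q))) = g := by
    rw [← he, ContinuousLinearMap.inverse_equiv]
    rfl
  have hgL : g = e.symm.toLinearEquiv.toLinearMap ∘ fun i => X i (f q) := rfl
  have h1 : LinearIndependent ℝ g :=
    (hli q hq).map' _ (LinearMap.ker_eq_bot.2 e.symm.injective)
  have h2 : D q = Submodule.span ℝ (range g) := by
    rw [hgL, range_comp, Submodule.span_image, hD q hq, ← he]
    exact Submodule.comap_equiv_eq_map_symm e.toLinearEquiv _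
  exact ⟨hge ▸ h1, hge ▸ h2⟩

end Distributions

/-! ### The distributions c(i - S) ker A on a complex manifold. -/

section SlantedDistributions

variable {m : ℕ}

/-- The real part of complex vectors. -/
noncomputable def reVec (m : ℕ) : EuclideanSpace ℂ (Fin m) →L[ℝ] EuclideanSpace ℝ (Fin m) :=
  LinearMap.toContinuousLinearMap
    { toFun := fun v => WithLp.toLp 2 fun j => (v j).re
      map_add' := fun u v => by ext j; simp
      map_smul' := fun c u => by ext j; simp }

/-- The imaginary part of complex vectors. -/
noncomputable def imVec (m : ℕ) : EuclideanSpace ℂ (Fin m) →L[ℝ] EuclideanSpace ℝ (Fin m) :=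
  LinearMap.toContinuousLinearMap
    { toFun := fun v => WithLp.toLp 2 fun j => (v j).im
      map_add' := fun u v => by ext j; simp
      map_smul' := fun c u => by ext j; simp }

/-- The inclusion of the real vectors. -/
noncomputable def ofRealVec (m : ℕ) : EuclideanSpace ℝ (Fin m) →L[ℝ] EuclideanSpace ℂ (Fin m) :=
  LinearMap.toContinuousLinearMap
    { toFun := fun v => WithLp.toLp 2 fun j => (v j : ℂ)
      map_add' := fun u v => by ext j; simp
      map_smul' := fun c u => by ext j; simp }

/-- The map `b ↦ c (i - S) b` from real to complex vectors. -/
noncomputable def slant (S : EuclideanSpace ℝ (Fin m) →L[ℝ] EuclideanSpace ℝ (Fin m)) (c : ℂ) :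
    EuclideanSpace ℝ (Fin m) →L[ℝ] EuclideanSpace ℂ (Fin m) :=
  c • (Complex.I • ofRealVec m - (ofRealVec m).comp S)

variable (S : EuclideanSpace ℝ (Fin m) →L[ℝ] EuclideanSpace ℝ (Fin m))

theorem slant_apply (c : ℂ) (b : EuclideanSpace ℝ (Fin m)) :
    slant S c b = c • (Complex.I • ofRealVec m b - ofRealVec m (S b)) := rfl

theorem slant_eq_smul (c : ℂ) (b : EuclideanSpace ℝ (Fin m)) : slant S c b = c • slant S 1 b := by
  rw [slant_apply, slant_apply, one_smul]

theorem imVec_slant_one (b : EuclideanSpace ℝ (Fin m)) : imVec m (slant S 1 b) = b := by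
  ext j
  rw [slant_apply, one_smul]
  change (Complex.I * (b j : ℂ) - (S b j : ℂ)).im = b j
  simp

/-- S b is real, so Im((i - S)b) = b. The coefficient is thus recovered by a fixed linear map and
inherits differentiability from the field. -/
theorem imVec_inv_smul_slant {c : ℂ} (hc : c ≠ 0) (b : EuclideanSpace ℝ (Fin m)) :
    imVec m (c⁻¹ • slant S c b) = b := by
  rw [slant_eq_smul, smul_smul, inv_mul_cancel₀ hc, one_smul, imVec_slant_one]

theorem slant_injective {c : ℂ} (hc : c ≠ 0) : Function.Injective (slant S c) := fun b b' h => by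
  rw [← imVec_inv_smul_slant S hc b, h, imVec_inv_smul_slant S hc]

/-- This computes the projection to U in coordinates; c = 1 - ti turns the slant into t - S. -/
theorem reVec_slant (c : ℂ) (b : EuclideanSpace ℝ (Fin m)) :
    reVec m (slant S c b) = -(c.im • b + c.re • S b) := by
  ext j
  change (c * (Complex.I * (b j : ℂ) - (S b j : ℂ))).re = -(c.im * b j + c.re * S b j)
  simp
  ring

variable {G : Type*} [NormedAddCommGroup G] [NormedSpace ℝ G]
  {Z : Type*} [TopologicalSpace Z] [ChartedSpace (EuclideanSpace ℂ (Fin m)) Z]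

/-- The distribution of the vectors `v` with `df v = c (i - S) b`, where `b` is in the kernel of
`A` at the real part of `f`. -/
noncomputable def slantField (A : EuclideanSpace ℝ (Fin m) → EuclideanSpace ℝ (Fin m) →L[ℝ] G)
    (f : Z → EuclideanSpace ℂ (Fin m)) (c : ℂ) (z : Z) :
    Submodule ℝ (EuclideanSpace ℂ (Fin m)) :=
  ((LinearMap.ker (A (reVec m (f z))).toLinearMap).map (slant S c).toLinearMap).comap
    (vdiff (EuclideanSpace ℂ (Fin m)) f z).toLinearMap

variable {S} {A : EuclideanSpace ℝ (Fin m) → EuclideanSpace ℝ (Fin m) →L[ℝ] G}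
  {f : Z → EuclideanSpace ℂ (Fin m)}

theorem mem_slantField {c : ℂ} {z : Z} {v : EuclideanSpace ℂ (Fin m)} :
    v ∈ slantField S A f c z ↔
      ∃ b, A (reVec m (f z)) b = 0 ∧ slant S c b = vdiff (EuclideanSpace ℂ (Fin m)) f z v := Iff.rfl

theorem vdiff_clm_comp {E E' E'' : Type*} [NormedAddCommGroup E] [NormedSpace ℝ E]
    [NormedAddCommGroup E'] [NormedSpace ℝ E'] [NormedAddCommGroup E''] [NormedSpace ℝ E'']
    {M : Type*} [TopologicalSpace M] [ChartedSpace E M]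
    (L : E' →L[ℝ] E'') {a : M → E'} {q : M} (ha : MDifferentiableAt 𝓘(ℝ, E) 𝓘(ℝ, E') a q) :
    MDifferentiableAt 𝓘(ℝ, E) 𝓘(ℝ, E'') (fun z => L (a z)) q ∧
      vdiff E (fun z => L (a z)) q = L.comp (vdiff E a q) := by
  refine ⟨L.differentiableAt.mdifferentiableAt.comp q ha, ?_⟩
  have := vdiff_comp ha (g := L) L.differentiableAt
  rw [L.fderiv] at this
  exact this

/-- The derivative of an identity `A (p z) (b z) = 0`. -/
theorem vdiff_annihilated {E E' : Type*} [NormedAddCommGroup E] [NormedSpace ℝ E]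
    [NormedAddCommGroup E'] [NormedSpace ℝ E'] {M : Type*} [TopologicalSpace M] [ChartedSpace E M]
    {A : E' → E' →L[ℝ] G} {p b : M → E'} {q : M} (hA : DifferentiableAt ℝ A (p q))
    (hp : MDifferentiableAt 𝓘(ℝ, E) 𝓘(ℝ, E') p q) (hb : MDifferentiableAt 𝓘(ℝ, E) 𝓘(ℝ, E') b q)
    (h : ∀ᶠ z in 𝓝 q, A (p z) (b z) = 0) (u : E) :
    A (p q) (vdiff E b q u) = -fderiv ℝ A (p q) (vdiff E p q u) (b q) := by
  have h1 : MDifferentiableAt 𝓘(ℝ, E) 𝓘(ℝ, E' × E') (fun z => (p z, b z)) q := hp.prodMk_space hb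
  have h4 : vdiff E (fun z => (p z, b z)) q = (vdiff E p q).prod (vdiff E b q) := by
    ext v
    · exact congrArg (fun L : E →L[ℝ] E' => L v)
        (vdiff_clm_comp (ContinuousLinearMap.fst ℝ E' E') h1).2.symm
    · exact congrArg (fun L : E →L[ℝ] E' => L v)
        (vdiff_clm_comp (ContinuousLinearMap.snd ℝ E' E') h1).2.symm
  have h2 : HasFDerivAt (fun y : E' × E' => A y.1 y.2)
      ((A (p q)).comp (ContinuousLinearMap.snd ℝ E' E') +
        ((fderiv ℝ A (p q)).comp (ContinuousLinearMap.fst ℝ E' E')).flip (b q)) (p q, b q) :=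
    HasFDerivAt.clm_apply (c := fun y : E' × E' => A y.1) (u := fun y : E' × E' => y.2)
      (hA.hasFDerivAt.comp (f := fun y : E' × E' => y.1) (p q, b q) hasFDerivAt_fst)
      hasFDerivAt_snd
  have h3 := vdiff_comp h1 (g := fun y : E' × E' => A y.1 y.2)
    h2.differentiableAt
  have h5 : vdiff E ((fun y : E' × E' => A y.1 y.2) ∘ fun z => (p z, b z)) q = 0 := by
    refine (vdiff_congr (g := fun _ => 0) ?_).trans mfderiv_const
    exact h
  rw [h5, h4, h2.fderiv] at h3
  have h6 := congrArg (fun L : E →L[ℝ] G => L u) h3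
  change 0 = A (p q) (vdiff E b q u) + fderiv ℝ A (p q) (vdiff E p q u) (b q) at h6
  rw [eq_neg_iff_add_eq_zero, ← h6]

/-- Operators which act on the values of `df` as multiplication by `c` map the distribution for
`1` to the distribution for `c`. -/
theorem map_slantField {z : Z} (hi : (vdiff (EuclideanSpace ℂ (Fin m)) f z).IsInvertible) {c : ℂ}
    {P : EuclideanSpace ℂ (Fin m) →L[ℝ] EuclideanSpace ℂ (Fin m)}
    (hP : ∀ v, vdiff (EuclideanSpace ℂ (Fin m)) f z (P v) =
      c • vdiff (EuclideanSpace ℂ (Fin m)) f z v) :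
    (slantField S A f 1 z).map P.toLinearMap = slantField S A f c z := by
  ext v
  constructor
  · rintro ⟨u, ⟨b, hb, h⟩, rfl⟩
    refine ⟨b, hb, ?_⟩
    refine Eq.trans ?_ (hP u).symm
    refine (slant_eq_smul S c b).trans ?_
    exact congrArg (c • ·) h
  · rintro ⟨b, hb, h⟩
    obtain ⟨u, hu⟩ := hi.surjective (slant S 1 b)
    refine ⟨u, ⟨b, hb, hu.symm⟩, hi.injective ?_⟩
    refine (hP u).trans ?_
    rw [hu, ← slant_eq_smul]
    exact h

variable [IsManifold 𝓘(ℂ, EuclideanSpace ℂ (Fin m)) ω Z]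

/-- Write df X = c(i - S)α and df Y = c(i - S)β. As c and S are constant, df[X, Y] = c(i - S)(Xβ -
Yα), and only A(Xβ - Yα) = 0 is needed. Differentiating A(Re f)α = 0 along Y and A(Re f)β = 0 along
X expresses this through dA in the directions Im(c)·b + Re(c)·Sb with b = α, β. The two symmetry
hypotheses treat these two terms. -/
theorem isIntegrableOn_slantField {T : Set (EuclideanSpace ℝ (Fin m))} {Ω : Set Z} {c : ℂ}
    (hc : c ≠ 0) (hA : ∀ y ∈ T, AnalyticAt ℝ A y)
    (hsymm : ∀ y ∈ T, ∀ b b', A y b = 0 → A y b' = 0 → fderiv ℝ A y b b' = fderiv ℝ A y b' b)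
    (hsymmS : ∀ y ∈ T, ∀ b b', A y b = 0 → A y b' = 0 →
      fderiv ℝ A y (S b) b' = fderiv ℝ A y (S b') b)
    (hf : ∀ z ∈ Ω, ContMDiffAt 𝓘(ℝ, EuclideanSpace ℂ (Fin m)) 𝓘(ℝ, EuclideanSpace ℂ (Fin m)) ω f z)
    (hT : ∀ z ∈ Ω, reVec m (f z) ∈ T) :
    VeroneseWeb.IsIntegrableOn 𝓘(ℝ, EuclideanSpace ℂ (Fin m)) (slantField S A f c) Ω := by
  intro V hV hVΩ (X : Z → EuclideanSpace ℂ (Fin m)) (Y : Z → EuclideanSpace ℂ (Fin m))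
    hX hY hXD hYD q hq
  change fieldBracket X Y q ∈ slantField S A f c q
  set df : Z → EuclideanSpace ℂ (Fin m) →L[ℝ] EuclideanSpace ℂ (Fin m) :=
    vdiff (EuclideanSpace ℂ (Fin m)) f with hdf
  obtain ⟨ha, hb, hbr⟩ := vdiff_fieldBracket (hf q (hVΩ hq))
    (VeroneseWeb.AnalyticVectorFieldOn.fieldDifferentiableAt hV hX hq)
    (VeroneseWeb.AnalyticVectorFieldOn.fieldDifferentiableAt hV hY hq)
    (a := fun z => df z (X z)) (b := fun z => df z (Y z))
    (Filter.Eventually.of_forall fun z => rfl) (Filter.Eventually.of_forall fun z => rfl)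
  set L : EuclideanSpace ℂ (Fin m) →L[ℝ] EuclideanSpace ℝ (Fin m) :=
    (imVec m).comp (c⁻¹ • ContinuousLinearMap.id ℝ (EuclideanSpace ℂ (Fin m))) with hL
  have hcoef : ∀ z v, v ∈ slantField S A f c z →
      A (reVec m (f z)) (L (df z v)) = 0 ∧ df z v = slant S c (L (df z v)) := by
    rintro z v ⟨b, hb, h⟩
    have h1 : L (df z v) = b := by
      change imVec m (c⁻¹ • df z v) = b
      rw [← imVec_inv_smul_slant S hc b]
      exact congrArg (fun u => imVec m (c⁻¹ • u)) h.symm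
    rw [h1]
    exact ⟨hb, h.symm⟩
  obtain ⟨hα, hαd⟩ := vdiff_clm_comp L ha
  obtain ⟨hβ, hβd⟩ := vdiff_clm_comp L hb
  obtain ⟨hp, hpd⟩ := vdiff_clm_comp (reVec m) ((hf q (hVΩ hq)).mdifferentiableAt (by simp))
  set α : Z → EuclideanSpace ℝ (Fin m) := fun z => L (df z (X z)) with hαdef
  set β : Z → EuclideanSpace ℝ (Fin m) := fun z => L (df z (Y z)) with hβdef
  have hVq := hV.mem_nhds hq
  have e1 : vdiff (EuclideanSpace ℂ (Fin m)) (fun z => df z (X z)) q =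
      (slant S c).comp (vdiff (EuclideanSpace ℂ (Fin m)) α q) := by
    rw [← (vdiff_clm_comp (slant S c) hα).2]
    refine vdiff_congr ?_
    filter_upwards [hVq] with z hz
    exact (hcoef z _ (hXD z hz)).2
  have e2 : vdiff (EuclideanSpace ℂ (Fin m)) (fun z => df z (Y z)) q =
      (slant S c).comp (vdiff (EuclideanSpace ℂ (Fin m)) β q) := by
    rw [← (vdiff_clm_comp (slant S c) hβ).2]
    refine vdiff_congr ?_
    filter_upwards [hVq] with z hz
    exact (hcoef z _ (hYD z hz)).2
  have hAq := hA _ (hT q (hVΩ hq))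
  have a1 := vdiff_annihilated (p := fun z => reVec m (f z)) hAq.differentiableAt hp hα (by
    filter_upwards [hVq] with z hz
    exact (hcoef z _ (hXD z hz)).1)
  have a2 := vdiff_annihilated (p := fun z => reVec m (f z)) hAq.differentiableAt hp hβ (by
    filter_upwards [hVq] with z hz
    exact (hcoef z _ (hYD z hz)).1)
  have hXq := hcoef q _ (hXD q hq)
  have hYq := hcoef q _ (hYD q hq)
  rw [mem_slantField]
  refine ⟨vdiff (EuclideanSpace ℂ (Fin m)) β q (X q) - vdiff (EuclideanSpace ℂ (Fin m)) α q (Y q),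
    ?_, ?_⟩
  · have r1 : vdiff (EuclideanSpace ℂ (Fin m)) (fun z => reVec m (f z)) q (X q) =
        -(c.im • α q + c.re • S (α q)) := by
      rw [hpd, ← reVec_slant]
      exact congrArg (reVec m) hXq.2
    have r2 : vdiff (EuclideanSpace ℂ (Fin m)) (fun z => reVec m (f z)) q (Y q) =
        -(c.im • β q + c.re • S (β q)) := by
      rw [hpd, ← reVec_slant]
      exact congrArg (reVec m) hYq.2
    have s1 := hsymm _ (hT q (hVΩ hq)) (α q) (β q) hXq.1 hYq.1
    have s2 := hsymmS _ (hT q (hVΩ hq)) (α q) (β q) hXq.1 hYq.1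
    rw [map_sub, a1, a2, r1, r2]
    simp only [map_neg, map_add, map_smul, _root_.neg_apply, _root_.add_apply, _root_.smul_apply,
      s1, s2]
    abel
  · refine Eq.trans ?_ hbr.symm
    rw [e1, e2, map_sub]
    rfl

theorem isDistributionOn_slantField {T : Set (EuclideanSpace ℝ (Fin m))} {Ω : Set Z} {c : ℂ}
    (hc : c ≠ 0) {r : ℕ} {b : Fin r → EuclideanSpace ℝ (Fin m) → EuclideanSpace ℝ (Fin m)}
    (hb : ∀ i, ∀ y ∈ T, AnalyticAt ℝ (b i) y)
    (hli : ∀ y ∈ T, LinearIndependent ℝ fun i => b i y)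
    (hspan : ∀ y ∈ T, LinearMap.ker (A y).toLinearMap = Submodule.span ℝ (range fun i => b i y))
    (hΩ : IsOpen Ω)
    (hf : ContMDiffOn 𝓘(ℝ, EuclideanSpace ℂ (Fin m)) 𝓘(ℝ, EuclideanSpace ℂ (Fin m)) ω f Ω)
    (hi : ∀ z ∈ Ω, (vdiff (EuclideanSpace ℂ (Fin m)) f z).IsInvertible)
    (hT : ∀ z ∈ Ω, reVec m (f z) ∈ T) :
    VeroneseWeb.IsDistributionOn 𝓘(ℝ, EuclideanSpace ℂ (Fin m)) (slantField S A f c) r Ω := by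
  refine isDistributionOn_of_comap (X := fun i y => slant S c (b i (reVec m y))) hΩ hf hi
    (fun i q hq => ((slant S c).analyticAt _).fun_comp
      ((hb i _ (hT q hq)).fun_comp ((reVec m).analyticAt _)))
    (fun q hq => (hli _ (hT q hq)).map' (slant S c).toLinearMap
      (LinearMap.ker_eq_bot.2 (slant_injective S hc))) (fun q hq => ?_)
  have h : (range fun i => slant S c (b i (reVec m (f q)))) =
      (slant S c).toLinearMap '' (range fun i => b i (reVec m (f q))) :=
    range_comp (slant S c).toLinearMap fun i => b i (reVec m (f q))
  rw [h, Submodule.span_image, ← hspan _ (hT q hq)]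
  rfl

end SlantedDistributions

/-! ### The operator S and an analytic frame of w(∞). -/

section VeroneseWebs

variable {k n : ℕ}

/-- The operator multiplying the coordinates of the `l`-th block by `l`. -/
noncomputable def blockScale (k n : ℕ) :
    EuclideanSpace ℝ (Fin (k * (n + 1))) →L[ℝ] EuclideanSpace ℝ (Fin (k * (n + 1))) :=
  LinearMap.toContinuousLinearMap
    { toFun := fun v => WithLp.toLp 2 fun a => (((finProdFinEquiv.symm a).2 : ℕ) : ℝ) * v a
      map_add' := fun u v => by
        ext a
        exact mul_add _ (u a) (v a)
      map_smul' := fun c u => by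
        ext a
        exact mul_left_comm _ c (u a) }

theorem blockScale_apply (v : EuclideanSpace ℝ (Fin (k * (n + 1)))) (i : Fin k) (l : Fin (n + 1)) :
    blockScale k n v (finProdFinEquiv (i, l)) = ((l : ℕ) : ℝ) * v (finProdFinEquiv (i, l)) := by
  change (((finProdFinEquiv.symm (finProdFinEquiv (i, l))).2 : ℕ) : ℝ) * _ = _
  rw [Equiv.symm_apply_apply]

/-- The kernel vectors at `t = ∞` with one coordinate `1`. -/
def kernelVector (k n : ℕ) (a : Fin (k * n)) : Fin (n + 1) → Fin k → ℝ :=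
  Pi.single (finProdFinEquiv.symm a).2.castSucc (Pi.single (finProdFinEquiv.symm a).1 1)

theorem sum_smul_kernelVector (c : Fin (k * n) → ℝ) (i : Fin k) (j : Fin n) :
    (∑ a, c a • kernelVector k n a) j.castSucc i = c (finProdFinEquiv (i, j)) := by
  rw [Finset.sum_apply, Finset.sum_apply, Finset.sum_eq_single (finProdFinEquiv (i, j))]
  · simp [kernelVector]
  · intro a _ ha
    obtain ⟨⟨i', j'⟩, rfl⟩ := finProdFinEquiv.surjective a
    have h : ¬(i' = i ∧ j' = j) := fun h => ha (by rw [h.1, h.2])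
    simp only [kernelVector, Equiv.symm_apply_apply, Pi.smul_apply, smul_eq_mul, mul_eq_zero]
    right
    by_cases hj : j' = j
    · rw [hj, Pi.single_eq_same, Pi.single_eq_of_ne fun hi => h ⟨hi.symm, hj⟩]
    · rw [Pi.single_eq_of_ne fun hj' => hj (Fin.castSucc_injective n hj').symm]
      rfl
  · simp

theorem linearIndependent_kernelVector : LinearIndependent ℝ (kernelVector k n) := by
  rw [Fintype.linearIndependent_iff]
  intro c hc a
  obtain ⟨⟨i, j⟩, rfl⟩ := finProdFinEquiv.surjective a
  rw [← sum_smul_kernelVector c, hc]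
  rfl

theorem ker_curveEval_infty :
    LinearMap.ker (curveEval k n OnePoint.infty).toLinearMap =
      Submodule.span ℝ (range (kernelVector k n)) := by
  apply le_antisymm
  · intro u hu
    have hu' : u (Fin.last n) = 0 := hu
    have : u = ∑ a : Fin (k * n), u (finProdFinEquiv.symm a).2.castSucc (finProdFinEquiv.symm a).1 •
        kernelVector k n a := by
      ext j i
      induction j using Fin.lastCases with
      | last =>
        rw [hu', Finset.sum_apply, Finset.sum_apply]
        refine (Finset.sum_eq_zero fun a _ => ?_).symm
        simp only [kernelVector, Pi.smul_apply, smul_eq_mul, mul_eq_zero]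
        right
        rw [Pi.single_eq_of_ne (Fin.castSucc_lt_last _).ne']
        rfl
      | cast j => rw [sum_smul_kernelVector (c := fun a =>
          u (finProdFinEquiv.symm a).2.castSucc (finProdFinEquiv.symm a).1), Equiv.symm_apply_apply]
    rw [this]
    exact Submodule.sum_mem _ fun a _ => Submodule.smul_mem _ _ (Submodule.subset_span ⟨a, rfl⟩)
  · rw [Submodule.span_le]
    rintro _ ⟨a, rfl⟩
    change kernelVector k n a (Fin.last n) = 0
    exact Pi.single_eq_of_ne (Fin.castSucc_lt_last _).ne' _

section

variable {E : Type*} [NormedAddCommGroup E] [NormedSpace ℝ E]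
  {Γ : E → E →L[ℝ] (Fin (n + 1) → Fin k → ℝ)} {y : E}

theorem analyticAt_inverse_apply [CompleteSpace E] (h : AnalyticAt ℝ Γ y)
    (hi : (Γ y).IsInvertible) (u : Fin (n + 1) → Fin k → ℝ) :
    AnalyticAt ℝ (fun y => (Γ y).inverse u) y := by
  obtain ⟨e, he⟩ := hi
  have h1 : AnalyticAt ℝ ContinuousLinearMap.inverse (Γ y) := by
    rw [← he]
    exact (contDiffAt_map_inverse (n := ω) e).analyticAt
  exact ((ContinuousLinearMap.apply ℝ E u).analyticAt _).fun_comp (h1.fun_comp h)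

theorem linearIndependent_inverse_kernelVector (hi : (Γ y).IsInvertible) :
    LinearIndependent ℝ fun a => (Γ y).inverse (kernelVector k n a) := by
  obtain ⟨e, he⟩ := hi
  rw [← he, ContinuousLinearMap.inverse_equiv]
  exact linearIndependent_kernelVector.map' e.symm.toLinearEquiv.toLinearMap
    (LinearMap.ker_eq_bot.2 e.symm.injective)

theorem ker_curveEval_infty_comp (hi : (Γ y).IsInvertible) :
    LinearMap.ker ((curveEval k n OnePoint.infty).comp (Γ y)).toLinearMap =
      Submodule.span ℝ (range fun a => (Γ y).inverse (kernelVector k n a)) := by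
  obtain ⟨e, he⟩ := hi
  rw [← he, ContinuousLinearMap.inverse_equiv]
  have h : (range fun a => (e.symm : _ →L[ℝ] E) (kernelVector k n a)) =
      e.symm.toLinearEquiv.toLinearMap '' range (kernelVector k n) :=
    range_comp e.symm.toLinearEquiv.toLinearMap (kernelVector k n)
  rw [h, Submodule.span_image, ← ker_curveEval_infty]
  exact Submodule.comap_equiv_eq_map_symm e.toLinearEquiv
    (LinearMap.ker (curveEval k n OnePoint.infty).toLinearMap)

end

end VeroneseWebs

/-! ### Holomorphic extensions and multiplication by 1 ± ti. -/

section HolomorphicMaps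

variable {m : ℕ} {Z : Type*} [TopologicalSpace Z] [ChartedSpace (EuclideanSpace ℂ (Fin m)) Z]
  {f : Z → EuclideanSpace ℂ (Fin m)} {z : Z}

theorem ContMDiffAt.real_of_complex
    (hf : ContMDiffAt 𝓘(ℂ, EuclideanSpace ℂ (Fin m)) 𝓘(ℂ, EuclideanSpace ℂ (Fin m)) ω f z) :
    ContMDiffAt 𝓘(ℝ, EuclideanSpace ℂ (Fin m)) 𝓘(ℝ, EuclideanSpace ℂ (Fin m)) ω f z := by
  obtain ⟨h1, h2⟩ := contMDiffAt_iff.1 hf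
  exact contMDiffAt_iff.2 ⟨h1, h2.restrict_scalars ℝ⟩

/-- The real differential of a holomorphic map is the complex one. -/
theorem exists_vdiff_eq_restrictScalars
    (hf : ContMDiffAt 𝓘(ℂ, EuclideanSpace ℂ (Fin m)) 𝓘(ℂ, EuclideanSpace ℂ (Fin m)) ω f z) :
    ∃ L : EuclideanSpace ℂ (Fin m) →L[ℂ] EuclideanSpace ℂ (Fin m),
      vdiff (EuclideanSpace ℂ (Fin m)) f z = L.restrictScalars ℝ := by
  have h := (hf.mdifferentiableAt (by simp)).hasMFDerivAt
  let L : EuclideanSpace ℂ (Fin m) →L[ℂ] EuclideanSpace ℂ (Fin m) :=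
    mfderiv 𝓘(ℂ, EuclideanSpace ℂ (Fin m)) 𝓘(ℂ, EuclideanSpace ℂ (Fin m)) f z
  let L' : EuclideanSpace ℂ (Fin m) →L[ℝ] EuclideanSpace ℂ (Fin m) := L.restrictScalars ℝ
  have h2 : HasMFDerivAt 𝓘(ℝ, EuclideanSpace ℂ (Fin m)) 𝓘(ℝ, EuclideanSpace ℂ (Fin m)) f z L' :=
    ⟨h.1, HasFDerivWithinAt.restrictScalars ℝ h.2⟩
  exact ⟨L, h2.mfderiv⟩

/-- A complex-linear map whose image contains the real vectors also reaches i times them, so it is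
surjective, hence bijective by dimension. -/
theorem isInvertible_of_range_ofRealVec
    {L : EuclideanSpace ℂ (Fin m) →L[ℂ] EuclideanSpace ℂ (Fin m)}
    (h : ∀ u, ∃ v, L v = ofRealVec m u) : (L.restrictScalars ℝ).IsInvertible := by
  have hs : Function.Surjective L := by
    intro u
    obtain ⟨a, ha⟩ := h (reVec m u)
    obtain ⟨b, hb⟩ := h (imVec m u)
    refine ⟨a + Complex.I • b, ?_⟩
    rw [map_add, map_smul, ha, hb]
    ext j
    change ((u j).re : ℂ) + Complex.I * ((u j).im : ℂ) = u j
    rw [mul_comm]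
    exact Complex.re_add_im _
  exact isInvertible_of_injective rfl (LinearMap.injective_iff_surjective.2 hs)

/-- The differential of a holomorphic extension of a chart is invertible along the complexified
domain. -/
theorem isInvertible_vdiff_of_extension {M : Type*} [TopologicalSpace M]
    [ChartedSpace (EuclideanSpace ℝ (Fin m)) M]
    {φ : M → EuclideanSpace ℝ (Fin m)} {ι : M → Z} {q : M}
    (hf : ContMDiffAt 𝓘(ℂ, EuclideanSpace ℂ (Fin m)) 𝓘(ℂ, EuclideanSpace ℂ (Fin m)) ω f (ι q))
    (hι : MDifferentiableAt (𝓡 m) 𝓘(ℝ, EuclideanSpace ℂ (Fin m)) ι q)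
    (hφ : MDifferentiableAt (𝓡 m) (𝓡 m) φ q)
    (hφi : (vdiff (EuclideanSpace ℝ (Fin m)) φ q).IsInvertible)
    (h : ∀ᶠ p in 𝓝 q, f (ι p) = ofRealVec m (φ p)) :
    (vdiff (EuclideanSpace ℂ (Fin m)) f (ι q)).IsInvertible := by
  obtain ⟨L, hL⟩ := exists_vdiff_eq_restrictScalars hf
  have h1 := vdiff_comp_map (hf.real_of_complex.mdifferentiableAt (by simp)) hι
  have h2 := (vdiff_clm_comp (ofRealVec m) hφ).2
  have h3 : vdiff (EuclideanSpace ℝ (Fin m)) (f ∘ ι) q =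
      vdiff (EuclideanSpace ℝ (Fin m)) (fun p => ofRealVec m (φ p)) q := vdiff_congr h
  rw [h1, h2] at h3
  rw [hL] at h3 ⊢
  refine isInvertible_of_range_ofRealVec fun u => ?_
  obtain ⟨v, rfl⟩ := hφi.surjective u
  exact ⟨_, congrArg (fun T : EuclideanSpace ℝ (Fin m) →L[ℝ] EuclideanSpace ℂ (Fin m) => T v) h3⟩

/-- The complex number acting as `Id + t J`. -/
noncomputable def addParam (t : OnePoint ℝ) : ℂ := t.elim Complex.I fun s => 1 + s * Complex.I

/-- The complex number acting as `Id - t J`. -/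
noncomputable def subParam (t : OnePoint ℝ) : ℂ := t.elim (-Complex.I) fun s => 1 - s * Complex.I

/-- The parameter `-t`. -/
def negParam (t : OnePoint ℝ) : OnePoint ℝ := t.elim OnePoint.infty fun s => ((-s : ℝ) : OnePoint ℝ)

theorem addParam_ne_zero (t : OnePoint ℝ) : addParam t ≠ 0 := by
  induction t using OnePoint.rec with
  | infty => exact Complex.I_ne_zero
  | coe s =>
    change (1 + s * Complex.I : ℂ) ≠ 0
    intro h
    simpa using congrArg Complex.re h

/-- Re((1 + si)(i - S)b) = (-s - S)b, while Re(i(i - S)b) = -b. The factor ε absorbs the latter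
sign, and the plus sign in Id + tJ sends t to -t downstairs. -/
theorem reVec_slant_addParam
    (S : EuclideanSpace ℝ (Fin m) →L[ℝ] EuclideanSpace ℝ (Fin m)) (t : OnePoint ℝ) :
    ∃ ε : ℝ, ε ≠ 0 ∧ ∀ b, reVec m (slant S (addParam t) b) = ε • pencil S (negParam t) b := by
  induction t using OnePoint.rec with
  | infty =>
    refine ⟨-1, by norm_num, fun b => ?_⟩
    rw [reVec_slant]
    change -(Complex.I.im • b + Complex.I.re • S b) = (-1 : ℝ) • b
    simp
  | coe s =>
    refine ⟨1, one_ne_zero, fun b => ?_⟩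
    rw [reVec_slant]
    change -((1 + s * Complex.I : ℂ).im • b + (1 + s * Complex.I : ℂ).re • S b) =
      (1 : ℝ) • ((-s) • b - S b)
    simp
    abel

theorem reVec_slant_subParam
    (S : EuclideanSpace ℝ (Fin m) →L[ℝ] EuclideanSpace ℝ (Fin m)) (t : OnePoint ℝ) :
    ∃ ε : ℝ, ε ≠ 0 ∧ ∀ b, reVec m (slant S (subParam t) b) = ε • pencil S t b := by
  refine ⟨1, one_ne_zero, fun b => ?_⟩
  rw [reVec_slant]
  induction t using OnePoint.rec with
  | infty =>
    change -((-Complex.I).im • b + (-Complex.I).re • S b) = (1 : ℝ) • b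
    simp
  | coe s =>
    change -((1 - s * Complex.I : ℂ).im • b + (1 - s * Complex.I : ℂ).re • S b) =
      (1 : ℝ) • (s • b - S b)
    simp
    abel

theorem vdiff_idAddJ
    (hf : ContMDiffAt 𝓘(ℂ, EuclideanSpace ℂ (Fin m)) 𝓘(ℂ, EuclideanSpace ℂ (Fin m)) ω f z)
    (t : OnePoint ℝ) (v : EuclideanSpace ℂ (Fin m)) :
    vdiff (EuclideanSpace ℂ (Fin m)) f z (VeroneseWeb.idAddJ t z v) =
      addParam t • vdiff (EuclideanSpace ℂ (Fin m)) f z v := by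
  obtain ⟨L, hL⟩ := exists_vdiff_eq_restrictScalars hf
  rw [hL]
  induction t using OnePoint.rec with
  | infty => exact L.map_smul Complex.I v
  | coe s =>
    change L (v + s • (Complex.I • v)) = (1 + s * Complex.I : ℂ) • L v
    have h : v + s • (Complex.I • v) = (1 + s * Complex.I : ℂ) • v := by
      rw [add_smul, one_smul, mul_smul]
      rfl
    rw [h, map_smul]

theorem vdiff_idSubJ
    (hf : ContMDiffAt 𝓘(ℂ, EuclideanSpace ℂ (Fin m)) 𝓘(ℂ, EuclideanSpace ℂ (Fin m)) ω f z)
    (t : OnePoint ℝ) (v : EuclideanSpace ℂ (Fin m)) :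
    vdiff (EuclideanSpace ℂ (Fin m)) f z (VeroneseWeb.idSubJ t z v) =
      subParam t • vdiff (EuclideanSpace ℂ (Fin m)) f z v := by
  obtain ⟨L, hL⟩ := exists_vdiff_eq_restrictScalars hf
  rw [hL]
  induction t using OnePoint.rec with
  | infty =>
    change L (-(Complex.I • v)) = (-Complex.I) • L v
    rw [map_neg, map_smul, neg_smul]
  | coe s =>
    change L (v - s • (Complex.I • v)) = (1 - s * Complex.I : ℂ) • L v
    have h : v - s • (Complex.I • v) = (1 - s * Complex.I : ℂ) • v := by
      rw [sub_smul, one_smul, mul_smul]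
      rfl
    rw [h, map_smul]

end HolomorphicMaps

/-! ### Projection onto the web and the second symmetry condition. -/

section RectifiedCoframes

variable {k n : ℕ}
  {Γ : EuclideanSpace ℝ (Fin (k * (n + 1))) →
    EuclideanSpace ℝ (Fin (k * (n + 1))) →L[ℝ] (Fin (n + 1) → Fin k → ℝ)}

theorem curveEval_sub_blockScale {y : EuclideanSpace ℝ (Fin (k * (n + 1)))}
    (hrect : ∀ (l : Fin (n + 1)) v,
      curveEval k n ((l : ℕ) : ℝ) (Γ y v) = 0 ↔ ∀ i : Fin k, v (finProdFinEquiv (i, l)) = 0)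
    (l : Fin (n + 1)) (b : EuclideanSpace ℝ (Fin (k * (n + 1)))) :
    curveEval k n ((l : ℕ) : ℝ) (Γ y (((l : ℕ) : ℝ) • b - blockScale k n b)) = 0 := by
  rw [hrect]
  intro i
  change ((l : ℕ) : ℝ) * b (finProdFinEquiv (i, l)) - blockScale k n b (finProdFinEquiv (i, l)) = 0
  rw [blockScale_apply, sub_self]

variable {M : Type*} [TopologicalSpace M]
  [ChartedSpace (EuclideanSpace ℝ (Fin (k * (n + 1)))) M]
  {w : OnePoint ℝ → (x : M) → Submodule ℝ (TangentSpace (𝓡 (k * (n + 1))) x)}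
  {φ : OpenPartialHomeomorph M (EuclideanSpace ℝ (Fin (k * (n + 1))))}
  {S : EuclideanSpace ℝ (Fin (k * (n + 1))) →L[ℝ] EuclideanSpace ℝ (Fin (k * (n + 1)))}

variable {Z : Type*} [TopologicalSpace Z]
  [ChartedSpace (EuclideanSpace ℂ (Fin (k * (n + 1)))) Z]
  {f : Z → EuclideanSpace ℂ (Fin (k * (n + 1)))} {Ω : Set Z}

/-- In coordinates the differential of the projection is Re ∘ dφᶜ, so c(i - S)w(∞) goes to ε(t -
S)w(∞) = w(t). The kernel is taken at Re φᶜ, the coordinates of the projected point, so the image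
depends only on that point. -/
theorem IsCoframeInChart.projectsOnto (h : IsCoframeInChart w φ Γ)
    (hφ : φ ∈ IsManifold.maximalAtlas (𝓡 (k * (n + 1))) ω M)
    (hS : ∀ y ∈ φ.target, ∀ (l : Fin (n + 1)) b,
      curveEval k n ((l : ℕ) : ℝ) (Γ y (((l : ℕ) : ℝ) • b - S b)) = 0)
    (hf : ∀ z ∈ Ω, MDifferentiableAt 𝓘(ℝ, EuclideanSpace ℂ (Fin (k * (n + 1))))
      𝓘(ℝ, EuclideanSpace ℂ (Fin (k * (n + 1)))) f z)
    (hi : ∀ z ∈ Ω, (vdiff (EuclideanSpace ℂ (Fin (k * (n + 1)))) f z).IsInvertible)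
    (hT : ∀ z ∈ Ω, reVec _ (f z) ∈ φ.target) {c : ℂ} {t : OnePoint ℝ}
    (hc : ∃ ε : ℝ, ε ≠ 0 ∧ ∀ b, reVec _ (slant S c b) = ε • pencil S t b)
    {D : (z : Z) → Submodule ℝ (TangentSpace 𝓘(ℝ, EuclideanSpace ℂ (Fin (k * (n + 1)))) z)}
    (hD : ∀ z ∈ Ω, D z =
      slantField S (fun y => (curveEval k n OnePoint.infty).comp (Γ y)) f c z) :
    VeroneseWeb.ProjectsOnto (VeroneseWeb.leafProjection φ f) Ω D (w t) := by
  obtain ⟨ε, hε, hc⟩ := hc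
  intro z hz
  rw [hD z hz]
  set q := VeroneseWeb.leafProjection φ f z with hq
  have hqs : q ∈ φ.source := φ.map_target (hT z hz)
  have hφq : φ q = reVec _ (f z) := φ.right_inv (hT z hz)
  obtain ⟨hφi, hφd⟩ := vdiff_isInvertible_of_mem_maximalAtlas hφ hqs
  have hΓi := h.isInvertible _ (φ.map_source hqs)
  set dp : EuclideanSpace ℂ (Fin (k * (n + 1))) →L[ℝ] EuclideanSpace ℝ (Fin (k * (n + 1))) :=
    mfderiv 𝓘(ℝ, EuclideanSpace ℂ (Fin (k * (n + 1)))) (𝓡 (k * (n + 1)))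
      (VeroneseWeb.leafProjection φ f) z with hdp
  have hdpv : ∀ v, vdiff (EuclideanSpace ℝ (Fin (k * (n + 1)))) φ q (dp v) =
      reVec _ (vdiff (EuclideanSpace ℂ (Fin (k * (n + 1)))) f z v) := by
    intro v
    obtain ⟨h1, h2⟩ := vdiff_clm_comp (reVec (k * (n + 1))) (hf z hz)
    rw [hφq] at hφd
    have h3 : dp = (vdiff (EuclideanSpace ℝ (Fin (k * (n + 1)))) φ q).inverse.comp
        (vdiff (EuclideanSpace ℂ (Fin (k * (n + 1)))) (fun z => reVec _ (f z)) z) :=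
      (HasMFDerivAt.comp (g := φ.symm) (f := fun z => reVec _ (f z)) z hφd h1.hasMFDerivAt).mfderiv
    rw [h3, h2]
    exact hφi.self_apply_inverse _
  ext u
  refine Iff.trans ?_ (h.mem_iff q hqs t u).symm
  constructor
  · rintro ⟨v, ⟨b, hb, hbv⟩, rfl⟩
    have h1 : vdiff (EuclideanSpace ℝ (Fin (k * (n + 1)))) φ q (dp v) = ε • pencil S t b :=
      (hdpv v).trans ((congrArg (reVec _) hbv.symm).trans (hc b))
    have h2 : curveEval k n t (Γ (φ q) (ε • pencil S t b)) = 0 := by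
      rw [map_smul, map_smul, curveEval_pencil_eq_zero (hS _ (φ.map_source hqs)) t, smul_zero]
      rw [hφq]
      exact hb
    exact (congrArg (fun u => curveEval k n t (Γ (φ q) u)) h1).trans h2
  · intro hu
    obtain ⟨b, hb, hbu⟩ := exists_pencil_eq_of_curveEval_eq_zero ⟨hΓi.injective, hΓi.surjective⟩
      (hS _ (φ.map_source hqs)) t hu
    obtain ⟨v, hv⟩ := (hi z hz).surjective (slant S c (ε⁻¹ • b))
    refine ⟨v, ⟨ε⁻¹ • b, ?_, hv.symm⟩, hφi.injective ?_⟩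
    · change curveEval k n OnePoint.infty (Γ (reVec _ (f z)) (ε⁻¹ • b)) = 0
      rw [← hφq, map_smul, map_smul, hb, smul_zero]
    · refine (hdpv v).trans ?_
      rw [hv, hc, map_smul, smul_inv_smul₀ hε]
      exact hbu

variable [IsManifold (𝓡 (k * (n + 1))) ω M]

/-- Integrability at a parameter `t = -1` different from the nodes, expressed in the frame of
the distribution at infinity. -/
theorem IsCoframeInChart.fderiv_symm_operator (h : IsCoframeInChart w φ Γ)
    (hφ : φ ∈ IsManifold.maximalAtlas (𝓡 (k * (n + 1))) ω M)
    (hint : ∀ t, VeroneseWeb.IsIntegrableOn (𝓡 (k * (n + 1))) (w t) univ)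
    (hS : ∀ y ∈ φ.target, ∀ (l : Fin (n + 1)) b,
      curveEval k n ((l : ℕ) : ℝ) (Γ y (((l : ℕ) : ℝ) • b - S b)) = 0)
    {y : EuclideanSpace ℝ (Fin (k * (n + 1)))} (hy : y ∈ φ.target)
    {b b' : EuclideanSpace ℝ (Fin (k * (n + 1)))}
    (hb : curveEval k n OnePoint.infty (Γ y b) = 0)
    (hb' : curveEval k n OnePoint.infty (Γ y b') = 0) :
    curveEval k n OnePoint.infty (fderiv ℝ Γ y (S b) b') =
      curveEval k n OnePoint.infty (fderiv ℝ Γ y (S b') b) := by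
  have hd := (h.analyticAt y hy).differentiableAt
  set C : ℝ := ∏ l : Fin (n + 1), ((-1 : ℝ) - (l : ℕ)) with hC
  have hC0 : C ≠ 0 := Finset.prod_ne_zero_iff.2 fun l _ => by
    have : (0 : ℝ) ≤ (l : ℕ) := Nat.cast_nonneg _
    linarith
  -- The identity γ(-1)((-1 - S)u) = C γ_n(u) holds at every base point with u and S constant, so it
  -- may be differentiated in the base point.
  have key : ∀ v u, curveEval k n ((-1 : ℝ) : OnePoint ℝ) (fderiv ℝ Γ y v ((-1 : ℝ) • u - S u)) =
      C • curveEval k n OnePoint.infty (fderiv ℝ Γ y v u) := by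
    intro v u
    have h1 : ∀ t u, HasFDerivAt (fun z => (curveEval k n t) (Γ z u))
        ((curveEval k n t).comp ((fderiv ℝ Γ y).flip u)) y := fun t u =>
      (curveEval k n t).hasFDerivAt.comp y
        (((ContinuousLinearMap.apply ℝ (Fin (n + 1) → Fin k → ℝ) u).hasFDerivAt).comp y
          hd.hasFDerivAt)
    have h2 := (h1 ((-1 : ℝ) : OnePoint ℝ) ((-1 : ℝ) • u - S u)).congr_of_eventuallyEq
      (f₁ := fun z => C • curveEval k n OnePoint.infty (Γ z u)) (by
        filter_upwards [φ.open_target.mem_nhds hy] with z hz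
        exact (curveEval_pencil (hS z hz) (-1) u).symm)
    have h3 := h2.unique ((h1 OnePoint.infty u).const_smul C)
    exact congrArg (fun L : EuclideanSpace ℝ (Fin (k * (n + 1))) →L[ℝ] (Fin k → ℝ) => L v) h3
  -- Apply integrability of w(-1) to (-1 - S)b and (-1 - S)b', which lie in w(-1). Cancelling C
  -- makes γ_n(dΓ((-1 - S)b)b') symmetric in b and b'; the part without S is symmetric by
  -- integrability of w(∞), leaving the part with S.
  have h1 := h.fderiv_symm hφ hint hy ((-1 : ℝ) : OnePoint ℝ)
    (curveEval_pencil_eq_zero (hS y hy) ((-1 : ℝ) : OnePoint ℝ) hb)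
    (curveEval_pencil_eq_zero (hS y hy) ((-1 : ℝ) : OnePoint ℝ) hb')
  rw [pencil_coe_apply, pencil_coe_apply, key, key] at h1
  have h2 := smul_right_injective _ hC0 h1
  have h3 := h.fderiv_symm hφ hint hy OnePoint.infty hb hb'
  simp only [map_sub, map_smul, _root_.sub_apply, _root_.smul_apply, h3] at h2
  exact sub_right_injective h2

/-- The frame of w(∞) is carried by t - S to an analytic frame of w(t), by injectivity of the pencil
on w(∞). -/
theorem IsCoframeInChart.isDistributionOn (h : IsCoframeInChart w φ Γ)
    (hφ : φ ∈ IsManifold.maximalAtlas (𝓡 (k * (n + 1))) ω M)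
    (hS : ∀ y ∈ φ.target, ∀ (l : Fin (n + 1)) b,
      curveEval k n ((l : ℕ) : ℝ) (Γ y (((l : ℕ) : ℝ) • b - S b)) = 0) (t : OnePoint ℝ) :
    VeroneseWeb.IsDistributionOn (𝓡 (k * (n + 1))) (w t) (k * n) φ.source := by
  refine isDistributionOn_of_comap
    (X := fun a y => pencil S t ((Γ y).inverse (kernelVector k n a)))
    φ.open_source (contMDiffOn_of_mem_maximalAtlas hφ)
    (fun q hq => (vdiff_isInvertible_of_mem_maximalAtlas hφ hq).1) (fun a q hq => ?_)
    (fun q hq => ?_) (fun q hq => ?_)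
  · exact ((pencil S t).analyticAt _).fun_comp (analyticAt_inverse_apply
      (h.analyticAt _ (φ.map_source hq)) (h.isInvertible _ (φ.map_source hq)) _)
  · have hi := h.isInvertible _ (φ.map_source hq)
    refine (linearIndependent_inverse_kernelVector hi).map_injOn (pencil S t).toLinearMap ?_
    rw [← ker_curveEval_infty_comp hi]
    intro b hb b' hb' hbb
    rw [← sub_eq_zero]
    refine eq_zero_of_pencil_eq_zero (S := S) (t := t) hi.injective (hS _ (φ.map_source hq))
      (Submodule.sub_mem _ hb hb') ?_
    rw [map_sub, sub_eq_zero]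
    exact hbb
  · have hi := h.isInvertible _ (φ.map_source hq)
    have hr : (range fun a => pencil S t ((Γ (φ q)).inverse (kernelVector k n a))) =
        (pencil S t).toLinearMap '' (range fun a => (Γ (φ q)).inverse (kernelVector k n a)) :=
      range_comp (pencil S t).toLinearMap fun a => (Γ (φ q)).inverse (kernelVector k n a)
    rw [hr, Submodule.span_image, ← ker_curveEval_infty_comp hi]
    ext v
    refine (h.mem_iff q hq t v).trans ⟨fun hv => ?_, ?_⟩
    · obtain ⟨b, hb, hbv⟩ := exists_pencil_eq_of_curveEval_eq_zero ⟨hi.injective, hi.surjective⟩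
        (hS _ (φ.map_source hq)) t hv
      exact ⟨b, hb, hbv⟩
    · rintro ⟨b, hb, hbv⟩
      have := curveEval_pencil_eq_zero (hS _ (φ.map_source hq)) t hb
      exact (congrArg (fun u => curveEval k n t (Γ (φ q) u)) hbv).symm.trans this

end RectifiedCoframes

/-! ### The main theorem. -/

theorem theorem1 (k n : ℕ) {M : Type*} [TopologicalSpace M]
    [ChartedSpace (EuclideanSpace ℝ (Fin (k * (n + 1)))) M]
    [IsManifold (𝓡 (k * (n + 1))) ω M]
    (w : OnePoint ℝ → (x : M) → Submodule ℝ (TangentSpace (𝓡 (k * (n + 1))) x))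
    (hw : VeroneseWeb.IsGeneralizedVeroneseCurve k n w)
    (hint : ∀ t, VeroneseWeb.IsIntegrableOn (𝓡 (k * (n + 1))) (w t) Set.univ)
    (x : M) :
    ∃ φ ∈ IsManifold.maximalAtlas (𝓡 (k * (n + 1))) ω M, x ∈ φ.source ∧
      -- for every complexification `Z` of the coordinate domain and the extension of `φ` to it
      ∀ {Z : Type*} [TopologicalSpace Z]
        [ChartedSpace (EuclideanSpace ℂ (Fin (k * (n + 1)))) Z]
        [IsManifold 𝓘(ℂ, EuclideanSpace ℂ (Fin (k * (n + 1)))) ω Z]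
        (ι : M → Z) (_ : VeroneseWeb.IsComplexification (k * (n + 1)) φ.source ι)
        (Ω₀ : Set Z) (φc : Z → EuclideanSpace ℂ (Fin (k * (n + 1))))
        (_ : VeroneseWeb.IsHolomorphicExtension φ.source ι φ Ω₀ φc),
      -- a germ of an integrable distribution `F` along the coordinate domain
      ∃ (Ω : Set Z)
        (F : (z : Z) →
          Submodule ℝ (TangentSpace 𝓘(ℝ, EuclideanSpace ℂ (Fin (k * (n + 1)))) z)),
        IsOpen Ω ∧ ι '' φ.source ⊆ Ω ∧ Ω ⊆ Ω₀ ∧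
        (∀ z ∈ Ω, VeroneseWeb.rePart φc z ∈ φ.target) ∧
        VeroneseWeb.IsDistributionOn 𝓘(ℝ, EuclideanSpace ℂ (Fin (k * (n + 1)))) F (k * n) Ω ∧
        VeroneseWeb.IsIntegrableOn 𝓘(ℝ, EuclideanSpace ℂ (Fin (k * (n + 1)))) F Ω ∧
        ∀ t : OnePoint ℝ,
          -- (1) integrability and (2) rank of `(Id + tJ)F`
          VeroneseWeb.IsIntegrableOn 𝓘(ℝ, EuclideanSpace ℂ (Fin (k * (n + 1))))
            (fun z => (F z).map (VeroneseWeb.idAddJ t z).toLinearMap) Ω ∧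
          VeroneseWeb.IsDistributionOn 𝓘(ℝ, EuclideanSpace ℂ (Fin (k * (n + 1))))
            (fun z => (F z).map (VeroneseWeb.idAddJ t z).toLinearMap) (k * n) Ω ∧
          -- (3) projectability of `(Id + tJ)F`
          VeroneseWeb.IsProjectable (VeroneseWeb.leafProjection φ φc) Ω φ.source
            (fun z => (F z).map (VeroneseWeb.idAddJ t z).toLinearMap) ∧
          -- (4) the projection of `(Id - tJ)F`
          VeroneseWeb.ProjectsOnto (VeroneseWeb.leafProjection φ φc) Ω
            (fun z => (F z).map (VeroneseWeb.idSubJ t z).toLinearMap) (w t) := by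
  obtain ⟨φ, hφ, hx, Γ, hΓ, hrect⟩ := exists_rectifying_chart hw hint x
  refine ⟨φ, hφ, hx, ?_⟩
  intro Z _ _ _ ι hι Ω₀ φc hφc
  have hS : ∀ y ∈ φ.target, ∀ (l : Fin (n + 1)) b,
      curveEval k n ((l : ℕ) : ℝ) (Γ y (((l : ℕ) : ℝ) • b - blockScale k n b)) = 0 :=
    fun y hy => curveEval_sub_blockScale (hrect y hy)
  set A : EuclideanSpace ℝ (Fin (k * (n + 1))) →
      EuclideanSpace ℝ (Fin (k * (n + 1))) →L[ℝ] (Fin k → ℝ) :=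
    fun y => (curveEval k n OnePoint.infty).comp (Γ y) with hAdef
  -- The neighbourhood on which the projection takes values in U and dφᶜ is invertible. It contains
  -- the embedded U since there φᶜ is real with values in the target, and dφᶜ, being complex-linear,
  -- extends the invertible dφ.
  set Ω : Set Z := interior {z | z ∈ Ω₀ ∧ reVec _ (φc z) ∈ φ.target ∧
    (vdiff (EuclideanSpace ℂ (Fin (k * (n + 1)))) φc z).IsInvertible} with hΩdef
  have hΩ : IsOpen Ω := isOpen_interior
  have hΩ₀ : Ω ⊆ Ω₀ := fun z hz => (interior_subset hz).1
  have hT : ∀ z ∈ Ω, reVec _ (φc z) ∈ φ.target := fun z hz => (interior_subset hz).2.1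
  have hinv : ∀ z ∈ Ω, (vdiff (EuclideanSpace ℂ (Fin (k * (n + 1)))) φc z).IsInvertible :=
    fun z hz => (interior_subset hz).2.2
  have hhol : ∀ z ∈ Ω₀, ContMDiffAt 𝓘(ℂ, EuclideanSpace ℂ (Fin (k * (n + 1))))
      𝓘(ℂ, EuclideanSpace ℂ (Fin (k * (n + 1)))) ω φc z :=
    fun z hz => hφc.holomorphic.contMDiffAt (hφc.isOpen.mem_nhds hz)
  have hreal : ∀ z ∈ Ω, ContMDiffAt 𝓘(ℝ, EuclideanSpace ℂ (Fin (k * (n + 1))))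
      𝓘(ℝ, EuclideanSpace ℂ (Fin (k * (n + 1)))) ω φc z :=
    fun z hz => (hhol z (hΩ₀ hz)).real_of_complex
  have hιΩ : ι '' φ.source ⊆ Ω := by
    rintro _ ⟨q, hq, rfl⟩
    have hq₀ : ι q ∈ Ω₀ := hφc.image_subset ⟨q, hq, rfl⟩
    have hext : ∀ p ∈ φ.source, φc (ι p) = ofRealVec _ (φ p) := fun p hp => by
      ext j
      exact hφc.extends_coord p hp j
    have hre : reVec _ (φc (ι q)) = φ q := by
      rw [hext q hq]
      ext j
      exact Complex.ofReal_re _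
    have hi : (vdiff (EuclideanSpace ℂ (Fin (k * (n + 1)))) φc (ι q)).IsInvertible :=
      isInvertible_vdiff_of_extension (hhol _ hq₀)
        ((hι.analytic.contMDiffAt (φ.open_source.mem_nhds hq)).mdifferentiableAt (by simp))
        ((contMDiffAt_of_mem_maximalAtlas hφ hq).mdifferentiableAt (by simp))
        (vdiff_isInvertible_of_mem_maximalAtlas hφ hq).1
        (Filter.mem_of_superset (φ.open_source.mem_nhds hq) hext)
    have hcont : ContinuousAt (fun z => reVec _ (φc z)) (ι q) :=
      (reVec _).continuous.continuousAt.comp (hhol _ hq₀).continuousAt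
    refine mem_interior_iff_mem_nhds.2 ?_
    filter_upwards [hφc.isOpen.mem_nhds hq₀,
      hcont.preimage_mem_nhds (φ.open_target.mem_nhds (hre.symm ▸ φ.map_source hq)),
      eventually_isInvertible_vdiff (hhol _ hq₀).real_of_complex hi] with z h1 h2 h3
    exact ⟨h1, h2, h3⟩
  have hdist : ∀ c : ℂ, c ≠ 0 → VeroneseWeb.IsDistributionOn
      𝓘(ℝ, EuclideanSpace ℂ (Fin (k * (n + 1)))) (slantField (blockScale k n) A φc c) (k * n) Ω :=
    fun c hc => isDistributionOn_slantField hc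
      (b := fun a y => (Γ y).inverse (kernelVector k n a))
      (fun a y hy => analyticAt_inverse_apply (hΓ.analyticAt y hy) (hΓ.isInvertible y hy) _)
      (fun y hy => linearIndependent_inverse_kernelVector (hΓ.isInvertible y hy))
      (fun y hy => ker_curveEval_infty_comp (hΓ.isInvertible y hy)) hΩ
      (fun z hz => (hreal z hz).contMDiffWithinAt) hinv hT
  have hintegrable : ∀ c : ℂ, c ≠ 0 → VeroneseWeb.IsIntegrableOn
      𝓘(ℝ, EuclideanSpace ℂ (Fin (k * (n + 1)))) (slantField (blockScale k n) A φc c) Ω := by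
    intro c hc
    refine isIntegrableOn_slantField hc
      (fun y hy => analyticAt_curveEval_comp (hΓ.analyticAt y hy) _) ?_ ?_ hreal hT
    · intro y hy b b' hb hb'
      have hd := (hΓ.analyticAt y hy).differentiableAt
      rw [fderiv_curveEval_comp hd, fderiv_curveEval_comp hd]
      exact hΓ.fderiv_symm hφ hint hy _ hb hb'
    · intro y hy b b' hb hb'
      have hd := (hΓ.analyticAt y hy).differentiableAt
      rw [fderiv_curveEval_comp hd, fderiv_curveEval_comp hd]
      exact hΓ.fderiv_symm_operator hφ hint hS hy hb hb'
  have hadd : ∀ t, ∀ z ∈ Ω, (slantField (blockScale k n) A φc 1 z).map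
      (VeroneseWeb.idAddJ t z).toLinearMap = slantField (blockScale k n) A φc (addParam t) z :=
    fun t z hz => map_slantField (hinv z hz) (vdiff_idAddJ (hhol z (hΩ₀ hz)) t)
  have hsub : ∀ t, ∀ z ∈ Ω, (slantField (blockScale k n) A φc 1 z).map
      (VeroneseWeb.idSubJ t z).toLinearMap = slantField (blockScale k n) A φc (subParam t) z :=
    fun t z hz => map_slantField (hinv z hz) (vdiff_idSubJ (hhol z (hΩ₀ hz)) t)
  have hmd := fun z hz => (hreal z hz).mdifferentiableAt (by simp)
  -- F is the slanted distribution with c = 1; Id ± tJ changes only the factor c.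
  refine ⟨Ω, slantField (blockScale k n) A φc 1, hΩ, hιΩ, hΩ₀, hT, hdist 1 one_ne_zero,
    hintegrable 1 one_ne_zero, fun t => ⟨?_, ?_, ?_, ?_⟩⟩
  · exact VeroneseWeb.IsIntegrableOn.congr (hintegrable _ (addParam_ne_zero t)) (hadd t)
  · exact VeroneseWeb.IsDistributionOn.congr hΩ (hdist _ (addParam_ne_zero t)) (hadd t)
  -- The projection of (Id + tJ)F is w(-t), which is integrable by hypothesis.
  · exact ⟨w (negParam t), ⟨k * n, hΓ.isDistributionOn hφ hS _⟩,
      fun V hV _ => hint _ V hV (subset_univ V),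
      hΓ.projectsOnto hφ hS hmd hinv hT (reVec_slant_addParam _ t) (hadd t)⟩
  · exact hΓ.projectsOnto hφ hS hmd hinv hT (reVec_slant_subParam _ t) (hsub t)
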